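/- Let $u$ be a bounded real-valued classical solution of the heat equation $u_t=u_{xx}$ in the half-plane $H=\mathbb{R}\times(0,\infty)$ that is not identically zero. Put $$Z=\{(x,t)\in H:\ u(x,t)=0\},\qquad Z_{\rm reg}=\{(x,t)\in Z:\ u_t^2+u_x^2\neq 0\},\qquad Z_{\rm sing}=Z\setminus Z_{\rm reg}.$$ By a regular analytic curve in an open set $U\subset H$ we mean a (non-empty) connected one-dimensional real analytic embedded submanifold $C$ of $U$ with $\overline{C}\setminus C\subset\partial U$. Then every point of $Z_{\rm reg}$ has an open neighborhood $U\subset H$ such that $Z\cap U$ is contained in $Z_{\rm reg}$ and is a regular analytic curve in $U$, and these curves can be analytically continued through the points of $Z_{\rm sing}$. In other words, $Z$ is a locally finite union of regular analytic curves in $H$. More precisely, there is a family $\mathcal{F}$ of regular analytic curves in $H$, locally finite in $H$, such that 1. $Z=\bigcup_{C\in\mathcal{F}}C$; 2. whenever $U\subset H$ is open and $\Gamma\subset Z_{\rm reg}$ is a regular analytic curve in $U$, there is a $C\in\mathcal{F}$ with $\Gamma\subset C$; 3. every $p\in Z_{\rm sing}$ has an open neighborhood $U\subset H$ such that each point of $Z\cap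 U$ lies on some $C\in\mathcal{F}$ with $p\in C$. -/

import Mathlib

open Set Topology

/-- The open half-plane `ℝ × (0, ∞)` of points `(x, t)` with `0 < t`. -/
def halfPlane : Set (ℝ × ℝ) := {p | 0 < p.2}

/-- The partial derivative `u_x`. -/
noncomputable def partialX (u : ℝ → ℝ → ℝ) (x t : ℝ) : ℝ := deriv (fun y => u y t) x

/-- The partial derivative `u_t`. -/
noncomputable def partialT (u : ℝ → ℝ → ℝ) (x t : ℝ) : ℝ := deriv (fun s => u x s) t

/-- `u` is a classical (`C^{2,1}`) solution of the heat equation `u_t = u_xx` in `ℝ × (0, ∞)`;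
the values `u x t` with `t ≤ 0` play no role. -/
structure IsHeatSolution (u : ℝ → ℝ → ℝ) : Prop where
  differentiable_x : ∀ x t, 0 < t → DifferentiableAt ℝ (fun y => u y t) x
  differentiable_xx : ∀ x t, 0 < t → DifferentiableAt ℝ (fun y => partialX u y t) x
  differentiable_t : ∀ x t, 0 < t → DifferentiableAt ℝ (fun s => u x s) t
  continuousOn : ContinuousOn (fun p : ℝ × ℝ => u p.1 p.2) halfPlane
  continuousOn_x : ContinuousOn (fun p : ℝ × ℝ => partialX u p.1 p.2) halfPlane
  continuousOn_xx : ContinuousOn (fun p : ℝ × ℝ => partialX (partialX u) p.1 p.2) halfPlane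
  continuousOn_t : ContinuousOn (fun p : ℝ × ℝ => partialT u p.1 p.2) halfPlane
  heat : ∀ x t, 0 < t → partialT u x t = partialX (partialX u) x t

/-- The zero set `Z` of `u` in `ℝ × (0, ∞)`. -/
def zeroSet (u : ℝ → ℝ → ℝ) : Set (ℝ × ℝ) := {p | p ∈ halfPlane ∧ u p.1 p.2 = 0}

/-- The set of regular zeros. -/
def regularZeros (u : ℝ → ℝ → ℝ) : Set (ℝ × ℝ) :=
  {p | p ∈ zeroSet u ∧ partialT u p.1 p.2 ^ 2 + partialX u p.1 p.2 ^ 2 ≠ 0}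

/-- The set of singular zeros. -/
def singularZeros (u : ℝ → ℝ → ℝ) : Set (ℝ × ℝ) := zeroSet u \ regularZeros u

/-- `C` is a one-dimensional real analytic embedded submanifold of the plane: each point of `C`
lies in the domain of a real analytic chart of the plane (a homeomorphism between open sets,
analytic in both directions) which flattens `C` to the line where the second coordinate is `0`. -/
def IsAnalyticSubmanifoldOne (C : Set (ℝ × ℝ)) : Prop :=
  ∀ p ∈ C, ∃ e : OpenPartialHomeomorph (ℝ × ℝ) (ℝ × ℝ),
    p ∈ e.source ∧ AnalyticOnNhd ℝ e e.source ∧ AnalyticOnNhd ℝ e.symm e.target ∧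
      ∀ q ∈ e.source, q ∈ C ↔ (e q).2 = 0

/-- `C` is a regular analytic curve in the (open) set `U`: a connected one-dimensional analytic
embedded submanifold of `U` whose closure adds only boundary points of `U`. -/
structure IsRegularAnalyticCurve (C U : Set (ℝ × ℝ)) : Prop where
  subset : C ⊆ U
  isConnected : IsConnected C
  submanifold : IsAnalyticSubmanifoldOne C
  closure_diff_subset : closure C \ C ⊆ frontier U

/-- The family `F` of sets is locally finite in `U`. -/
def LocallyFiniteIn (F : Set (Set (ℝ × ℝ))) (U : Set (ℝ × ℝ)) : Prop :=
  ∀ p ∈ U, ∃ V ∈ 𝓝 p, {C | C ∈ F ∧ (C ∩ V).Nonempty}.Finite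

/-!
The proof has a local part, which describes the zero set near one zero, and a global part, which
glues the local branches to curves.

*Analyticity.* Near each point `(x₀, t₀)` of the half-plane, a bounded solution is the sum of an
absolutely convergent double power series in which the coefficient of `x ^ j * t ^ k / (j! k!)` is
`W (j + 2 * k)` for a single sequence `W` (`IsHeatSolution.exists_hasHeatSeries`). Indeed, by the
maximum principle the solution is the heat extension of its values at an earlier time, the heat
kernel is a superposition of complex exponentials that solve the heat equation, and the series
results from expanding these exponentials.

*Local structure.* Let `n` be the order of a zero, that is, the least index with `W n ≠ 0`; it exists
because the solution is not identically zero. The parabolic blow-up `u (x₀ + x) (t₀ + x² s) / xⁿ` tends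
to a multiple of the `n`-th heat polynomial in `s`, whose roots are negative and simple by its
differential equation. By the implicit function theorem each root `ρ` yields an analytic branch of
zeros `t = φ x` with `φ x ≈ t₀ + ρ (x - x₀)²`, called a cap. Outside the parabolas
`|t - t₀| ≤ K (x - x₀)²`, a second blow-up shows that there are no zeros if `n` is even, and that the
zeros form one further analytic branch `x = ψ t`, called a stem, if `n` is odd. The result is
`IsHeatSolution.hasBranchingZeros`; all other zeros nearby are regular, and a regular zero lies on
one branch only, because its order is at most two.

*Global structure.* After the time of a zero, the zeros near it lie on its stem. Therefore analytic
arcs of zeros `x = g t` that meet coincide (`IsVerticalArc.eqOn_of_meet`), and each of them lies on a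
maximal one. A maximal arc can end inside the half-plane only at the top of a cap, one half of which
it contains (`IsMaxArc.exists_cap_of_mem_closure`). The curves of the family are the maximal
arcs without such an end, and the unions of the two maximal arcs that end at the two sides of a cap
with the top of the cap. Only one of them passes through a given regular zero
(`eq_of_mem_regularZeros`), while near any zero the zero set is covered by finitely many of those that
pass through it (`exists_finite_cover`). Since singular zeros are isolated, local finiteness follows;
so does the continuation property, because lying on the same curve is a locally constant relation
on a connected set of regular zeros.
-/

/-! ### Absolutely convergent double power series -/

/-- The multilinear map underlying the monomial `x ^ a * t ^ (m - a)` of degree `m`. -/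
noncomputable def monomialMultilinear (a m : ℕ) :
    ContinuousMultilinearMap ℝ (fun _ : Fin m => ℝ × ℝ) ℝ :=
  (ContinuousMultilinearMap.mkPiAlgebra ℝ (Fin m) ℝ).compContinuousLinearMap
    (fun l => if l.1 < a then ContinuousLinearMap.fst ℝ ℝ ℝ else ContinuousLinearMap.snd ℝ ℝ ℝ)

theorem norm_monomialMultilinear_le (a m : ℕ) : ‖monomialMultilinear a m‖ ≤ 1 := by
  refine (ContinuousMultilinearMap.norm_compContinuousLinearMap_le _ _).trans ?_
  have h1 : ‖ContinuousMultilinearMap.mkPiAlgebra ℝ (Fin m) ℝ‖ ≤ 1 := by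
    simp [ContinuousMultilinearMap.norm_mkPiAlgebra]
  refine mul_le_one₀ h1 (by positivity) (Finset.prod_le_one (fun _ _ => by positivity) ?_)
  intro l _
  split_ifs
  · exact ContinuousLinearMap.norm_fst_le ..
  · exact ContinuousLinearMap.norm_snd_le ..

theorem monomialMultilinear_apply_diag (a b : ℕ) (q : ℝ × ℝ) :
    monomialMultilinear a (a + b) (fun _ => q) = q.1 ^ a * q.2 ^ b := by
  simp only [monomialMultilinear, ContinuousMultilinearMap.compContinuousLinearMap_apply,
    ContinuousMultilinearMap.mkPiAlgebra_apply, Fin.prod_univ_add]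
  simp

theorem analyticAt_tsum_monomial_unit {ι : Type*} (c : ι → ℝ) (a b : ι → ℕ)
    (h : Summable fun i => |c i|) {p : ℝ × ℝ} (h1 : |p.1| < 1) (h2 : |p.2| < 1) :
    AnalyticAt ℝ (fun q : ℝ × ℝ => ∑' i, c i * (q.1 ^ a i * q.2 ^ b i)) p := by
  classical
  -- group the monomials by total degree
  let e := Equiv.sigmaFiberEquiv (fun i => a i + b i)
  have hs : Summable fun x : (Σ m, {i // a i + b i = m}) => |c (e x)| := (e.summable_iff).2 h
  have hterm : ∀ m, ∀ i : {i // a i + b i = m},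
      ‖c i.1 • monomialMultilinear (a i.1) m‖ ≤ |c i.1| := by
    intro m i
    rw [norm_smul, Real.norm_eq_abs]
    exact mul_le_of_le_one_right (abs_nonneg _) (norm_monomialMultilinear_le _ _)
  have hfib : ∀ m, Summable fun i : {i // a i + b i = m} => |c i.1| := fun m => hs.sigma_factor m
  let P : FormalMultilinearSeries ℝ (ℝ × ℝ) ℝ := fun m =>
    ∑' i : {i // a i + b i = m}, c i.1 • monomialMultilinear (a i.1) m
  have hPs : ∀ m, Summable fun i : {i // a i + b i = m} =>
      c i.1 • monomialMultilinear (a i.1) m := fun m => .of_norm_bounded (hfib m) (hterm m)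
  have hP : HasFPowerSeriesOnBall (fun q : ℝ × ℝ => ∑' i, c i * (q.1 ^ a i * q.2 ^ b i)) P 0 1 := by
    refine ⟨?_, one_pos, ?_⟩
    · have : ((1 : NNReal) : ENNReal) ≤ P.radius := by
        refine P.le_radius_of_summable_norm ?_
        refine Summable.of_nonneg_of_le (fun m => by positivity) (fun m => ?_) hs.sigma
        simp only [NNReal.coe_one, one_pow, mul_one]
        exact tsum_of_norm_bounded (hfib m).hasSum (hterm m)
      simpa using this
    · intro y hy
      have hy' : |y.1| ≤ 1 ∧ |y.2| ≤ 1 := by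
        have : ‖y‖ < 1 := by
          simpa [Metric.eball, edist_zero_right, ← ofReal_norm] using hy
        rw [Prod.norm_def, max_lt_iff] at this
        exact ⟨this.1.le, this.2.le⟩
      have habs : Summable fun i => c i * (y.1 ^ a i * y.2 ^ b i) := by
        refine .of_norm_bounded h fun i => ?_
        rw [Real.norm_eq_abs, abs_mul, abs_mul, abs_pow, abs_pow]
        refine mul_le_of_le_one_right (abs_nonneg _) (mul_le_one₀ ?_ (by positivity) ?_)
        · exact pow_le_one₀ (abs_nonneg _) hy'.1
        · exact pow_le_one₀ (abs_nonneg _) hy'.2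
      have hsum := (e.hasSum_iff).2 habs.hasSum
      rw [zero_add]
      refine hsum.sigma fun m => ?_
      have := (ContinuousMultilinearMap.apply ℝ (fun _ : Fin m => ℝ × ℝ) ℝ
        (fun _ => y)).hasSum (hPs m).hasSum
      convert! this using 1
      funext i
      obtain ⟨i, rfl⟩ := i
      simp [e, monomialMultilinear_apply_diag]
  refine hP.analyticAt_of_mem ?_
  have : ‖p‖ < 1 := by rw [Prod.norm_def]; exact max_lt h1 h2
  simpa [Metric.eball, edist_zero_right, ← ofReal_norm] using this

/-- The sum of a double power series is analytic in the interior of a bidisc where the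
series converges absolutely. The monomials may be indexed by any type, with repetitions. -/
theorem analyticAt_tsum_monomial {ι : Type*} (c : ι → ℝ) (a b : ι → ℕ) {r s : ℝ} (hr : 0 < r)
    (hs : 0 < s) (h : Summable fun i => |c i| * (r ^ a i * s ^ b i)) {p : ℝ × ℝ}
    (h1 : |p.1| < r) (h2 : |p.2| < s) :
    AnalyticAt ℝ (fun q : ℝ × ℝ => ∑' i, c i * (q.1 ^ a i * q.2 ^ b i)) p := by
  have key := analyticAt_tsum_monomial_unit (fun i => c i * (r ^ a i * s ^ b i)) a b
    (by simpa [abs_mul, abs_of_pos hr, abs_of_pos hs] using h) (p := (p.1 / r, p.2 / s))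
    (by rw [abs_div, abs_of_pos hr]; exact (div_lt_one hr).2 h1)
    (by rw [abs_div, abs_of_pos hs]; exact (div_lt_one hs).2 h2)
  have hlin : AnalyticAt ℝ (fun q : ℝ × ℝ => (q.1 / r, q.2 / s)) p := by
    exact (analyticAt_fst.div_const).prod (analyticAt_snd.div_const)
  have := key.comp_of_eq hlin rfl
  refine this.congr (Filter.Eventually.of_forall fun q => ?_)
  simp only [Function.comp]
  refine tsum_congr fun i => ?_
  rw [div_pow, div_pow]
  field_simp

theorem succ_le_two_pow (j : ℕ) : ((j : ℝ) + 1) ≤ 2 ^ j := by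
  exact_mod_cast Nat.succ_le_of_lt j.lt_two_pow_self

theorem summable_deriv_fst {c : ℕ × ℕ → ℝ} {r : ℝ} (hr : 0 < r)
    (h : Summable fun i : ℕ × ℕ => |c i| * (r ^ i.1 * r ^ i.2)) :
    Summable fun i : ℕ × ℕ =>
      |((i.1 : ℝ) + 1) * c (i.1 + 1, i.2)| * ((r / 2) ^ i.1 * (r / 2) ^ i.2) := by
  have hinj : Function.Injective fun i : ℕ × ℕ => (i.1 + 1, i.2) := by
    rintro ⟨a, b⟩ ⟨a', b'⟩ h
    simpa using h
  refine Summable.of_nonneg_of_le (fun i => by positivity) (fun i => ?_)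
    ((h.comp_injective hinj).mul_left r⁻¹)
  obtain ⟨j, k⟩ := i
  simp only [Function.comp]
  have h1 : ((j : ℝ) + 1) * (r / 2) ^ j ≤ r ^ j := by
    rw [div_pow, mul_div_assoc', div_le_iff₀ (by positivity), mul_comm]
    exact mul_le_mul_of_nonneg_left (succ_le_two_pow j) (by positivity)
  have h2 : (r / 2) ^ k ≤ r ^ k := by gcongr; linarith
  rw [abs_mul, abs_of_nonneg (by positivity : (0 : ℝ) ≤ (j : ℝ) + 1)]
  calc ((j : ℝ) + 1) * |c (j + 1, k)| * ((r / 2) ^ j * (r / 2) ^ k)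
      = |c (j + 1, k)| * ((((j : ℝ) + 1) * (r / 2) ^ j) * (r / 2) ^ k) := by ring
    _ ≤ |c (j + 1, k)| * (r ^ j * r ^ k) := by gcongr
    _ = r⁻¹ * (|c (j + 1, k)| * (r ^ (j + 1) * r ^ k)) := by rw [pow_succ]; field_simp

/-- Termwise differentiation of a double power series in the first variable. -/
theorem hasDerivAt_tsum_fst {c : ℕ × ℕ → ℝ} {r : ℝ} (hr : 0 < r)
    (h : Summable fun i : ℕ × ℕ => |c i| * (r ^ i.1 * r ^ i.2)) {x t : ℝ} (hx : |x| < r / 2)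
    (ht : |t| < r / 2) :
    HasDerivAt (fun y => ∑' i : ℕ × ℕ, c i * (y ^ i.1 * t ^ i.2))
      (∑' i : ℕ × ℕ, ((i.1 : ℝ) + 1) * c (i.1 + 1, i.2) * (x ^ i.1 * t ^ i.2)) x := by
  have hinj : Function.Injective fun i : ℕ × ℕ => (i.1 + 1, i.2) := by
    rintro ⟨a, b⟩ ⟨a', b'⟩ h
    simpa using h
  have hr2 : 0 < r / 2 := by positivity
  have hsupp : ∀ g : ℕ × ℕ → ℝ, (∀ k, g (0, k) = 0) →
      Function.support g ⊆ Set.range fun i : ℕ × ℕ => (i.1 + 1, i.2) := by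
    rintro g hg ⟨j, k⟩ hjk
    rcases j with _ | j
    · exact absurd (hg k) hjk
    · exact ⟨(j, k), rfl⟩
  let g' : ℕ × ℕ → ℝ → ℝ := fun i y => c i * ((i.1 : ℝ) * y ^ (i.1 - 1) * t ^ i.2)
  let U : ℕ × ℕ → ℝ := fun i => |c i| * ((i.1 : ℝ) * (r / 2) ^ (i.1 - 1) * (r / 2) ^ i.2)
  have hU : Summable U := by
    refine (hinj.summable_iff (fun i hi => ?_)).1 ?_
    · by_contra hne
      exact hi (hsupp U (by simp [U]) hne)
    · refine (summable_deriv_fst hr h).congr fun i => ?_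
      rw [abs_mul, abs_of_nonneg (by positivity : (0 : ℝ) ≤ (i.1 : ℝ) + 1)]
      simp only [U, Function.comp, Nat.add_sub_cancel, Nat.cast_add, Nat.cast_one]
      ring
  have key := hasDerivAt_tsum_of_isPreconnected (g := fun i y => c i * (y ^ i.1 * t ^ i.2))
    (g' := g') (u := U) (t := Metric.ball (0 : ℝ) (r / 2)) (y₀ := 0) (y := x) hU
    Metric.isOpen_ball (convex_ball _ _).isPreconnected ?_ ?_ (by simpa using hr) ?_
    (by simpa using hx)
  · convert! key using 1
    rw [← hinj.tsum_eq (f := fun i => g' i x) (hsupp _ (by simp [g']))]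
    refine tsum_congr fun i => ?_
    simp only [g', Nat.add_sub_cancel, Nat.cast_add, Nat.cast_one]
    ring
  · intro i y _
    exact ((hasDerivAt_pow i.1 y).mul_const _).const_mul _
  · intro i y hy
    have hy' : |y| < r / 2 := by simpa using hy
    simp only [g', U, Real.norm_eq_abs, abs_mul, abs_pow, Nat.abs_cast]
    gcongr
  · refine .of_norm_bounded h fun i => ?_
    rw [Real.norm_eq_abs, abs_mul, abs_mul, abs_pow, abs_pow, abs_zero]
    have : |t| ≤ r := by linarith
    gcongr

/-! ### Heat series -/

/-- The coefficients `W (j + 2 k) / (j! k!)` of a solution of the heat equation whose `m`-th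
derivative in the space variable at the centre is `W m`. -/
noncomputable def heatCoeff (W : ℕ → ℝ) (i : ℕ × ℕ) : ℝ :=
  W (i.1 + 2 * i.2) / ((i.1.factorial : ℝ) * (i.2.factorial : ℝ))

/-- `u` is the sum of the heat series with data `W` in the bidisc of radius `r` about `(x₀, t₀)`,
and the series converges absolutely there. -/
structure HasHeatSeries (u : ℝ → ℝ → ℝ) (W : ℕ → ℝ) (r x₀ t₀ : ℝ) : Prop where
  pos : 0 < r
  summable : Summable fun i : ℕ × ℕ => |heatCoeff W i| * (r ^ i.1 * r ^ i.2)
  eq_tsum : ∀ x t, |x - x₀| < r → |t - t₀| < r →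
    u x t = ∑' i : ℕ × ℕ, heatCoeff W i * ((x - x₀) ^ i.1 * (t - t₀) ^ i.2)

theorem heatCoeff_succ_fst (W : ℕ → ℝ) (i : ℕ × ℕ) :
    ((i.1 : ℝ) + 1) * heatCoeff W (i.1 + 1, i.2) = heatCoeff (fun m => W (m + 1)) i := by
  simp only [heatCoeff, Nat.factorial_succ]
  rw [show i.1 + 1 + 2 * i.2 = i.1 + 2 * i.2 + 1 by ring]
  push_cast
  field_simp

theorem heatCoeff_succ_snd (W : ℕ → ℝ) (i : ℕ × ℕ) :
    ((i.2 : ℝ) + 1) * heatCoeff W (i.1, i.2 + 1) = heatCoeff (fun m => W (m + 2)) i := by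
  simp only [heatCoeff, Nat.factorial_succ]
  rw [show i.1 + 2 * (i.2 + 1) = i.1 + 2 * i.2 + 2 by ring]
  push_cast
  field_simp

namespace HasHeatSeries

variable {u : ℝ → ℝ → ℝ} {W : ℕ → ℝ} {r x₀ t₀ : ℝ}

theorem hasDerivAt_fst (h : HasHeatSeries u W r x₀ t₀) {x t : ℝ} (hx : |x - x₀| < r / 2)
    (ht : |t - t₀| < r / 2) :
    HasDerivAt (fun y => u y t) (∑' i : ℕ × ℕ, heatCoeff (fun m => W (m + 1)) i *
      ((x - x₀) ^ i.1 * (t - t₀) ^ i.2)) x := by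
  have hr := h.pos
  have key := hasDerivAt_tsum_fst hr h.summable hx ht
  simp only [heatCoeff_succ_fst] at key
  have key2 := key.comp_sub_const x x₀
  refine key2.congr_of_eventuallyEq ?_
  have : ∀ᶠ y in 𝓝 x, |y - x₀| < r :=
    (isOpen_lt (by fun_prop) continuous_const).mem_nhds (show |x - x₀| < r by linarith)
  filter_upwards [this] with y hy
  exact h.eq_tsum y t hy (by linarith)

theorem hasDerivAt_snd (h : HasHeatSeries u W r x₀ t₀) {x t : ℝ} (hx : |x - x₀| < r / 2)
    (ht : |t - t₀| < r / 2) :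
    HasDerivAt (fun s => u x s) (∑' i : ℕ × ℕ, heatCoeff (fun m => W (m + 2)) i *
      ((x - x₀) ^ i.1 * (t - t₀) ^ i.2)) t := by
  have hr := h.pos
  have hswap := (Equiv.prodComm ℕ ℕ).summable_iff.2 h.summable
  have key := hasDerivAt_tsum_fst (c := fun i => heatCoeff W i.swap) hr
    (hswap.congr fun i => by simp [mul_comm]) ht hx
  have key2 := key.comp_sub_const t t₀
  convert! key2.congr_of_eventuallyEq ?_ using 1
  · rw [← (Equiv.prodComm ℕ ℕ).tsum_eq]
    refine tsum_congr fun i => ?_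
    rw [← heatCoeff_succ_snd]
    simp only [Equiv.prodComm_apply, Prod.fst_swap, Prod.snd_swap, Prod.swap_prod_mk]
    ring
  · have : ∀ᶠ y in 𝓝 t, |y - t₀| < r :=
      (isOpen_lt (by fun_prop) continuous_const).mem_nhds (show |t - t₀| < r by linarith)
    filter_upwards [this] with y hy
    rw [h.eq_tsum x y (by linarith) hy, ← (Equiv.prodComm ℕ ℕ).tsum_eq]
    refine tsum_congr fun i => ?_
    simp only [Equiv.prodComm_apply, Prod.fst_swap, Prod.snd_swap]
    ring

theorem partialX (h : HasHeatSeries u W r x₀ t₀) :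
    HasHeatSeries (partialX u) (fun m => W (m + 1)) (r / 2) x₀ t₀ where
  pos := half_pos h.pos
  summable := by
    refine (summable_deriv_fst h.pos h.summable).congr fun i => ?_
    rw [heatCoeff_succ_fst]
  eq_tsum x t hx ht := (h.hasDerivAt_fst hx ht).deriv

theorem partialT (h : HasHeatSeries u W r x₀ t₀) :
    HasHeatSeries (partialT u) (fun m => W (m + 2)) (r / 2) x₀ t₀ where
  pos := half_pos h.pos
  summable := by
    have hswap := (Equiv.prodComm ℕ ℕ).summable_iff.2 h.summable
    have := summable_deriv_fst (c := fun i => heatCoeff W i.swap) h.pos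
      (hswap.congr fun i => by simp [mul_comm])
    refine ((Equiv.prodComm ℕ ℕ).summable_iff.2 this).congr fun i => ?_
    rw [← heatCoeff_succ_snd]
    simp only [Function.comp, Equiv.prodComm_apply, Prod.fst_swap, Prod.snd_swap,
      Prod.swap_prod_mk]
    ring
  eq_tsum x t hx ht := (h.hasDerivAt_snd hx ht).deriv

theorem analyticAt (h : HasHeatSeries u W r x₀ t₀) :
    AnalyticAt ℝ (fun p : ℝ × ℝ => u p.1 p.2) (x₀, t₀) := by
  have key := analyticAt_tsum_monomial (heatCoeff W) Prod.fst Prod.snd h.pos h.pos h.summable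
    (p := (0, 0)) (by simpa using h.pos) (by simpa using h.pos)
  have hlin : AnalyticAt ℝ (fun q : ℝ × ℝ => (q.1 - x₀, q.2 - t₀)) (x₀, t₀) :=
    (analyticAt_fst.sub analyticAt_const).prod (analyticAt_snd.sub analyticAt_const)
  have := key.comp_of_eq hlin (by simp)
  refine this.congr ?_
  have h1 : ∀ᶠ q : ℝ × ℝ in 𝓝 (x₀, t₀), |q.1 - x₀| < r :=
    (isOpen_lt (by fun_prop) continuous_const).mem_nhds (by simpa using h.pos)
  have h2 : ∀ᶠ q : ℝ × ℝ in 𝓝 (x₀, t₀), |q.2 - t₀| < r :=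
    (isOpen_lt (by fun_prop) continuous_const).mem_nhds (by simpa using h.pos)
  filter_upwards [h1, h2] with q hq1 hq2
  rw [h.eq_tsum _ _ hq1 hq2, Function.comp]

end HasHeatSeries

theorem HasSum.mul_of_summable_norm_nat {R : Type*} [NormedField R] [CompleteSpace R]
    {f g : ℕ → R} {s t : R}
    (hf : HasSum f s) (hg : HasSum g t) (hf' : Summable fun n => ‖f n‖)
    (hg' : Summable fun n => ‖g n‖) : HasSum (fun i : ℕ × ℕ => f i.1 * g i.2) (s * t) :=
  hf.mul hg (summable_mul_of_summable_norm hf' hg')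

theorem Real.hasSum_pow_div_factorial (y : ℝ) :
    HasSum (fun n : ℕ => y ^ n / n.factorial) (Real.exp y) := by
  rw [Real.exp_eq_exp_ℝ]
  exact NormedSpace.expSeries_div_hasSum_exp y

theorem Complex.hasSum_pow_div_factorial (y : ℂ) :
    HasSum (fun n : ℕ => y ^ n / n.factorial) (Complex.exp y) := by
  rw [Complex.exp_eq_exp_ℂ]
  exact NormedSpace.expSeries_div_hasSum_exp y

theorem hasSum_exp_mul_exp (a b : ℝ) :
    HasSum (fun i : ℕ × ℕ => a ^ i.1 / i.1.factorial * (b ^ i.2 / i.2.factorial))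
      (Real.exp a * Real.exp b) := by
  have := HasSum.mul_of_summable_norm_nat (Real.hasSum_pow_div_factorial a)
    (Real.hasSum_pow_div_factorial b) (NormedSpace.norm_expSeries_div_summable a)
    (NormedSpace.norm_expSeries_div_summable b)
  exact this

theorem hasSum_cexp_mul_cexp (a b : ℂ) :
    HasSum (fun i : ℕ × ℕ => a ^ i.1 / i.1.factorial * (b ^ i.2 / i.2.factorial))
      (Complex.exp a * Complex.exp b) := by
  have := HasSum.mul_of_summable_norm_nat (Complex.hasSum_pow_div_factorial a)
    (Complex.hasSum_pow_div_factorial b) (NormedSpace.norm_expSeries_div_summable a)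
    (NormedSpace.norm_expSeries_div_summable b)
  exact this

open MeasureTheory in
/-- A superposition of the exponential solutions `exp (Λ x + Λ² t)`, `Λ` complex, of the heat
equation is the sum of its heat series: the exponential series may be integrated term by term. -/
theorem hasHeatSeries_of_superposition {Ω : Type*} [MeasurableSpace Ω] {μ : Measure Ω}
    {F : Ω → ℝ} {Λ : Ω → ℂ} (hF : AEStronglyMeasurable F μ) (hΛ : AEStronglyMeasurable Λ μ)
    {u : ℝ → ℝ → ℝ} {r x₀ t₀ : ℝ} (hr : 0 < r)
    (hint : Integrable (fun ω => |F ω| * Real.exp (r * ‖Λ ω‖ + r * ‖Λ ω‖ ^ 2)) μ)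
    (hu : ∀ x t, |x - x₀| < r → |t - t₀| < r →
      u x t = ∫ ω, F ω * (Complex.exp (Λ ω * (x - x₀ : ℝ) + Λ ω ^ 2 * (t - t₀ : ℝ))).re ∂μ) :
    HasHeatSeries u (fun m => ∫ ω, F ω * ((Λ ω) ^ m).re ∂μ) r x₀ t₀ := by
  -- the majorant of the terms of the double exponential series
  let B : ℕ × ℕ → Ω → ℝ := fun i ω =>
    |F ω| * ((r * ‖Λ ω‖) ^ i.1 / i.1.factorial * ((r * ‖Λ ω‖ ^ 2) ^ i.2 / i.2.factorial))
  have hF' := hF.aemeasurable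
  have hΛ' := hΛ.aemeasurable
  have hBmeas : ∀ i, AEStronglyMeasurable (B i) μ := fun i =>
    AEMeasurable.aestronglyMeasurable (by fun_prop)
  have hB0 : ∀ i ω, 0 ≤ B i ω := fun i ω => by positivity
  have hBsum : ∀ ω, HasSum (fun i => B i ω)
      (|F ω| * Real.exp (r * ‖Λ ω‖ + r * ‖Λ ω‖ ^ 2)) := by
    intro ω
    rw [Real.exp_add]
    exact (hasSum_exp_mul_exp (r * ‖Λ ω‖) (r * ‖Λ ω‖ ^ 2)).mul_left _
  have hBint : ∀ i, Integrable (B i) μ := fun i => by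
    refine hint.mono' (hBmeas i) (Filter.Eventually.of_forall fun ω => ?_)
    rw [Real.norm_of_nonneg (hB0 i ω)]
    exact le_hasSum (hBsum ω) i fun j _ => hB0 j ω
  have hBtot : Summable fun i => ∫ ω, B i ω ∂μ := by
    refine summable_of_sum_le (c := ∫ ω, |F ω| * Real.exp (r * ‖Λ ω‖ + r * ‖Λ ω‖ ^ 2) ∂μ)
      (fun i => integral_nonneg (hB0 i)) fun S => ?_
    rw [← integral_finsetSum _ fun i _ => hBint i]
    exact integral_mono (integrable_finsetSum _ fun i _ => hBint i) hint fun ω =>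
      sum_le_hasSum S (fun i _ => hB0 i ω) (hBsum ω)
  -- the terms of the series
  let T : ℝ → ℝ → ℕ × ℕ → Ω → ℝ := fun h s i ω =>
    F ω * ((Λ ω) ^ (i.1 + 2 * i.2)).re *
      ((h ^ i.1 * s ^ i.2) / ((i.1.factorial : ℝ) * i.2.factorial))
  have hTmeas : ∀ h s i, AEStronglyMeasurable (T h s i) μ := fun h s i =>
    AEMeasurable.aestronglyMeasurable (by fun_prop)
  have hTle : ∀ h s, |h| ≤ r → |s| ≤ r → ∀ i ω, ‖T h s i ω‖ ≤ B i ω := by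
    intro h s hh hs i ω
    simp only [T, B, Real.norm_eq_abs, abs_mul, abs_div, abs_pow, Nat.abs_cast]
    have h1 : |((Λ ω) ^ (i.1 + 2 * i.2)).re| ≤ ‖Λ ω‖ ^ (i.1 + 2 * i.2) := by
      rw [← norm_pow]; exact Complex.abs_re_le_norm _
    calc |F ω| * |((Λ ω) ^ (i.1 + 2 * i.2)).re| *
          ((|h| ^ i.1 * |s| ^ i.2) / ((i.1.factorial : ℝ) * i.2.factorial))
        ≤ |F ω| * ‖Λ ω‖ ^ (i.1 + 2 * i.2) *
          ((r ^ i.1 * r ^ i.2) / ((i.1.factorial : ℝ) * i.2.factorial)) := by gcongr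
      _ = _ := by rw [pow_add, pow_mul, mul_pow, mul_pow]; field_simp
  have hTint : ∀ h s, |h| ≤ r → |s| ≤ r → ∀ i, Integrable (T h s i) μ := fun h s hh hs i =>
    (hBint i).mono' (hTmeas h s i) (Filter.Eventually.of_forall (hTle h s hh hs i))
  have hTtot : ∀ h s, |h| ≤ r → |s| ≤ r → Summable fun i => ∫ ω, ‖T h s i ω‖ ∂μ := by
    intro h s hh hs
    exact Summable.of_nonneg_of_le (fun i => integral_nonneg fun ω => norm_nonneg _)
      (fun i => integral_mono (hTint h s hh hs i).norm (hBint i) (hTle h s hh hs i)) hBtot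
  have hTsum : ∀ h s ω, HasSum (fun i => T h s i ω)
      (F ω * (Complex.exp (Λ ω * (h : ℝ) + Λ ω ^ 2 * (s : ℝ))).re) := by
    intro h s ω
    have hprod := hasSum_cexp_mul_cexp (Λ ω * (h : ℝ)) (Λ ω ^ 2 * (s : ℝ))
    rw [← Complex.exp_add] at hprod
    have := (Complex.hasSum_re hprod).mul_left (F ω)
    refine this.congr_fun fun i => ?_
    have e : (Λ ω * (h : ℝ)) ^ i.1 / (i.1.factorial : ℂ) *
        ((Λ ω ^ 2 * (s : ℝ)) ^ i.2 / (i.2.factorial : ℂ)) = (Λ ω) ^ (i.1 + 2 * i.2) *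
        ((h ^ i.1 * s ^ i.2 / ((i.1.factorial : ℝ) * i.2.factorial) : ℝ) : ℂ) := by
      push_cast
      rw [pow_add, pow_mul, mul_pow, mul_pow]
      field_simp
    simp only [T]
    rw [e, Complex.re_mul_ofReal, mul_assoc]
  have hW : ∀ h s i, ∫ ω, T h s i ω ∂μ =
      heatCoeff (fun m => ∫ ω, F ω * ((Λ ω) ^ m).re ∂μ) i * (h ^ i.1 * s ^ i.2) := by
    intro h s i
    simp only [T, heatCoeff, integral_mul_const]
    ring
  refine ⟨hr, ?_, fun x t hx ht => ?_⟩
  · refine (Summable.of_nonneg_of_le (fun i => by positivity) (fun i => ?_)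
      (hTtot r r (abs_of_pos hr).le (abs_of_pos hr).le))
    have := norm_integral_le_integral_norm (μ := μ) (T r r i)
    rw [hW, Real.norm_eq_abs, abs_mul, abs_of_pos (by positivity : 0 < r ^ i.1 * r ^ i.2)] at this
    exact this
  · have := hasSum_integral_of_summable_integral_norm
      (hTint (x - x₀) (t - t₀) hx.le ht.le) (hTtot (x - x₀) (t - t₀) hx.le ht.le)
    rw [hu x t hx ht]
    simp only [hW, (hTsum _ _ _).tsum_eq] at this
    exact this.tsum_eq.symm

open MeasureTheory ProbabilityTheory in
/-- The solution of the heat equation at time `τ ≥ 0` with bounded initial data `f`, in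
probabilistic form: the mean of `f (x + √(2 τ) Z)` for a standard normal variable `Z`. -/
noncomputable def heatExtension (f : ℝ → ℝ) (τ x : ℝ) : ℝ :=
  ∫ z, f (x + √(2 * τ) * z) * gaussianPDFReal 0 1 z

open MeasureTheory ProbabilityTheory in
theorem continuous_heatExtension {f : ℝ → ℝ} (hf : Continuous f) {M : ℝ} (hM : ∀ x, |f x| ≤ M) :
    Continuous fun p : ℝ × ℝ => heatExtension f p.2 p.1 := by
  unfold heatExtension
  refine continuous_of_dominated (bound := fun z => M * gaussianPDFReal 0 1 z) (fun p => ?_)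
    (fun p => Filter.Eventually.of_forall fun z => ?_) ((integrable_gaussianPDFReal 0 1).const_mul M)
    (Filter.Eventually.of_forall fun z => by fun_prop)
  · exact (Continuous.aestronglyMeasurable (by fun_prop)).mul
      (integrable_gaussianPDFReal 0 1).aestronglyMeasurable
  · rw [norm_mul, Real.norm_eq_abs, Real.norm_of_nonneg (gaussianPDFReal_nonneg 0 1 z)]
    exact mul_le_mul_of_nonneg_right (hM _) (gaussianPDFReal_nonneg 0 1 z)

open MeasureTheory ProbabilityTheory in
theorem heatExtension_zero (f : ℝ → ℝ) (x : ℝ) : heatExtension f 0 x = f x := by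
  simp [heatExtension, integral_const_mul, integral_gaussianPDFReal_eq_one]

open MeasureTheory ProbabilityTheory in
theorem abs_heatExtension_le {f : ℝ → ℝ} {M : ℝ} (hM : ∀ x, |f x| ≤ M) (τ x : ℝ) :
    |heatExtension f τ x| ≤ M := by
  have := norm_integral_le_of_norm_le (f := fun z => f (x + √(2 * τ) * z) * gaussianPDFReal 0 1 z)
    ((integrable_gaussianPDFReal 0 1).const_mul M) (Filter.Eventually.of_forall fun z => by
      rw [norm_mul, Real.norm_eq_abs, Real.norm_of_nonneg (gaussianPDFReal_nonneg 0 1 z)]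
      exact mul_le_mul_of_nonneg_right (hM _) (gaussianPDFReal_nonneg 0 1 z))
  rwa [integral_const_mul, integral_gaussianPDFReal_eq_one 0 one_ne_zero, mul_one] at this

open MeasureTheory ProbabilityTheory in
/-- The heat kernel form of `heatExtension`. -/
theorem heatExtension_eq_integral_kernel (f : ℝ → ℝ) {τ : ℝ} (hτ : 0 < τ) (x : ℝ) :
    heatExtension f τ x =
      ∫ y, f y * ((√(4 * Real.pi * τ))⁻¹ * Real.exp (-(x - y) ^ 2 / (4 * τ))) := by
  have hc : 0 < √(2 * τ) := by positivity
  have h1 := Measure.integral_comp_mul_left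
    (fun y => f (x + y) * ((√(4 * Real.pi * τ))⁻¹ * Real.exp (-(x - (x + y)) ^ 2 / (4 * τ)))) (√(2 * τ))
  have h2 := integral_add_left_eq_self (μ := volume)
    (fun y => f y * ((√(4 * Real.pi * τ))⁻¹ * Real.exp (-(x - y) ^ 2 / (4 * τ)))) x
  rw [h2, abs_of_pos (by positivity), smul_eq_mul, eq_inv_mul_iff_mul_eq₀ hc.ne'] at h1
  rw [← h1, ← integral_const_mul, heatExtension]
  congr 1
  funext z
  have e1 : -(x - (x + √(2 * τ) * z)) ^ 2 / (4 * τ) = -(z - 0) ^ 2 / (2 * ((1 : NNReal) : ℝ)) := by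
    have : (√(2 * τ)) ^ 2 = 2 * τ := Real.sq_sqrt (by positivity)
    rw [show -(x - (x + √(2 * τ) * z)) ^ 2 = -((√(2 * τ)) ^ 2 * z ^ 2) by ring, this]
    simp only [NNReal.coe_one]
    field_simp
    ring
  have e2 : √(4 * Real.pi * τ) = √(2 * τ) * √(2 * Real.pi * ((1 : NNReal) : ℝ)) := by
    rw [← Real.sqrt_mul (by positivity)]
    congr 1
    simp only [NNReal.coe_one]
    ring
  rw [gaussianPDFReal, e1, e2]
  field_simp

open MeasureTheory in
/-- The heat kernel at time `τ + σ` as a superposition of exponential solutions: the Fourier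
representation of the kernel, with the path of integration shifted to the saddle point of the
kernel at time `τ`. -/
theorem integral_exp_saddle {τ σ : ℝ} (hτ : 0 < τ) (hσ : |σ| < τ) (z h : ℝ) :
    ∫ ξ : ℝ, Real.exp (-z ^ 2 / (4 * τ) - τ * ξ ^ 2) *
      (Complex.exp ((-z / (2 * τ) + ξ * Complex.I) * h + (-z / (2 * τ) + ξ * Complex.I) ^ 2 * σ)).re
      = √(Real.pi / (τ + σ)) * Real.exp (-(z + h) ^ 2 / (4 * (τ + σ))) := by
  have hT : 0 < τ + σ := by linarith [neg_abs_le σ]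
  have key := integral_cexp_quadratic (b := -((τ + σ : ℝ) : ℂ)) (by simp; linarith)
    (((h - z * σ / τ : ℝ) : ℂ) * Complex.I)
    ((-z ^ 2 / (4 * τ) - z * h / (2 * τ) + z ^ 2 * σ / (4 * τ ^ 2) : ℝ) : ℂ)
  have hre : ∀ ξ : ℝ, Real.exp (-z ^ 2 / (4 * τ) - τ * ξ ^ 2) *
      (Complex.exp ((-z / (2 * τ) + ξ * Complex.I) * h +
        (-z / (2 * τ) + ξ * Complex.I) ^ 2 * σ)).re =
      (Complex.exp (-((τ + σ : ℝ) : ℂ) * ξ ^ 2 + ((h - z * σ / τ : ℝ) : ℂ) * Complex.I * ξ +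
      ((-z ^ 2 / (4 * τ) - z * h / (2 * τ) + z ^ 2 * σ / (4 * τ ^ 2) : ℝ) : ℂ))).re := by
    intro ξ
    rw [← Complex.re_ofReal_mul, Complex.ofReal_exp, ← Complex.exp_add]
    congr 2
    have : (τ : ℂ) ≠ 0 := by exact_mod_cast hτ.ne'
    push_cast
    field_simp
    ring_nf
    rw [Complex.I_sq]
    ring
  have hI : Integrable fun ξ : ℝ => Complex.exp (-((τ + σ : ℝ) : ℂ) * ξ ^ 2 +
      ((h - z * σ / τ : ℝ) : ℂ) * Complex.I * ξ +
      ((-z ^ 2 / (4 * τ) - z * h / (2 * τ) + z ^ 2 * σ / (4 * τ ^ 2) : ℝ) : ℂ)) :=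
    integrable_cexp_quadratic' (by simp; linarith) _ _
  simp_rw [hre]
  have := integral_re hI
  simp only [RCLike.re_to_complex] at this
  rw [this, key, neg_neg]
  have e1 : ((Real.pi : ℂ) / ((τ + σ : ℝ) : ℂ)) ^ ((1 : ℂ) / 2) = ((√(Real.pi / (τ + σ)) : ℝ) : ℂ) := by
    rw [Real.sqrt_eq_rpow, Complex.ofReal_cpow (by positivity)]
    push_cast
    rfl
  rw [e1, Complex.re_ofReal_mul]
  congr 1
  rw [← Complex.exp_ofReal_re]
  congr 2
  have h1 : (τ : ℂ) ≠ 0 := by exact_mod_cast hτ.ne'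
  have h2 : (τ : ℂ) + σ ≠ 0 := by exact_mod_cast hT.ne'
  push_cast
  field_simp
  ring_nf
  rw [Complex.I_sq]
  ring

open MeasureTheory in
/-- For positive times, the heat extension is a superposition of exponential solutions, with the
heat kernel written as in `integral_exp_saddle`. -/
theorem hasHeatSeries_heatExtension {f : ℝ → ℝ} (hf : Continuous f) {M : ℝ}
    (hM : ∀ x, |f x| ≤ M) {s t₀ : ℝ} (hs : s < t₀) (x₀ : ℝ) :
    ∃ W r, HasHeatSeries (fun x t => heatExtension f (t - s) x) W r x₀ t₀ := by
  obtain ⟨τ, hτ⟩ : ∃ τ, τ = t₀ - s := ⟨_, rfl⟩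
  have hτ0 : 0 < τ := by linarith
  have hM0 : 0 ≤ M := (abs_nonneg _).trans (hM 0)
  let F : ℝ × ℝ → ℝ := fun ω =>
    (2 * Real.pi)⁻¹ * f ω.1 * Real.exp (-(x₀ - ω.1) ^ 2 / (4 * τ) - τ * ω.2 ^ 2)
  let Λ : ℝ × ℝ → ℂ := fun ω => -((x₀ - ω.1 : ℝ) : ℂ) / (2 * τ) + ω.2 * Complex.I
  have hFc : Continuous F := by fun_prop
  have hΛc : Continuous Λ := by fun_prop
  have hnorm : ∀ ω, ‖Λ ω‖ ^ 2 = (x₀ - ω.1) ^ 2 / (4 * τ ^ 2) + ω.2 ^ 2 := by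
    intro ω
    have : Λ ω = ((-(x₀ - ω.1) / (2 * τ) : ℝ) : ℂ) + (ω.2 : ℂ) * Complex.I := by
      simp only [Λ]; push_cast; ring
    rw [this, Complex.sq_norm, Complex.normSq_add_mul_I]
    field_simp
    ring
  have hr : 0 < τ / 4 := by positivity
  -- on a bidisc of radius `τ / 4`, half of the Gaussian decay absorbs the growth of the exponentials
  have hbound : Integrable fun ω : ℝ × ℝ => (2 * Real.pi)⁻¹ * M * Real.exp (τ / 4) *
      (Real.exp (-(1 / (8 * τ)) * (x₀ - ω.1) ^ 2) * Real.exp (-(τ / 2) * ω.2 ^ 2)) := by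
    refine Integrable.const_mul ?_ _
    have h1 : Integrable fun y : ℝ => Real.exp (-(1 / (8 * τ)) * (x₀ - y) ^ 2) :=
      (integrable_exp_neg_mul_sq (by positivity : 0 < 1 / (8 * τ))).comp_sub_left x₀
    have h2 : Integrable fun ξ : ℝ => Real.exp (-(τ / 2) * ξ ^ 2) :=
      integrable_exp_neg_mul_sq (by positivity : 0 < τ / 2)
    exact h1.mul_prod h2
  have hle : ∀ ω, |F ω| * Real.exp (τ / 4 * ‖Λ ω‖ + τ / 4 * ‖Λ ω‖ ^ 2) ≤
      (2 * Real.pi)⁻¹ * M * Real.exp (τ / 4) *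
      (Real.exp (-(1 / (8 * τ)) * (x₀ - ω.1) ^ 2) * Real.exp (-(τ / 2) * ω.2 ^ 2)) := by
    intro ω
    have e1 : |F ω| = (2 * Real.pi)⁻¹ * |f ω.1| *
        Real.exp (-(x₀ - ω.1) ^ 2 / (4 * τ) - τ * ω.2 ^ 2) := by
      simp only [F, abs_mul, Real.abs_exp]
      rw [abs_of_pos (by positivity : 0 < (2 * Real.pi)⁻¹)]
    rw [e1, mul_assoc _ (Real.exp _) (Real.exp _), mul_assoc _ (Real.exp (τ / 4)),
      ← Real.exp_add, ← Real.exp_add, ← Real.exp_add]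
    refine mul_le_mul (mul_le_mul_of_nonneg_left (hM _) (by positivity)) ?_
      (Real.exp_pos _).le (mul_nonneg (by positivity) hM0)
    rw [Real.exp_le_exp]
    have h1 : ‖Λ ω‖ ≤ 1 + ‖Λ ω‖ ^ 2 := by nlinarith [sq_nonneg (‖Λ ω‖ - 1), norm_nonneg (Λ ω)]
    have h2 : τ / 4 * ‖Λ ω‖ ≤ τ / 4 * (1 + ‖Λ ω‖ ^ 2) := by gcongr
    calc _ ≤ -(x₀ - ω.1) ^ 2 / (4 * τ) - τ * ω.2 ^ 2 +
          (τ / 4 * (1 + ‖Λ ω‖ ^ 2) + τ / 4 * ‖Λ ω‖ ^ 2) := by gcongr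
      _ = _ := by rw [hnorm]; field_simp; ring
  have hint : Integrable (fun ω => |F ω| * Real.exp (τ / 4 * ‖Λ ω‖ + τ / 4 * ‖Λ ω‖ ^ 2)) := by
    refine hbound.mono' (by fun_prop) (Filter.Eventually.of_forall fun ω => ?_)
    rw [Real.norm_of_nonneg (by positivity)]
    exact hle ω
  refine ⟨_, τ / 4, hasHeatSeries_of_superposition (μ := volume) hFc.aestronglyMeasurable
    hΛc.aestronglyMeasurable hr hint fun x t hx ht => ?_⟩
  have hσ : |t - t₀| < τ := by linarith
  have hts : 0 < t - s := by linarith [neg_abs_le (t - t₀)]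
  have hint2 : Integrable fun ω =>
      F ω * (Complex.exp (Λ ω * (x - x₀ : ℝ) + Λ ω ^ 2 * (t - t₀ : ℝ))).re := by
    refine hint.mono' (Continuous.aestronglyMeasurable (by fun_prop))
      (Filter.Eventually.of_forall fun ω => ?_)
    rw [norm_mul, Real.norm_eq_abs, Real.norm_eq_abs]
    refine mul_le_mul_of_nonneg_left ?_ (abs_nonneg _)
    refine (Complex.abs_re_le_norm _).trans ?_
    rw [Complex.norm_exp, Real.exp_le_exp]
    refine (Complex.re_le_norm _).trans ((norm_add_le _ _).trans ?_)
    rw [norm_mul, norm_mul, norm_pow, Complex.norm_real, Complex.norm_real, mul_comm (τ / 4),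
      mul_comm (τ / 4), Real.norm_eq_abs, Real.norm_eq_abs]
    gcongr
  rw [Measure.volume_eq_prod, integral_prod _ (by rwa [← Measure.volume_eq_prod]), heatExtension_eq_integral_kernel f hts]
  congr 1
  funext y
  have key := integral_exp_saddle hτ0 hσ (x₀ - y) (x - x₀)
  have e1 : ∀ ξ : ℝ, F (y, ξ) *
      (Complex.exp (Λ (y, ξ) * (x - x₀ : ℝ) + Λ (y, ξ) ^ 2 * (t - t₀ : ℝ))).re =
      (2 * Real.pi)⁻¹ * f y * (Real.exp (-(x₀ - y) ^ 2 / (4 * τ) - τ * ξ ^ 2) *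
      (Complex.exp ((-((x₀ - y : ℝ) : ℂ) / (2 * τ) + ξ * Complex.I) * (x - x₀ : ℝ) +
        (-((x₀ - y : ℝ) : ℂ) / (2 * τ) + ξ * Complex.I) ^ 2 * (t - t₀ : ℝ))).re) := by
    intro ξ
    simp only [F, Λ]
    ring
  simp_rw [e1]
  rw [integral_const_mul, key, show x₀ - y + (x - x₀) = x - y by ring,
    show τ + (t - t₀) = t - s by rw [hτ]; ring]
  have e2 : √(Real.pi / (t - s)) = 2 * Real.pi * (√(4 * Real.pi * (t - s)))⁻¹ := by
    rw [← Real.sqrt_inv, show Real.pi / (t - s) = (2 * Real.pi) ^ 2 * (4 * Real.pi * (t - s))⁻¹ by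
      field_simp; ring, Real.sqrt_mul (by positivity), Real.sqrt_sq (by positivity)]
  rw [e2]
  have := Real.pi_pos
  field_simp

/-! ### Uniqueness of bounded solutions -/

theorem deriv_deriv_nonpos_of_isLocalMax {g : ℝ → ℝ} {a : ℝ} (h : IsLocalMax g a)
    (hc : ContinuousAt g a) : deriv (deriv g) a ≤ 0 := by
  by_contra! hpos
  have hmin := isLocalMin_of_deriv_deriv_pos hpos h.deriv_eq_zero hc
  have hconst : g =ᶠ[𝓝 a] fun _ => g a := by
    filter_upwards [h, hmin] with x h1 h2
    exact le_antisymm h1 h2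
  have h0 : deriv g =ᶠ[𝓝 a] fun _ => 0 := by
    refine hconst.deriv.trans ?_
    simp
  rw [h0.deriv_eq] at hpos
  simp at hpos

theorem nonneg_of_hasDerivAt_of_le_left {g : ℝ → ℝ} {g' a b : ℝ} (hg : HasDerivAt g g' a)
    (hb : b < a) (h : ∀ t ∈ Ioo b a, g t ≤ g a) : 0 ≤ g' := by
  have h1 := (hasDerivWithinAt_iff_tendsto_slope' (s := Iio a) (by simp)).1 hg.hasDerivWithinAt
  refine ge_of_tendsto h1 ?_
  filter_upwards [Ioo_mem_nhdsLT hb] with t ht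
  rw [slope_def_field]
  exact div_nonneg_of_nonpos (by linarith [h t ht]) (by linarith [ht.2])

/-- A Phragmén–Lindelöf maximum principle: a solution of the heat equation that is bounded above
and initially nonpositive stays nonpositive. -/
theorem nonpos_of_heat_of_bddAbove {w wx wxx : ℝ → ℝ → ℝ} {s B : ℝ}
    (hc : ContinuousOn (fun p : ℝ × ℝ => w p.1 p.2) {p | s ≤ p.2})
    (hx : ∀ x t, s < t → HasDerivAt (fun y => w y t) (wx x t) x)
    (hxx : ∀ x t, s < t → HasDerivAt (fun y => wx y t) (wxx x t) x)
    (ht : ∀ x t, s < t → HasDerivAt (fun τ => w x τ) (wxx x t) t)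
    (hB : ∀ x t, s ≤ t → w x t ≤ B) (h0 : ∀ x, w x s ≤ 0) {x₁ t₁ : ℝ} (h₁ : s ≤ t₁) :
    w x₁ t₁ ≤ 0 := by
  -- compare with the supersolution `ε (x² + 3 (t - s))` on a large rectangle
  have key : ∀ ε > 0, w x₁ t₁ ≤ ε * (x₁ ^ 2 + 3 * (t₁ - s)) := by
    intro ε hε
    obtain ⟨R, hR1, hR2, hR0⟩ : ∃ R, |x₁| ≤ R ∧ B ≤ ε * R ^ 2 ∧ 0 ≤ R := by
      have hB' : B / ε ≤ (|x₁| + |B / ε| + 1) ^ 2 := by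
        have := le_abs_self (B / ε)
        nlinarith [abs_nonneg x₁, abs_nonneg (B / ε)]
      refine ⟨|x₁| + |B / ε| + 1, by linarith [abs_nonneg (B / ε)], ?_, by positivity⟩
      rwa [div_le_iff₀' hε] at hB'
    let q : ℝ × ℝ → ℝ := fun p => w p.1 p.2 - ε * (p.1 ^ 2 + 3 * (p.2 - s))
    have hK : IsCompact (Icc (-R) R ×ˢ Icc s t₁) := isCompact_Icc.prod isCompact_Icc
    have hmem : (x₁, t₁) ∈ Icc (-R) R ×ˢ Icc s t₁ := ⟨abs_le.1 hR1, h₁, le_rfl⟩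
    have hq : ContinuousOn q (Icc (-R) R ×ˢ Icc s t₁) :=
      (hc.mono fun p hp => hp.2.1).sub (by fun_prop)
    obtain ⟨⟨xm, tm⟩, ⟨hxm, htm⟩, hmax⟩ := hK.exists_isMaxOn ⟨_, hmem⟩ hq
    suffices h : q (xm, tm) ≤ 0 by
      have := (hmax hmem).trans h
      simpa [q] using this
    by_contra! hpos
    simp only at hxm htm
    -- a positive maximum is attained neither initially nor on the lateral sides
    have hts : s < tm := by
      refine lt_of_le_of_ne htm.1 fun h => ?_
      have h1 := h0 xm
      simp only [q, ← h] at hpos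
      nlinarith [mul_nonneg hε.le (sq_nonneg xm)]
    have hlt : xm ^ 2 < R ^ 2 := by
      by_contra! h
      have h1 := hB xm tm hts.le
      have h2 : ε * R ^ 2 ≤ ε * xm ^ 2 := by gcongr
      have h3 : 0 ≤ ε * (3 * (tm - s)) := mul_nonneg hε.le (by linarith)
      simp only [q] at hpos
      nlinarith
    have hxm' : xm ∈ Ioo (-R) R := abs_lt.1 ((sq_lt_sq₀ (abs_nonneg _) hR0).1 (by rwa [sq_abs]))
    have hg1 : ∀ x, HasDerivAt (fun y => q (y, tm)) (wx x tm - ε * (2 * x)) x := fun x => by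
      have := (hx x tm hts).fun_sub ((((hasDerivAt_pow 2 x).add_const (3 * (tm - s)))).const_mul ε)
      simpa [q] using this
    have hg2 : HasDerivAt (fun y => wx y tm - ε * (2 * y)) (wxx xm tm - ε * 2) xm := by
      have := (hxx xm tm hts).fun_sub (((hasDerivAt_id xm).const_mul 2).const_mul ε)
      simpa using this
    have hloc : IsLocalMax (fun y => q (y, tm)) xm := by
      filter_upwards [Ioo_mem_nhds hxm'.1 hxm'.2] with y hy
      exact hmax (show (y, tm) ∈ _ from ⟨⟨hy.1.le, hy.2.le⟩, htm⟩)
    -- at the maximum `q_xx ≤ 0 ≤ q_t`, while `q_t - q_xx = -ε`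
    have h2 := deriv_deriv_nonpos_of_isLocalMax hloc (hg1 xm).continuousAt
    have hd : deriv (fun y => q (y, tm)) = fun y => wx y tm - ε * (2 * y) :=
      funext fun y => (hg1 y).deriv
    rw [hd, hg2.deriv] at h2
    have hg3 : HasDerivAt (fun τ => q (xm, τ)) (wxx xm tm - ε * 3) tm := by
      have := (ht xm tm hts).fun_sub
        (((((hasDerivAt_id tm).sub_const s).const_mul 3).const_add (xm ^ 2)).const_mul ε)
      simpa [q] using this
    have h3 := nonneg_of_hasDerivAt_of_le_left hg3 hts fun t htt =>
      hmax (show (xm, t) ∈ _ from ⟨hxm, htt.1.le, htt.2.le.trans htm.2⟩)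
    linarith
  have hlim : Filter.Tendsto (fun ε : ℝ => ε * (x₁ ^ 2 + 3 * (t₁ - s))) (𝓝[>] 0) (𝓝 0) := by
    have : ContinuousAt (fun ε : ℝ => ε * (x₁ ^ 2 + 3 * (t₁ - s))) 0 := by fun_prop
    simpa [ContinuousAt] using this.tendsto.mono_left nhdsWithin_le_nhds
  exact ge_of_tendsto hlim (by filter_upwards [self_mem_nhdsWithin] with ε hε using key ε hε)

namespace HasHeatSeries

variable {u v : ℝ → ℝ → ℝ} {W : ℕ → ℝ} {r x₀ t₀ : ℝ}

theorem mono {r' : ℝ} (h : HasHeatSeries u W r x₀ t₀) (h0 : 0 < r') (hr : r' ≤ r) :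
    HasHeatSeries u W r' x₀ t₀ where
  pos := h0
  summable := Summable.of_nonneg_of_le (fun i => by positivity)
    (fun i => by have := h.pos; gcongr) h.summable
  eq_tsum x t hx ht := h.eq_tsum x t (hx.trans_le hr) (ht.trans_le hr)

theorem congr (h : HasHeatSeries u W r x₀ t₀)
    (huv : ∀ x t, |x - x₀| < r → |t - t₀| < r → v x t = u x t) : HasHeatSeries v W r x₀ t₀ where
  pos := h.pos
  summable := h.summable
  eq_tsum x t hx ht := (huv x t hx ht).trans (h.eq_tsum x t hx ht)

theorem hasDerivAt_x (h : HasHeatSeries u W r x₀ t₀) :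
    HasDerivAt (fun y => u y t₀) (_root_.partialX u x₀ t₀) x₀ := by
  have := h.pos
  exact (h.hasDerivAt_fst (x := x₀) (t := t₀) (by simpa) (by simpa)).differentiableAt.hasDerivAt

theorem hasDerivAt_t (h : HasHeatSeries u W r x₀ t₀) :
    HasDerivAt (fun τ => u x₀ τ) (_root_.partialX (_root_.partialX u) x₀ t₀) t₀ := by
  have hr := h.pos
  have h1 := h.hasDerivAt_snd (x := x₀) (t := t₀) (by simpa) (by simpa)
  rw [h.partialX.partialX.eq_tsum x₀ t₀ (by simpa) (by simpa)]
  exact h1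

end HasHeatSeries

/-- A bounded solution of the heat equation in the half-plane is, near every point, the sum of its
heat series: by uniqueness it is the heat extension of its values at an earlier time. -/
theorem IsHeatSolution.exists_hasHeatSeries {u : ℝ → ℝ → ℝ} (hu : IsHeatSolution u)
    (hbdd : ∃ M : ℝ, ∀ x t : ℝ, 0 < t → |u x t| ≤ M) (x₀ : ℝ) {t₀ : ℝ} (ht₀ : 0 < t₀) :
    ∃ W r, HasHeatSeries u W r x₀ t₀ := by
  obtain ⟨M, hM⟩ := hbdd
  obtain ⟨s, hs⟩ : ∃ s, s = t₀ / 2 := ⟨_, rfl⟩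
  have hs0 : 0 < s := by linarith
  let f : ℝ → ℝ := fun x => u x s
  have hf : Continuous f := by
    refine continuous_iff_continuousAt.2 fun x => (hu.differentiable_x x s hs0).continuousAt
  have hfM : ∀ x, |f x| ≤ M := fun x => hM x s hs0
  let v : ℝ → ℝ → ℝ := fun x t => heatExtension f (t - s) x
  have hvc : Continuous fun p : ℝ × ℝ => v p.1 p.2 :=
    (continuous_heatExtension hf hfM).comp
      (by fun_prop : Continuous fun p : ℝ × ℝ => (p.1, p.2 - s))
  have hvs : ∀ x t, s < t → ∃ W r, HasHeatSeries v W r x t := fun x t h =>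
    hasHeatSeries_heatExtension hf hfM h x
  have hvx : ∀ x t, s < t → HasDerivAt (fun y => v y t) (partialX v x t) x := fun x t h => by
    obtain ⟨W, r, hW⟩ := hvs x t h
    exact hW.hasDerivAt_x
  have hvxx : ∀ x t, s < t → HasDerivAt (fun y => partialX v y t) (partialX (partialX v) x t) x :=
    fun x t h => by
      obtain ⟨W, r, hW⟩ := hvs x t h
      exact hW.partialX.hasDerivAt_x
  have hvt : ∀ x t, s < t → HasDerivAt (fun y => v x y) (partialX (partialX v) x t) t :=
    fun x t h => by
      obtain ⟨W, r, hW⟩ := hvs x t h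
      exact hW.hasDerivAt_t
  have hux : ∀ x t, s < t → HasDerivAt (fun y => u y t) (partialX u x t) x := fun x t h =>
    (hu.differentiable_x x t (hs0.trans h)).hasDerivAt
  have huxx : ∀ x t, s < t → HasDerivAt (fun y => partialX u y t) (partialX (partialX u) x t) x :=
    fun x t h => (hu.differentiable_xx x t (hs0.trans h)).hasDerivAt
  have hut : ∀ x t, s < t → HasDerivAt (fun y => u x y) (partialX (partialX u) x t) t :=
    fun x t h => by
      rw [← hu.heat x t (hs0.trans h)]
      exact (hu.differentiable_t x t (hs0.trans h)).hasDerivAt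
  have huc : ContinuousOn (fun p : ℝ × ℝ => u p.1 p.2) {p | s ≤ p.2} :=
    hu.continuousOn.mono fun p hp => hs0.trans_le hp
  have hv0 : ∀ x, v x s = u x s := fun x => by simp [v, heatExtension_zero, f]
  have huv : ∀ x t, s ≤ t → u x t = v x t := by
    intro x t hst
    apply le_antisymm
    · refine sub_nonpos.1 (nonpos_of_heat_of_bddAbove (w := fun x t => u x t - v x t) (B := M + M)
        (huc.sub hvc.continuousOn) (fun x t h => (hux x t h).sub (hvx x t h))
        (fun x t h => (huxx x t h).sub (hvxx x t h)) (fun x t h => (hut x t h).sub (hvt x t h))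
        (fun x t h => ?_) (fun x => by rw [hv0]; simp) hst)
      linarith [(abs_le.1 (hM x t (hs0.trans_le h))).2,
        (abs_le.1 (abs_heatExtension_le hfM (t - s) x)).1]
    · refine sub_nonpos.1 (nonpos_of_heat_of_bddAbove (w := fun x t => v x t - u x t) (B := M + M)
        (hvc.continuousOn.sub huc) (fun x t h => (hvx x t h).sub (hux x t h))
        (fun x t h => (hvxx x t h).sub (huxx x t h)) (fun x t h => (hvt x t h).sub (hut x t h))
        (fun x t h => ?_) (fun x => by rw [hv0]; simp) hst)
      linarith [(abs_le.1 (hM x t (hs0.trans_le h))).1,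
        (abs_le.1 (abs_heatExtension_le hfM (t - s) x)).2]
  obtain ⟨W, r, hW⟩ := hvs x₀ t₀ (by linarith)
  refine ⟨W, min r s, (hW.mono (lt_min hW.pos hs0) (min_le_left _ _)).congr fun x t _ ht => ?_⟩
  refine huv x t ?_
  have := ht.trans_le (min_le_right _ _)
  linarith [neg_abs_le (t - t₀)]

/-! ### Heat polynomials -/

/-- The coefficient of `s ^ k` in `heatPoly n`. -/
noncomputable def heatPolyCoeff (n k : ℕ) : ℝ :=
  if 2 * k ≤ n then ((k.factorial : ℝ) * ((n - 2 * k).factorial : ℝ))⁻¹ else 0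

/-- The polynomial `∑ s ^ k / (k! (n - 2 k)!)`, that is the restriction to the line `x = 1` of the
heat polynomial `∑ x ^ (n - 2 k) * t ^ k / (k! (n - 2 k)!)`, a caloric version of the `n`-th Hermite
polynomial. -/
noncomputable def heatPoly (n : ℕ) : Polynomial ℝ :=
  ∑ k ∈ Finset.range (n + 1), Polynomial.monomial k (heatPolyCoeff n k)

theorem heatPolyCoeff_of_lt {n k : ℕ} (h : n < 2 * k) : heatPolyCoeff n k = 0 :=
  if_neg (by omega)

theorem heatPolyCoeff_add (j k : ℕ) :
    heatPolyCoeff (j + 2 * k) k = ((k.factorial : ℝ) * (j.factorial : ℝ))⁻¹ := by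
  rw [heatPolyCoeff, if_pos (by omega), Nat.add_sub_cancel]

theorem heatPolyCoeff_nonneg (n k : ℕ) : 0 ≤ heatPolyCoeff n k := by
  unfold heatPolyCoeff
  split_ifs <;> positivity

theorem coeff_heatPoly (n k : ℕ) : (heatPoly n).coeff k = heatPolyCoeff n k := by
  simp only [heatPoly, Polynomial.finsetSum_coeff, Polynomial.coeff_monomial]
  rw [Finset.sum_ite_eq' (Finset.range (n + 1)) k]
  split_ifs with h
  · rfl
  · rw [Finset.mem_range] at h
    exact (heatPolyCoeff_of_lt (by omega)).symm

theorem eval_heatPoly (n : ℕ) (s : ℝ) :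
    (heatPoly n).eval s = ∑ k ∈ Finset.range (n + 1), heatPolyCoeff n k * s ^ k := by
  simp [heatPoly, Polynomial.eval_finsetSum]

theorem eval_heatPoly_pos (n : ℕ) {s : ℝ} (hs : 0 ≤ s) : 0 < (heatPoly n).eval s := by
  rw [eval_heatPoly]
  refine Finset.sum_pos' (fun k _ => mul_nonneg (heatPolyCoeff_nonneg n k) (by positivity))
    ⟨0, by simp, ?_⟩
  simp only [heatPolyCoeff, mul_zero, zero_le, if_true, pow_zero, mul_one]
  positivity

theorem heatPoly_ne_zero (n : ℕ) : heatPoly n ≠ 0 := fun h => by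
  have := eval_heatPoly_pos n le_rfl
  simp [h] at this

theorem derivative_heatPoly (n : ℕ) :
    Polynomial.derivative (heatPoly (n + 2)) = heatPoly n := by
  ext k
  rw [Polynomial.coeff_derivative, coeff_heatPoly, coeff_heatPoly]
  rcases le_or_gt (2 * k) n with h | h
  · obtain ⟨j, rfl⟩ : ∃ j, n = j + 2 * k := ⟨n - 2 * k, by omega⟩
    rw [show j + 2 * k + 2 = j + 2 * (k + 1) by ring, heatPolyCoeff_add, heatPolyCoeff_add,
      Nat.factorial_succ]
    push_cast
    field_simp
  · rw [heatPolyCoeff_of_lt h, heatPolyCoeff_of_lt (by omega), zero_mul]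

open Polynomial in
/-- The Hermite differential equation, for `heatPoly`. -/
theorem heatPoly_ode (n : ℕ) :
    derivative (heatPoly n) = C ((n : ℝ) * (n - 1)) * heatPoly n
      - C (4 * (n : ℝ) - 6) * (X * derivative (heatPoly n))
      + C 4 * (X * (X * derivative (derivative (heatPoly n)))) := by
  have hrec : ∀ k : ℕ, heatPolyCoeff n (k + 1) * (k + 1) =
      ((n : ℝ) - 2 * k) * (n - 2 * k - 1) * heatPolyCoeff n k := by
    intro k
    rcases lt_or_ge n (2 * k) with h | h
    · rw [heatPolyCoeff_of_lt h, heatPolyCoeff_of_lt (by omega)]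
      ring
    obtain ⟨j, rfl⟩ : ∃ j, n = j + 2 * k := ⟨n - 2 * k, by omega⟩
    rcases j with _ | _ | j
    · rw [heatPolyCoeff_of_lt (by omega)]
      push_cast
      ring
    · rw [heatPolyCoeff_of_lt (by omega)]
      push_cast
      ring
    · rw [show heatPolyCoeff (j + 1 + 1 + 2 * k) (k + 1) = heatPolyCoeff (j + 2 * (k + 1)) (k + 1) by
        congr 1; ring, heatPolyCoeff_add, heatPolyCoeff_add]
      simp only [Nat.factorial_succ]
      push_cast
      field_simp
      ring
  ext k
  rcases k with _ | _ | k
  · have := hrec 0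
    simp [coeff_derivative, coeff_heatPoly] at this ⊢
    linarith
  · have := hrec 1
    simp only [coeff_add, coeff_sub, coeff_C_mul, coeff_X_mul, coeff_X_mul_zero, coeff_derivative,
      coeff_heatPoly]
    push_cast at this ⊢
    linarith
  · have := hrec (k + 2)
    simp only [coeff_add, coeff_sub, coeff_C_mul, coeff_X_mul, coeff_derivative, coeff_heatPoly]
    push_cast at this ⊢
    linarith

theorem heatPoly_root_neg {n : ℕ} {ρ : ℝ} (h : (heatPoly n).eval ρ = 0) : ρ < 0 := by
  by_contra! h0
  exact (eval_heatPoly_pos n h0).ne' h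

open Polynomial in
/-- The real roots of a heat polynomial are simple: a multiple root would have a multiplicity that
contradicts the differential equation. -/
theorem eval_derivative_heatPoly_ne_zero {n : ℕ} {ρ : ℝ} (h : (heatPoly n).eval ρ = 0) :
    (derivative (heatPoly n)).eval ρ ≠ 0 := by
  intro h'
  have hρ := (heatPoly_root_neg h).ne
  set P := heatPoly n with hP
  have hP0 : P ≠ 0 := heatPoly_ne_zero n
  have hmul : 1 < P.rootMultiplicity ρ :=
    (one_lt_rootMultiplicity_iff_isRoot hP0).2 ⟨h, h'⟩
  obtain ⟨m, hm⟩ : ∃ m, P.rootMultiplicity ρ = m + 2 := ⟨P.rootMultiplicity ρ - 2, by omega⟩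
  have hm1 : (derivative P).rootMultiplicity ρ = m + 1 := by
    rw [derivative_rootMultiplicity_of_root h, hm]; rfl
  have hm2 : (derivative (derivative P)).rootMultiplicity ρ = m := by
    rw [derivative_rootMultiplicity_of_root h', hm1]; rfl
  have hd1 : (X - C ρ) ^ (m + 1) ∣ derivative P := hm1 ▸ pow_rootMultiplicity_dvd _ _
  have hd0 : (X - C ρ) ^ (m + 1) ∣ P :=
    (pow_dvd_pow _ (by omega)).trans (hm ▸ pow_rootMultiplicity_dvd P ρ)
  have hd2 : (X - C ρ) ^ (m + 1) ∣ C 4 * (X * (X * derivative (derivative P))) := by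
    have e : C 4 * (X * (X * derivative (derivative P))) = derivative P -
        C ((n : ℝ) * (n - 1)) * P + C (4 * (n : ℝ) - 6) * (X * derivative P) := by
      linear_combination -heatPoly_ode n
    rw [e]
    exact dvd_add (dvd_sub hd1 (hd0.mul_left _)) ((hd1.mul_left _).mul_left _)
  have hcop : IsCoprime ((X - C ρ) ^ (m + 1)) (X : ℝ[X]) := by
    refine IsCoprime.pow_left ?_
    have := isCoprime_X_sub_C_of_isUnit_sub (R := ℝ) (a := ρ) (b := 0) (by simpa using hρ)
    simpa using this
  have hd3 := hcop.dvd_of_dvd_mul_left (hcop.dvd_of_dvd_mul_left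
    ((dvd_C_mul (by norm_num : (4 : ℝ) ≠ 0)).1 hd2))
  have hne : derivative (derivative P) ≠ 0 := by
    intro h0
    have h1 := derivative_eq_zero.1 h0
    have h2 : derivative P = 0 := by
      rw [eq_C_of_natDegree_eq_zero h1] at h' ⊢
      simpa using h'
    have h3 := derivative_eq_zero.1 h2
    apply hP0
    rw [eq_C_of_natDegree_eq_zero h3] at h ⊢
    simpa using h
  have := (le_rootMultiplicity_iff hne).2 hd3
  omega

open Polynomial in
/-- For `n ≥ 2` there is a real root: otherwise the polynomial would be positive with a positive
minimum, and at the minimum the differential equation reads `4 s² P'' = - n (n - 1) P < 0`. -/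
theorem exists_root_heatPoly {n : ℕ} (hn : 2 ≤ n) : ∃ ρ, (heatPoly n).eval ρ = 0 := by
  by_contra! hne
  have hpos : ∀ s, 0 < (heatPoly n).eval s := by
    intro s
    by_contra! hs
    obtain ⟨ρ, hρ⟩ := mem_range_of_exists_le_of_exists_ge (heatPoly n).continuous ⟨s, hs⟩
      ⟨0, (eval_heatPoly_pos n le_rfl).le⟩
    exact hne ρ hρ
  obtain ⟨s, hs⟩ := (heatPoly n).exists_forall_norm_le
  have hmin : ∀ y, (heatPoly n).eval s ≤ (heatPoly n).eval y := fun y => by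
    have := hs y
    rwa [Real.norm_of_nonneg (hpos _).le, Real.norm_of_nonneg (hpos _).le] at this
  have hmax : IsLocalMax (fun y => -(heatPoly n).eval y) s :=
    Filter.Eventually.of_forall fun y => neg_le_neg (hmin y)
  have h2 := deriv_deriv_nonpos_of_isLocalMax hmax (by fun_prop)
  have h1 := hmax.deriv_eq_zero
  have hd : deriv (fun y => -(heatPoly n).eval y) = fun y => -(derivative (heatPoly n)).eval y := by
    funext y; simp
  rw [hd] at h1 h2
  have h3 : 0 ≤ (derivative (derivative (heatPoly n))).eval s := by simpa using h2
  have h4 : (derivative (heatPoly n)).eval s = 0 := by simpa using h1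
  have ode := congrArg (eval s) (heatPoly_ode n)
  simp only [eval_add, eval_sub, eval_mul, eval_C, eval_X, h4] at ode
  have hn' : (2 : ℝ) ≤ n := by exact_mod_cast hn
  have h5 : 0 < (n : ℝ) * (n - 1) * (heatPoly n).eval s :=
    mul_pos (mul_pos (by linarith) (by linarith)) (hpos s)
  nlinarith [mul_nonneg (mul_self_nonneg s) h3]

/-! ### Blow-ups of a heat series at a zero of finite order -/

namespace HasHeatSeries

variable {u : ℝ → ℝ → ℝ} {W : ℕ → ℝ} {r x₀ t₀ : ℝ}

/-- A series with the coefficients of a heat series, or smaller ones, but other monomials is analytic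
if its monomials are dominated on some bidisc by those of the heat series. -/
theorem analyticAt_tsum_blowup (h : HasHeatSeries u W r x₀ t₀) (d : ℕ × ℕ → ℝ)
    (hd : ∀ i, |d i| ≤ |heatCoeff W i|) (a b : ℕ × ℕ → ℕ) {ρ K C : ℝ} (hρ : 0 < ρ) (hK : 0 < K)
    (hC : ∀ i, heatCoeff W i ≠ 0 → ρ ^ a i * K ^ b i ≤ C * (r ^ i.1 * r ^ i.2)) {s : ℝ}
    (hs : |s| < K) :
    AnalyticAt ℝ (fun q : ℝ × ℝ => ∑' i, d i * (q.1 ^ a i * q.2 ^ b i)) (0, s) := by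
  refine analyticAt_tsum_monomial d a b hρ hK ?_ (by simpa using hρ) hs
  refine Summable.of_nonneg_of_le (fun i => by positivity) (fun i => ?_) (h.summable.mul_left C)
  by_cases hi : heatCoeff W i = 0
  · have : d i = 0 := by simpa [hi] using hd i
    simp [this, hi]
  · calc |d i| * (ρ ^ a i * K ^ b i) ≤ |heatCoeff W i| * (C * (r ^ i.1 * r ^ i.2)) := by
          exact mul_le_mul (hd i) (hC i hi) (by positivity) (abs_nonneg _)
      _ = _ := by ring

theorem heatCoeff_eq_zero {n : ℕ} (hn : ∀ m < n, W m = 0) {i : ℕ × ℕ} (hi : i.1 + 2 * i.2 < n) :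
    heatCoeff W i = 0 := by
  rw [heatCoeff, hn _ hi, zero_div]

/-- The parabolic blow-up at a zero of order `n`: in the coordinates `x` and `s = t / x²` the
solution is `x ^ n` times an analytic function, which for `x = 0` is a heat polynomial in `s`. -/
theorem exists_parabolic_blowup (h : HasHeatSeries u W r x₀ t₀) {n : ℕ} (hn : ∀ m < n, W m = 0) :
    ∃ v : ℝ × ℝ → ℝ, (∀ s, AnalyticAt ℝ v (0, s)) ∧
      (∀ s, v (0, s) = W n * (heatPoly n).eval s) ∧
      ∀ x s, |x| < r → |x ^ 2 * s| < r → u (x₀ + x) (t₀ + x ^ 2 * s) = x ^ n * v (x, s) := by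
  refine ⟨fun q => ∑' i : ℕ × ℕ, heatCoeff W i * (q.1 ^ (i.1 + 2 * i.2 - n) * q.2 ^ i.2),
    fun s => ?_, fun s => ?_, fun x s hx hs => ?_⟩
  · have hr := h.pos
    have hK : 0 < |s| + 1 := by positivity
    obtain ⟨ρ, hρ, hρr, hρK⟩ : ∃ ρ, 0 < ρ ∧ ρ ≤ r ∧ ρ ^ 2 * (|s| + 1) ≤ r := by
      have h1 : Filter.Tendsto (fun ρ : ℝ => ρ ^ 2 * (|s| + 1)) (𝓝[>] 0) (𝓝 0) := by
        have : ContinuousAt (fun ρ : ℝ => ρ ^ 2 * (|s| + 1)) 0 := by fun_prop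
        simpa [ContinuousAt] using this.tendsto.mono_left nhdsWithin_le_nhds
      have h2 := h1.eventually (Iic_mem_nhds hr)
      have h3 : ∀ᶠ ρ in 𝓝[>] (0 : ℝ), ρ ∈ Ioo 0 r := Ioo_mem_nhdsGT hr
      obtain ⟨ρ, h2, h3⟩ := (h2.and h3).exists
      exact ⟨ρ, h3.1, h3.2.le, h2⟩
    refine h.analyticAt_tsum_blowup (heatCoeff W) (fun i => le_rfl) _ _ hρ hK
      (C := (ρ ^ n)⁻¹) (fun i hi => ?_) (lt_add_one _)
    have hle : n ≤ i.1 + 2 * i.2 := by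
      by_contra! hlt
      exact hi (heatCoeff_eq_zero hn hlt)
    calc ρ ^ (i.1 + 2 * i.2 - n) * (|s| + 1) ^ i.2
        = (ρ ^ n)⁻¹ * (ρ ^ i.1 * (ρ ^ 2 * (|s| + 1)) ^ i.2) := by
          rw [pow_sub₀ _ hρ.ne' hle, mul_pow, pow_add, pow_mul]; ring
      _ ≤ _ := by gcongr
  · let S : Finset (ℕ × ℕ) := ((Finset.range (n + 1)).filter fun k => 2 * k ≤ n).image
      fun k => (n - 2 * k, k)
    have hS : ∀ i ∉ S, heatCoeff W i * ((0 : ℝ) ^ (i.1 + 2 * i.2 - n) * s ^ i.2) = 0 := by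
      rintro ⟨j, k⟩ hi
      rcases lt_trichotomy (j + 2 * k) n with hlt | heq | hgt
      · rw [heatCoeff_eq_zero hn hlt, zero_mul]
      · refine absurd ?_ hi
        simp only [S, Finset.mem_image, Finset.mem_filter, Finset.mem_range, Prod.mk.injEq]
        exact ⟨k, ⟨by omega, by omega⟩, by omega, rfl⟩
      · rw [zero_pow (by simp only; omega), zero_mul, mul_zero]
    dsimp only
    rw [tsum_eq_sum hS, Finset.sum_image (by
      intro a _ b _ hab
      exact (Prod.mk.inj hab).2), eval_heatPoly, Finset.mul_sum, Finset.sum_filter]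
    refine Finset.sum_congr rfl fun k _ => ?_
    by_cases hk : 2 * k ≤ n
    · rw [if_pos hk, heatPolyCoeff, if_pos hk, heatCoeff]
      have : n - 2 * k + 2 * k = n := by omega
      simp only [this, Nat.sub_self, pow_zero, one_mul]
      field_simp
    · rw [if_neg hk, heatPolyCoeff, if_neg hk]
      simp
  · rw [h.eq_tsum _ _ (by simpa using hx) (by simpa using hs), ← tsum_mul_left]
    refine tsum_congr fun i => ?_
    simp only [add_sub_cancel_left]
    by_cases hi : i.1 + 2 * i.2 < n
    · rw [heatCoeff_eq_zero hn hi]; simp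
    · have : x ^ (i.1 + 2 * i.2) = x ^ n * x ^ (i.1 + 2 * i.2 - n) := by
        rw [← pow_add]; congr 1; omega
      rw [mul_pow, ← pow_mul, ← mul_assoc (x ^ i.1), ← pow_add, this]
      ring

/-- The blow-up in the time direction at a zero of odd order `2 N + 1`: in the coordinates `t` and
`y = x / t` the solution is `t ^ (N + 1)` times an analytic function, which is affine in `y` for
`t = 0`. -/
theorem exists_vertical_blowup (h : HasHeatSeries u W r x₀ t₀) {N : ℕ}
    (hn : ∀ m < 2 * N + 1, W m = 0) :
    ∃ w : ℝ × ℝ → ℝ, (∀ y, AnalyticAt ℝ w (0, y)) ∧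
      (∀ y, w (0, y) = W (2 * N + 1) / N.factorial * y + heatCoeff W (0, N + 1)) ∧
      ∀ t y, |t| < r → |t * y| < r → u (x₀ + t * y) (t₀ + t) = t ^ (N + 1) * w (t, y) := by
  have hle : ∀ i : ℕ × ℕ, heatCoeff W i ≠ 0 → N + 1 ≤ i.1 + i.2 := by
    intro i hi
    by_contra! hlt
    exact hi (heatCoeff_eq_zero hn (by omega))
  refine ⟨fun q => ∑' i : ℕ × ℕ, heatCoeff W i * (q.1 ^ (i.1 + i.2 - (N + 1)) * q.2 ^ i.1),
    fun s => ?_, fun y => ?_, fun t y ht hy => ?_⟩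
  · have hr := h.pos
    have hK : 0 < |s| + 1 := by positivity
    have hρ : 0 < r / (|s| + 1) := by positivity
    refine h.analyticAt_tsum_blowup (heatCoeff W) (fun i => le_rfl) _ _ hρ hK
      (C := ((r / (|s| + 1)) ^ (N + 1))⁻¹) (fun i hi => ?_) (lt_add_one _)
    have hρr : r / (|s| + 1) ≤ r := div_le_self hr.le (by linarith [abs_nonneg s])
    calc (r / (|s| + 1)) ^ (i.1 + i.2 - (N + 1)) * (|s| + 1) ^ i.1
        = ((r / (|s| + 1)) ^ (N + 1))⁻¹ *
          ((r / (|s| + 1) * (|s| + 1)) ^ i.1 * (r / (|s| + 1)) ^ i.2) := by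
          rw [pow_sub₀ _ hρ.ne' (hle i hi), mul_pow, pow_add]; ring
      _ = ((r / (|s| + 1)) ^ (N + 1))⁻¹ * (r ^ i.1 * (r / (|s| + 1)) ^ i.2) := by
          rw [div_mul_cancel₀ _ hK.ne']
      _ ≤ _ := by gcongr
  · have hS : ∀ i ∉ ({(1, N), (0, N + 1)} : Finset (ℕ × ℕ)),
        heatCoeff W i * ((0 : ℝ) ^ (i.1 + i.2 - (N + 1)) * y ^ i.1) = 0 := by
      rintro ⟨j, k⟩ hi
      simp only [Finset.mem_insert, Finset.mem_singleton, Prod.mk.injEq, not_or, not_and] at hi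
      by_cases hlt : j + 2 * k < 2 * N + 1
      · rw [heatCoeff_eq_zero hn hlt, zero_mul]
      · rw [zero_pow (by simp only; omega), zero_mul, mul_zero]
    dsimp only
    rw [tsum_eq_sum hS, Finset.sum_pair (by simp)]
    simp [heatCoeff, add_comm 1]
  · rw [h.eq_tsum _ _ (by simpa using hy) (by simpa using ht), ← tsum_mul_left]
    refine tsum_congr fun i => ?_
    simp only [add_sub_cancel_left]
    by_cases hi : heatCoeff W i = 0
    · rw [hi]; simp
    · have : t ^ (i.1 + i.2) = t ^ (N + 1) * t ^ (i.1 + i.2 - (N + 1)) := by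
        rw [← pow_add]; congr 1; have := hle i hi; omega
      rw [mul_pow, mul_right_comm, ← pow_add, this]
      ring

/-- A solution that vanishes to even order at a point has no zeros in a thin parabolic
neighbourhood of the time axis through this point. -/
theorem exists_ne_zero_of_even (h : HasHeatSeries u W r x₀ t₀) {N : ℕ}
    (hn : ∀ m < 2 * N, W m = 0) (hN : W (2 * N) ≠ 0) :
    ∃ ε > 0, ∀ x t, t ≠ 0 → |t| < ε → |x| ≤ ε * √|t| → u (x₀ + x) (t₀ + t) ≠ 0 := by
  have hr := h.pos
  -- the two signs of `t` are treated by the same substitution `x = τ z`, `t = ± τ²`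
  have key : ∀ σ : ℝ, |σ| = 1 → ∃ ε > 0, ∀ τ z, |τ| < ε → |z| < ε → 0 < τ →
      u (x₀ + τ * z) (t₀ + σ * τ ^ 2) ≠ 0 := by
    intro σ hσ
    have hσ0 : σ ≠ 0 := by rintro rfl; simp at hσ
    let w : ℝ × ℝ → ℝ := fun q => ∑' i : ℕ × ℕ, heatCoeff W i * σ ^ i.2 *
      (q.1 ^ (i.1 + 2 * i.2 - 2 * N) * q.2 ^ i.1)
    obtain ⟨ρ, hρ, hρ1, hρr⟩ : ∃ ρ, 0 < ρ ∧ ρ ≤ 1 ∧ ρ ≤ r :=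
      ⟨min 1 r, lt_min one_pos hr, min_le_left _ _, min_le_right _ _⟩
    have hw : AnalyticAt ℝ w (0, 0) := by
      refine h.analyticAt_tsum_blowup (fun i => heatCoeff W i * σ ^ i.2) (fun i => ?_) _ _ hρ one_pos
        (C := (ρ ^ (2 * N))⁻¹) (fun i hi => ?_) (by simp)
      · rw [abs_mul, abs_pow, hσ, one_pow, mul_one]
      · have hle : 2 * N ≤ i.1 + 2 * i.2 := by
          by_contra! hlt
          exact hi (heatCoeff_eq_zero hn hlt)
        have h2 : ρ ^ 2 ≤ r := by nlinarith
        calc ρ ^ (i.1 + 2 * i.2 - 2 * N) * 1 ^ i.1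
            = (ρ ^ (2 * N))⁻¹ * (ρ ^ i.1 * (ρ ^ 2) ^ i.2) := by
              rw [pow_sub₀ _ hρ.ne' hle, pow_add, ← pow_mul]; ring
          _ ≤ _ := by gcongr
    have hw0 : w (0, 0) ≠ 0 := by
      have hS : ∀ i ∉ ({(0, N)} : Finset (ℕ × ℕ)), heatCoeff W i * σ ^ i.2 *
          ((0 : ℝ) ^ (i.1 + 2 * i.2 - 2 * N) * 0 ^ i.1) = 0 := by
        rintro ⟨j, k⟩ hi
        simp only [Finset.mem_singleton, Prod.mk.injEq, not_and] at hi
        rcases j with _ | j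
        · by_cases hlt : 0 + 2 * k < 2 * N
          · rw [heatCoeff_eq_zero hn hlt, zero_mul, zero_mul]
          · have := hi rfl
            rw [zero_pow (by simp only; omega), zero_mul, mul_zero]
        · simp
      simp only [w]
      rw [tsum_eq_sum hS]
      simp [heatCoeff, hσ0, hN, Nat.factorial_ne_zero]
    have hev := hw.continuousAt.eventually_ne hw0
    obtain ⟨ε, hε, hball⟩ := Metric.eventually_nhds_iff.1 hev
    refine ⟨min ε ρ, lt_min hε hρ, fun τ z hτ hz hτ0 => ?_⟩
    have hτ1 := abs_lt.1 (hτ.trans_le (min_le_right _ _))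
    have hz1 := abs_lt.1 (hz.trans_le (min_le_right _ _))
    have hx : |τ * z| < r := by
      rw [abs_mul]
      have h1 : |τ| < 1 := (hτ.trans_le (min_le_right _ _)).trans_le hρ1
      have h2 : |z| < r := (hz.trans_le (min_le_right _ _)).trans_le hρr
      nlinarith [abs_nonneg τ, abs_nonneg z]
    have ht : |σ * τ ^ 2| < r := by
      rw [abs_mul, hσ, one_mul, abs_pow, sq_abs]
      nlinarith
    have e : u (x₀ + τ * z) (t₀ + σ * τ ^ 2) = τ ^ (2 * N) * w (τ, z) := by
      rw [h.eq_tsum _ _ (by simpa using hx) (by simpa using ht), ← tsum_mul_left]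
      refine tsum_congr fun i => ?_
      simp only [add_sub_cancel_left]
      by_cases hi : i.1 + 2 * i.2 < 2 * N
      · rw [heatCoeff_eq_zero hn hi]; simp
      · have : τ ^ (i.1 + 2 * i.2) = τ ^ (2 * N) * τ ^ (i.1 + 2 * i.2 - 2 * N) := by
          rw [← pow_add]; congr 1; omega
        rw [pow_add, pow_mul] at this
        linear_combination heatCoeff W i * σ ^ i.2 * z ^ i.1 * this
    rw [e]
    refine mul_ne_zero (pow_ne_zero _ hτ0.ne') (hball ?_)
    rw [Prod.dist_eq, max_lt_iff]
    simp only [Real.dist_eq, sub_zero]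
    exact ⟨hτ.trans_le (min_le_left _ _), hz.trans_le (min_le_left _ _)⟩
  obtain ⟨ε₁, hε₁, h₁⟩ := key 1 (by simp)
  obtain ⟨ε₂, hε₂, h₂⟩ := key (-1) (by simp)
  obtain ⟨ε, hε, hεm, hεs⟩ : ∃ ε, 0 < ε ∧ ε < min ε₁ ε₂ ∧ √ε ≤ min ε₁ ε₂ := by
    have hm : 0 < min ε₁ ε₂ := lt_min hε₁ hε₂
    have h3 : ∀ᶠ ε in 𝓝[>] (0 : ℝ), ε ∈ Ioo 0 (min ε₁ ε₂) := Ioo_mem_nhdsGT hm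
    have h4 : Filter.Tendsto (fun ε : ℝ => √ε) (𝓝[>] 0) (𝓝 0) := by
      have : ContinuousAt (fun ε : ℝ => √ε) 0 := by fun_prop
      simpa [ContinuousAt] using this.tendsto.mono_left nhdsWithin_le_nhds
    obtain ⟨ε, h5, h6⟩ := (h3.and (h4.eventually (Iic_mem_nhds hm))).exists
    exact ⟨ε, h5.1, h5.2, h6⟩
  refine ⟨ε, hε, fun x t ht0 ht hx => ?_⟩
  obtain ⟨τ, hτdef⟩ : ∃ τ, τ = √|t| := ⟨_, rfl⟩
  rw [← hτdef] at hx
  have hτ : 0 < τ := hτdef ▸ Real.sqrt_pos.2 (abs_pos.2 ht0)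
  have hτε : |τ| < min ε₁ ε₂ := by
    rw [abs_of_pos hτ, hτdef]
    exact (Real.sqrt_lt_sqrt (abs_nonneg _) ht).trans_le hεs
  have hz : |x / τ| < min ε₁ ε₂ := by
    rw [abs_div, abs_of_pos hτ, div_lt_iff₀ hτ]
    exact hx.trans_lt (by gcongr)
  have hxz : τ * (x / τ) = x := mul_div_cancel₀ _ hτ.ne'
  have hsq : τ ^ 2 = |t| := hτdef ▸ Real.sq_sqrt (abs_nonneg _)
  rcases lt_or_gt_of_ne ht0 with hneg | hpos
  · have := h₂ τ (x / τ) (hτε.trans_le (min_le_right _ _)) (hz.trans_le (min_le_right _ _)) hτ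
    rwa [hxz, hsq, abs_of_neg hneg, neg_one_mul, neg_neg] at this
  · have := h₁ τ (x / τ) (hτε.trans_le (min_le_left _ _)) (hz.trans_le (min_le_left _ _)) hτ
    rwa [hxz, hsq, abs_of_pos hpos, one_mul] at this

end HasHeatSeries

/-- The analytic implicit function theorem in the plane. -/
theorem AnalyticAt.exists_implicit {f : ℝ × ℝ → ℝ} {p : ℝ × ℝ} (hf : AnalyticAt ℝ f p)
    (h0 : f p = 0) {d : ℝ} (hd : HasDerivAt (fun s => f (p.1, s)) d p.2) (hd0 : d ≠ 0) :
    ∃ g : ℝ → ℝ, AnalyticAt ℝ g p.1 ∧ g p.1 = p.2 ∧ ∀ᶠ q in 𝓝 p, f q = 0 ↔ q.2 = g q.1 := by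
  have hc : ContDiffAt ℝ ⊤ f p := hf.contDiffAt
  have hcomp : HasDerivAt (fun s => f (p.1, s)) (fderiv ℝ f p (0, 1)) p.2 := by
    have h1 : HasDerivAt (fun s : ℝ => (p.1, s)) ((0 : ℝ), (1 : ℝ)) p.2 :=
      (hasDerivAt_const _ _).prodMk (hasDerivAt_id _)
    exact (hf.differentiableAt.hasFDerivAt (x := p)).comp_hasDerivAt p.2 h1
  have hval : fderiv ℝ f p (0, 1) = d := hcomp.unique hd
  have hinv : (fderiv ℝ f p ∘L .inr ℝ ℝ ℝ).IsInvertible := by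
    refine ⟨ContinuousLinearEquiv.unitsEquivAut ℝ (Units.mk0 d hd0), ?_⟩
    ext
    simp [hval]
  refine ⟨hc.implicitFunction (by simp) hinv, ?_, hc.implicitFunction_apply_self (by simp) hinv, ?_⟩
  · exact (hc.contDiffAt_implicitFunction (by simp) hinv).analyticAt
  · filter_upwards [hc.eventually_apply_eq_iff_implicitFunction (by simp) hinv] with q hq
    rw [h0] at hq
    rw [hq, eq_comm]

/-! ### The zero set near a zero -/

/-- The graph of `φ` over the `x`-axis is an analytic branch of zeros through `(x₀, t₀)` on which the
time has a strict local maximum at this point. -/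
structure IsCap (u : ℝ → ℝ → ℝ) (x₀ t₀ : ℝ) (φ : ℝ → ℝ) : Prop where
  analyticAt : AnalyticAt ℝ φ x₀
  apply_eq : φ x₀ = t₀
  deriv_pos : ∀ᶠ x in 𝓝[<] x₀, 0 < deriv φ x
  deriv_neg : ∀ᶠ x in 𝓝[>] x₀, deriv φ x < 0
  zero : ∀ᶠ x in 𝓝 x₀, u x (φ x) = 0

/-- The graph of `ψ` over the `t`-axis is an analytic branch of zeros through `(x₀, t₀)`. -/
structure IsStem (u : ℝ → ℝ → ℝ) (x₀ t₀ : ℝ) (ψ : ℝ → ℝ) : Prop where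
  analyticAt : AnalyticAt ℝ ψ t₀
  apply_eq : ψ t₀ = x₀
  zero : ∀ᶠ t in 𝓝 t₀, u (ψ t) t = 0

theorem isCap_of_parabola {u : ℝ → ℝ → ℝ} {x₀ t₀ : ℝ} {S : ℝ → ℝ} (hS : AnalyticAt ℝ S 0)
    (h0 : S 0 < 0) (hz : ∀ᶠ x in 𝓝 (0 : ℝ), u (x₀ + x) (t₀ + x ^ 2 * S x) = 0) :
    IsCap u x₀ t₀ (fun x => t₀ + (x - x₀) ^ 2 * S (x - x₀)) := by
  have hlim : Filter.Tendsto (fun x => x - x₀) (𝓝 x₀) (𝓝 0) := by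
    have : ContinuousAt (fun x => x - x₀) x₀ := by fun_prop
    simpa [ContinuousAt] using this
  have hsub : AnalyticAt ℝ (fun x => x - x₀) x₀ := analyticAt_id.sub analyticAt_const
  have hderiv : ∀ᶠ x in 𝓝 x₀, deriv (fun x => t₀ + (x - x₀) ^ 2 * S (x - x₀)) x =
      (x - x₀) * (2 * S (x - x₀) + (x - x₀) * deriv S (x - x₀)) := by
    filter_upwards [hlim.eventually hS.eventually_analyticAt] with x hx
    have h1 : HasDerivAt (fun x => S (x - x₀)) (deriv S (x - x₀)) x :=
      hx.differentiableAt.hasDerivAt.comp_sub_const x x₀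
    have h2 : HasDerivAt (fun x => (x - x₀) ^ 2) (2 * (x - x₀)) x := by
      simpa using ((hasDerivAt_id x).sub_const x₀).fun_pow 2
    rw [((h2.fun_mul h1).const_add t₀).deriv]
    ring
  have hneg : ∀ᶠ x in 𝓝 x₀, 2 * S (x - x₀) + (x - x₀) * deriv S (x - x₀) < 0 := by
    have hc : ContinuousAt (fun y => 2 * S y + y * deriv S y) 0 :=
      (hS.continuousAt.const_mul 2).add (continuousAt_id.mul hS.deriv.continuousAt)
    have h1 : 2 * S 0 + 0 * deriv S 0 < 0 := by linarith
    exact hlim.eventually (hc.tendsto.eventually_lt_const h1)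
  refine ⟨?_, by simp, ?_, ?_, ?_⟩
  · exact analyticAt_const.add ((hsub.pow 2).mul (hS.comp_of_eq hsub (by simp)))
  · filter_upwards [nhdsWithin_le_nhds hderiv, nhdsWithin_le_nhds hneg, self_mem_nhdsWithin]
      with x h1 h2 h3
    rw [h1]
    exact mul_pos_of_neg_of_neg (sub_neg.2 h3) h2
  · filter_upwards [nhdsWithin_le_nhds hderiv, nhdsWithin_le_nhds hneg, self_mem_nhdsWithin]
      with x h1 h2 h3
    rw [h1]
    exact mul_neg_of_pos_of_neg (sub_pos.2 h3) h2
  · filter_upwards [hlim.eventually hz] with x hx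
    rwa [add_sub_cancel] at hx

namespace HasHeatSeries

variable {u : ℝ → ℝ → ℝ} {W : ℕ → ℝ} {r x₀ t₀ : ℝ}

/-- Away from the time axis, the zeros near a zero of order `n` lie on analytic curves
`t = x ^ 2 * S x`, one for each real root of the `n`-th heat polynomial, and they are regular. -/
theorem exists_parabolic_branches (h : HasHeatSeries u W r x₀ t₀) {n : ℕ} (hn1 : 1 ≤ n)
    (hn : ∀ m < n, W m = 0) (hWn : W n ≠ 0) :
    ∃ S : ℝ → ℝ → ℝ, (∀ ρ, (heatPoly n).eval ρ = 0 → AnalyticAt ℝ (S ρ) 0 ∧ S ρ 0 = ρ ∧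
        ∀ᶠ x in 𝓝 (0 : ℝ), u (x₀ + x) (t₀ + x ^ 2 * S ρ x) = 0) ∧
      ∀ K, ∀ᶠ q : ℝ × ℝ in 𝓝 (0, 0), |q.2| ≤ K * q.1 ^ 2 → q.1 ≠ 0 →
        u (x₀ + q.1) (t₀ + q.2) = 0 →
        (∃ ρ, (heatPoly n).eval ρ = 0 ∧ q.2 = q.1 ^ 2 * S ρ q.1) ∧
          _root_.partialT u (x₀ + q.1) (t₀ + q.2) ≠ 0 := by
  have hr := h.pos
  obtain ⟨v, hva, hv0, hv⟩ := h.exists_parabolic_blowup hn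
  have himp : ∀ ρ, (heatPoly n).eval ρ = 0 → ∃ g : ℝ → ℝ, AnalyticAt ℝ g 0 ∧ g 0 = ρ ∧
      ∀ᶠ q in 𝓝 ((0 : ℝ), ρ), v q = 0 ↔ q.2 = g q.1 := by
    intro ρ hρ
    refine (hva ρ).exists_implicit (by rw [hv0, hρ, mul_zero])
      (d := W n * (Polynomial.derivative (heatPoly n)).eval ρ) ?_
      (mul_ne_zero hWn (eval_derivative_heatPoly_ne_zero hρ))
    simp only [hv0]
    exact ((heatPoly n).hasDerivAt ρ).const_mul _
  choose! S hSa hS0 hS using himp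
  -- the blow-up of the time derivative does not vanish at the roots
  obtain ⟨v₂, hv₂c, hv₂⟩ : ∃ v₂ : ℝ × ℝ → ℝ,
      (∀ ρ, (heatPoly n).eval ρ = 0 → ∀ᶠ q in 𝓝 ((0 : ℝ), ρ), v₂ q ≠ 0) ∧
      ∀ x s, |x| < r / 2 → |x ^ 2 * s| < r / 2 → x ≠ 0 → v₂ (x, s) ≠ 0 →
        _root_.partialT u (x₀ + x) (t₀ + x ^ 2 * s) ≠ 0 := by
    obtain rfl | ⟨m, rfl⟩ : n = 1 ∨ ∃ m, n = m + 2 := by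
      rcases hn1.eq_or_lt with h1 | h2
      exacts [Or.inl h1.symm, Or.inr ⟨n - 2, by omega⟩]
    · -- for `n = 1` there are no roots
      refine ⟨fun _ => 0, fun ρ hρ => ?_, by simp⟩
      rw [eval_heatPoly] at hρ
      simp [Finset.sum_range_succ, heatPolyCoeff] at hρ
    · obtain ⟨v₂, hva, hv0, hv⟩ := h.partialT.exists_parabolic_blowup (n := m)
        (fun k hk => hn (k + 2) (by omega))
      refine ⟨v₂, fun ρ hρ => (hva ρ).continuousAt.eventually_ne ?_, fun x s hx hs hx0 h2 => ?_⟩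
      · rw [hv0, ← derivative_heatPoly]
        exact mul_ne_zero hWn (eval_derivative_heatPoly_ne_zero hρ)
      · rw [hv x s hx hs]
        exact mul_ne_zero (pow_ne_zero _ hx0) h2
  refine ⟨S, fun ρ hρ => ⟨hSa ρ hρ, hS0 ρ hρ, ?_⟩, fun K => ?_⟩
  · have hc := (hSa ρ hρ).continuousAt
    have h1 : Filter.Tendsto (fun x => (x, S ρ x)) (𝓝 0) (𝓝 (0, ρ)) := by
      have : ContinuousAt (fun x => (x, S ρ x)) 0 := continuousAt_id.prodMk hc
      simpa [ContinuousAt, hS0 ρ hρ] using this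
    have h2 : ∀ᶠ x in 𝓝 (0 : ℝ), |x| < r :=
      (isOpen_lt (by fun_prop) continuous_const).mem_nhds (by simpa using hr)
    have h3 : ∀ᶠ x in 𝓝 (0 : ℝ), |x ^ 2 * S ρ x| < r := by
      have : ContinuousAt (fun x => |x ^ 2 * S ρ x|) 0 := (by fun_prop)
      exact this.eventually_lt_const (by simpa using hr)
    filter_upwards [h1.eventually (hS ρ hρ), h2, h3] with x hx1 hx2 hx3
    rw [hv x _ hx2 hx3, hx1.2 rfl, mul_zero]
  · -- a compactness argument in the blow-up variable `s`
    have hP : ∀ᶠ x in 𝓝 (0 : ℝ), ∀ s ∈ Icc (-K) K, v (x, s) = 0 →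
        (∃ ρ, (heatPoly n).eval ρ = 0 ∧ s = S ρ x) ∧ v₂ (x, s) ≠ 0 := by
      refine isCompact_Icc.eventually_forall_of_forall_eventually (P := fun x s => v (x, s) = 0 →
        (∃ ρ, (heatPoly n).eval ρ = 0 ∧ s = S ρ x) ∧ v₂ (x, s) ≠ 0) fun s _ => ?_
      by_cases hs : (heatPoly n).eval s = 0
      · filter_upwards [hS s hs, hv₂c s hs] with z hz1 hz2 hz3
        exact ⟨⟨s, hs, hz1.1 hz3⟩, hz2⟩
      · have : v (0, s) ≠ 0 := by rw [hv0]; exact mul_ne_zero hWn hs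
        filter_upwards [(hva s).continuousAt.eventually_ne this] with z hz1 hz2
        exact absurd hz2 hz1
    have h1 : ∀ᶠ q : ℝ × ℝ in 𝓝 (0, 0), |q.1| < r / 2 :=
      (isOpen_lt (by fun_prop) continuous_const).mem_nhds (by simpa using hr)
    have h2 : ∀ᶠ q : ℝ × ℝ in 𝓝 (0, 0), |q.2| < r / 2 :=
      (isOpen_lt (by fun_prop) continuous_const).mem_nhds (by simpa using hr)
    have hfst : Filter.Tendsto (Prod.fst : ℝ × ℝ → ℝ) (𝓝 (0, 0)) (𝓝 0) :=
      continuous_fst.tendsto' _ _ rfl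
    filter_upwards [hfst.eventually hP, h1, h2] with q hq hq1 hq2 hK hx hu
    obtain ⟨s, hs⟩ : ∃ s, q.2 = q.1 ^ 2 * s := ⟨q.2 / q.1 ^ 2, by field_simp⟩
    have hx2 : 0 < q.1 ^ 2 := by positivity
    have hsK : s ∈ Icc (-K) K := by
      rw [mem_Icc, ← abs_le]
      rw [hs, abs_mul, abs_of_pos hx2, mul_comm] at hK
      exact le_of_mul_le_mul_right hK hx2
    rw [hs] at hq2 hu ⊢
    rw [hv _ _ (by linarith) (by linarith)] at hu
    obtain ⟨⟨ρ, hρ, hρs⟩, h2⟩ := hq s hsK ((mul_eq_zero.1 hu).resolve_left (pow_ne_zero _ hx))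
    exact ⟨⟨ρ, hρ, by rw [hρs]⟩, hv₂ _ _ hq1 hq2 hx h2⟩

theorem abs_le_of_inv_sq_mul_sq_lt {ε x t : ℝ} (hε : 0 < ε) (h : (ε ^ 2)⁻¹ * x ^ 2 < |t|) :
    |x| ≤ ε * √|t| := by
  rw [inv_mul_lt_iff₀ (by positivity)] at h
  rw [← Real.sqrt_sq hε.le, ← Real.sqrt_mul (by positivity)]
  exact Real.abs_le_sqrt h.le

/-- Near the time axis, the zeros near a zero of odd order lie on a single analytic curve
transversal to the `x`-axis, and they are regular. The curve exists by the implicit function theorem,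
and it contains all these zeros by Rolle's theorem: `u_x` vanishes to even order, hence it has no
zeros near the time axis. -/
theorem exists_vertical_branch (h : HasHeatSeries u W r x₀ t₀) {N : ℕ}
    (hn : ∀ m < 2 * N + 1, W m = 0) (hN : W (2 * N + 1) ≠ 0) :
    ∃ Y : ℝ → ℝ, AnalyticAt ℝ Y 0 ∧ (∀ᶠ t in 𝓝 (0 : ℝ), u (x₀ + t * Y t) (t₀ + t) = 0) ∧
      ∃ K > 0, ∀ᶠ q : ℝ × ℝ in 𝓝 (0, 0), K * q.1 ^ 2 < |q.2| → u (x₀ + q.1) (t₀ + q.2) = 0 →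
        q.1 = q.2 * Y q.2 ∧ _root_.partialX u (x₀ + q.1) (t₀ + q.2) ≠ 0 := by
  have hr := h.pos
  obtain ⟨w, hwa, hw0, hw⟩ := h.exists_vertical_blowup hn
  have ha : W (2 * N + 1) / N.factorial ≠ 0 := div_ne_zero hN (by positivity)
  obtain ⟨y₀, hy₀⟩ : ∃ y₀, W (2 * N + 1) / N.factorial * y₀ + heatCoeff W (0, N + 1) = 0 :=
    ⟨-heatCoeff W (0, N + 1) / (W (2 * N + 1) / N.factorial), by field_simp; ring⟩
  obtain ⟨Y, hYa, hY0, hY⟩ := (hwa y₀).exists_implicit (by rw [hw0, hy₀])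
    (d := W (2 * N + 1) / N.factorial) (by
      simp only [hw0]
      simpa using ((hasDerivAt_id y₀).const_mul (W (2 * N + 1) / N.factorial)).add_const
        (heatCoeff W (0, N + 1))) ha
  simp only at hYa hY0
  have hYc := hYa.continuousAt
  have h1 : Filter.Tendsto (fun t => (t, Y t)) (𝓝 0) (𝓝 (0, y₀)) := by
    have : ContinuousAt (fun t => (t, Y t)) 0 := continuousAt_id.prodMk hYc
    simpa [ContinuousAt, hY0] using this
  have h2 : ∀ᶠ t in 𝓝 (0 : ℝ), |t| < r / 2 :=
    (isOpen_lt (by fun_prop) continuous_const).mem_nhds (by simpa using hr)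
  have h3 : ∀ᶠ t in 𝓝 (0 : ℝ), |t * Y t| < r := by
    have : ContinuousAt (fun t => |t * Y t|) 0 := by fun_prop
    exact this.eventually_lt_const (by simpa using hr)
  have hzero : ∀ᶠ t in 𝓝 (0 : ℝ), u (x₀ + t * Y t) (t₀ + t) = 0 := by
    filter_upwards [h1.eventually hY, h2, h3] with t ht1 ht2 ht3
    rw [hw t _ (by linarith) ht3, ht1.2 rfl, mul_zero]
  obtain ⟨ε, hε, hne⟩ := h.partialX.exists_ne_zero_of_even (N := N)
    (fun m hm => hn (m + 1) (by omega)) hN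
  refine ⟨Y, hYa, hzero, (ε ^ 2)⁻¹, by positivity, ?_⟩
  have h4 : ∀ᶠ t in 𝓝 (0 : ℝ), √|t| * |Y t| < ε := by
    have : ContinuousAt (fun t => √|t| * |Y t|) 0 := by fun_prop
    exact this.eventually_lt_const (by simpa using hε)
  have h5 : ∀ᶠ t in 𝓝 (0 : ℝ), ε * √|t| < r / 2 := by
    have : ContinuousAt (fun t : ℝ => ε * √|t|) 0 := by fun_prop
    exact this.eventually_lt_const (by simpa using hr)
  have h6 : ∀ᶠ t in 𝓝 (0 : ℝ), |t| < ε :=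
    (isOpen_lt (by fun_prop) continuous_const).mem_nhds (by simpa using hε)
  have hsnd : Filter.Tendsto (Prod.snd : ℝ × ℝ → ℝ) (𝓝 (0, 0)) (𝓝 0) :=
    continuous_snd.tendsto' _ _ rfl
  filter_upwards [hsnd.eventually (((((hzero.and h2).and h4).and h5).and h6))]
    with q ⟨⟨⟨⟨hq1, hq2⟩, hq4⟩, hq5⟩, hq6⟩ hK hu
  have ht0 : q.2 ≠ 0 := by
    intro h0
    rw [h0, abs_zero] at hK
    have : 0 ≤ (ε ^ 2)⁻¹ * q.1 ^ 2 := by positivity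
    linarith
  have hx : |q.1| ≤ ε * √|q.2| := abs_le_of_inv_sq_mul_sq_lt hε hK
  have hY' : |q.2 * Y q.2| ≤ ε * √|q.2| := by
    rw [abs_mul]
    nth_rw 1 [← Real.mul_self_sqrt (abs_nonneg q.2)]
    rw [mul_assoc, mul_comm ε]
    gcongr
  refine ⟨?_, hne q.1 q.2 ht0 hq6 hx⟩
  -- two zeros on the same time slice would give a zero of `u_x` between them
  have hrolle : ∀ a b, |a| ≤ ε * √|q.2| → |b| ≤ ε * √|q.2| → u (x₀ + a) (t₀ + q.2) = 0 →
      u (x₀ + b) (t₀ + q.2) = 0 → ¬ a < b := by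
    intro a b ha hb hua hub hab
    obtain ⟨c, hc, hc0⟩ := exists_deriv_eq_zero (f := fun y => u y (t₀ + q.2))
      (a := x₀ + a) (b := x₀ + b) (by linarith) (fun y hy => by
        refine (h.hasDerivAt_fst (x := y) (t := t₀ + q.2) ?_ (by simpa using hq2)).continuousAt.continuousWithinAt
        rw [abs_lt]
        constructor <;> linarith [hy.1, hy.2, (abs_le.1 ha).1, (abs_le.1 hb).2]) (by rw [hua, hub])
    refine hne (c - x₀) q.2 ht0 hq6 ?_ (by rw [add_sub_cancel]; exact hc0)
    rw [abs_le]
    constructor <;> linarith [hc.1, hc.2, (abs_le.1 ha).1, (abs_le.1 hb).2]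
  rcases lt_trichotomy q.1 (q.2 * Y q.2) with hlt | heq | hgt
  · exact absurd hlt (hrolle _ _ hx hY' hu hq1)
  · exact heq
  · exact absurd hgt (hrolle _ _ hY' hx hq1 hu)

theorem exists_forall_ne_zero_near_axis (h : HasHeatSeries u W r x₀ t₀) {N : ℕ}
    (hn : ∀ m < 2 * N, W m = 0) (hN : W (2 * N) ≠ 0) :
    ∃ K > 0, ∀ᶠ q : ℝ × ℝ in 𝓝 (0, 0), K * q.1 ^ 2 < |q.2| → u (x₀ + q.1) (t₀ + q.2) ≠ 0 := by
  obtain ⟨ε, hε, hne⟩ := h.exists_ne_zero_of_even hn hN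
  refine ⟨(ε ^ 2)⁻¹, by positivity, ?_⟩
  have h6 : ∀ᶠ q : ℝ × ℝ in 𝓝 (0, 0), |q.2| < ε :=
    (isOpen_lt (by fun_prop) continuous_const).mem_nhds (by simpa using hε)
  filter_upwards [h6] with q hq hK
  refine hne _ _ ?_ hq (abs_le_of_inv_sq_mul_sq_lt hε hK)
  intro h0
  rw [h0, abs_zero] at hK
  have : 0 ≤ (ε ^ 2)⁻¹ * q.1 ^ 2 := by positivity
  linarith

end HasHeatSeries

/-- Near the zero `(x₀, t₀)` the zero set of `u` is the union of the graphs of the finitely many caps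
`φ ∈ Φ` and of at most one stem `ψ ∈ Ψ`, and all the other zeros near this point are regular. -/
structure IsLocalBranching (u : ℝ → ℝ → ℝ) (x₀ t₀ : ℝ) (Φ Ψ : Set (ℝ → ℝ)) : Prop where
  finite : Φ.Finite
  subsingleton : Ψ.Subsingleton
  isCap : ∀ φ ∈ Φ, IsCap u x₀ t₀ φ
  isStem : ∀ ψ ∈ Ψ, IsStem u x₀ t₀ ψ
  cover : ∀ᶠ q : ℝ × ℝ in 𝓝 (x₀, t₀), u q.1 q.2 = 0 →
    (∃ φ ∈ Φ, q.2 = φ q.1) ∨ ∃ ψ ∈ Ψ, q.1 = ψ q.2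
  regular : ∀ᶠ q : ℝ × ℝ in 𝓝[≠] (x₀, t₀), u q.1 q.2 = 0 →
    partialX u q.1 q.2 ≠ 0 ∨ partialT u q.1 q.2 ≠ 0

theorem finite_setOf_root_heatPoly (n : ℕ) : {ρ | (heatPoly n).eval ρ = 0}.Finite :=
  (heatPoly n).finite_setOfPred_isRoot (heatPoly_ne_zero n)

namespace HasHeatSeries

variable {u : ℝ → ℝ → ℝ} {W : ℕ → ℝ} {r x₀ t₀ : ℝ}

/-- A zero of order `n` has one cap for each root of the `n`-th heat polynomial, and a stem if `n` is
odd. For `n ≤ 2` this is a single branch. -/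
theorem exists_isLocalBranching (h : HasHeatSeries u W r x₀ t₀) {n : ℕ} (hn1 : 1 ≤ n)
    (hn : ∀ m < n, W m = 0) (hWn : W n ≠ 0) :
    ∃ Φ Ψ : Set (ℝ → ℝ), IsLocalBranching u x₀ t₀ Φ Ψ ∧
      (n ≤ 2 → (∃ φ, Φ = {φ} ∧ Ψ = ∅) ∨ ∃ ψ, Φ = ∅ ∧ Ψ = {ψ}) := by
  obtain ⟨S, hS, hpar⟩ := h.exists_parabolic_branches hn1 hn hWn
  let c : ℝ → ℝ → ℝ := fun ρ x => t₀ + (x - x₀) ^ 2 * S ρ (x - x₀)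
  let Φ : Set (ℝ → ℝ) := c '' {ρ | (heatPoly n).eval ρ = 0}
  have hfin : Φ.Finite := (finite_setOf_root_heatPoly n).image _
  have hcap : ∀ φ ∈ Φ, IsCap u x₀ t₀ φ := by
    rintro _ ⟨ρ, hρ, rfl⟩
    obtain ⟨h1, h2, h3⟩ := hS ρ hρ
    exact isCap_of_parabola h1 (by rw [h2]; exact heatPoly_root_neg hρ) h3
  have hlim : Filter.Tendsto (fun q : ℝ × ℝ => (q.1 - x₀, q.2 - t₀)) (𝓝 (x₀, t₀)) (𝓝 (0, 0)) := by
    have : ContinuousAt (fun q : ℝ × ℝ => (q.1 - x₀, q.2 - t₀)) (x₀, t₀) := by fun_prop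
    simpa [ContinuousAt] using this
  have hne0 : ∀ q : ℝ × ℝ, ∀ K, q ≠ (x₀, t₀) → |q.2 - t₀| ≤ K * (q.1 - x₀) ^ 2 → q.1 - x₀ ≠ 0 := by
    intro q K hq hle h0
    rw [h0] at hle
    have h1 : q.2 - t₀ = 0 := by
      rw [← abs_nonpos_iff]; simpa using hle
    exact hq (Prod.ext (sub_eq_zero.1 h0) (sub_eq_zero.1 h1))
  rcases n.even_or_odd' with ⟨N, hN | hN⟩
  · subst hN
    obtain ⟨ρ₀, hρ₀⟩ := exists_root_heatPoly (n := 2 * N) (by omega)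
    obtain ⟨K, hK, haxis⟩ := h.exists_forall_ne_zero_near_axis hn hWn
    have hall : ∀ᶠ q : ℝ × ℝ in 𝓝 (x₀, t₀), q ≠ (x₀, t₀) → u q.1 q.2 = 0 →
        (∃ φ ∈ Φ, q.2 = φ q.1) ∧ _root_.partialT u q.1 q.2 ≠ 0 := by
      filter_upwards [hlim.eventually (hpar K), hlim.eventually haxis] with q h1 h2 hq hu
      simp only [add_sub_cancel] at h1 h2
      rcases le_or_gt |q.2 - t₀| (K * (q.1 - x₀) ^ 2) with hle | hgt
      · obtain ⟨⟨ρ, hρ, hq2⟩, h3⟩ := h1 hle (hne0 q K hq hle) hu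
        exact ⟨⟨c ρ, ⟨ρ, hρ, rfl⟩, by simp only [c]; linarith⟩, h3⟩
      · exact absurd hu (h2 hgt)
    refine ⟨Φ, ∅, ⟨hfin, subsingleton_empty, hcap, by simp, ?_, ?_⟩, ?_⟩
    · filter_upwards [hall] with q hq hu
      by_cases hq0 : q = (x₀, t₀)
      · exact Or.inl ⟨c ρ₀, ⟨ρ₀, hρ₀, rfl⟩, by simp [c, hq0]⟩
      · exact Or.inl (hq hq0 hu).1
    · filter_upwards [nhdsWithin_le_nhds hall, self_mem_nhdsWithin] with q hq hq0 hu
      exact Or.inr (hq hq0 hu).2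
    · intro hle
      obtain rfl : N = 1 := by omega
      refine Or.inl ⟨c (-(1 / 2)), ?_, rfl⟩
      have : {ρ | (heatPoly (2 * 1)).eval ρ = 0} = {-(1 / 2)} := by
        ext ρ
        rw [mem_ofPred_eq, eval_heatPoly]
        simp [Finset.sum_range_succ, heatPolyCoeff]
        constructor <;> intro h <;> linarith
      simp only [Φ, this, image_singleton]
  · subst hN
    obtain ⟨Y, hYa, hY0, K, hK, haxis⟩ := h.exists_vertical_branch hn hWn
    let ψ : ℝ → ℝ := fun t => x₀ + (t - t₀) * Y (t - t₀)
    have hstem : IsStem u x₀ t₀ ψ := by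
      have hsub : AnalyticAt ℝ (fun x => x - t₀) t₀ := analyticAt_id.sub analyticAt_const
      refine ⟨analyticAt_const.add (hsub.mul (hYa.comp_of_eq hsub (by simp))), by simp [ψ], ?_⟩
      have hlim : Filter.Tendsto (fun t => t - t₀) (𝓝 t₀) (𝓝 0) := by
        have : ContinuousAt (fun t => t - t₀) t₀ := by fun_prop
        simpa [ContinuousAt] using this
      filter_upwards [hlim.eventually hY0] with t ht
      rwa [add_sub_cancel] at ht
    have hall : ∀ᶠ q : ℝ × ℝ in 𝓝 (x₀, t₀), q ≠ (x₀, t₀) → u q.1 q.2 = 0 →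
        ((∃ φ ∈ Φ, q.2 = φ q.1) ∨ q.1 = ψ q.2) ∧
          (_root_.partialX u q.1 q.2 ≠ 0 ∨ _root_.partialT u q.1 q.2 ≠ 0) := by
      filter_upwards [hlim.eventually (hpar K), hlim.eventually haxis] with q h1 h2 hq hu
      simp only [add_sub_cancel] at h1 h2
      rcases le_or_gt |q.2 - t₀| (K * (q.1 - x₀) ^ 2) with hle | hgt
      · obtain ⟨⟨ρ, hρ, hq2⟩, h3⟩ := h1 hle (hne0 q K hq hle) hu
        exact ⟨Or.inl ⟨c ρ, ⟨ρ, hρ, rfl⟩, by simp only [c]; linarith⟩, Or.inr h3⟩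
      · obtain ⟨h3, h4⟩ := h2 hgt hu
        exact ⟨Or.inr (by simp only [ψ]; linarith), Or.inl h4⟩
    refine ⟨Φ, {ψ}, ⟨hfin, subsingleton_singleton, hcap, by simpa using hstem, ?_, ?_⟩, ?_⟩
    · filter_upwards [hall] with q hq hu
      by_cases hq0 : q = (x₀, t₀)
      · exact Or.inr ⟨ψ, rfl, by simp [ψ, hq0]⟩
      · simpa using (hq hq0 hu).1
    · filter_upwards [nhdsWithin_le_nhds hall, self_mem_nhdsWithin] with q hq hq0 hu
      exact (hq hq0 hu).2
    · intro hle
      obtain rfl : N = 0 := by omega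
      refine Or.inr ⟨ψ, ?_, rfl⟩
      have : {ρ | (heatPoly (2 * 0 + 1)).eval ρ = 0} = ∅ := by
        ext ρ
        rw [mem_ofPred_eq, eval_heatPoly]
        simp [Finset.sum_range_succ, heatPolyCoeff]
      simp only [Φ, this, image_empty]

theorem apply_center (h : HasHeatSeries u W r x₀ t₀) : u x₀ t₀ = W 0 := by
  have hr := h.pos
  rw [h.eq_tsum x₀ t₀ (by simpa) (by simpa), tsum_eq_single (0, 0)]
  · simp [heatCoeff]
  · rintro ⟨j, k⟩ hjk
    rcases j with _ | j
    · rcases k with _ | k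
      · exact absurd rfl hjk
      · simp
    · simp

end HasHeatSeries

theorem isPreconnected_halfPlane : IsPreconnected halfPlane :=
  ((convex_Ioi (0 : ℝ)).linear_preimage (LinearMap.snd ℝ ℝ ℝ)).isPreconnected

theorem isOpen_halfPlane : IsOpen halfPlane := isOpen_lt continuous_const continuous_snd

/-- The setting of the global part of the argument: a continuous function whose zeros in the
half-plane all branch in the way described by `IsLocalBranching`, and do not branch at all where
they are regular. -/
structure HasBranchingZeros (u : ℝ → ℝ → ℝ) : Prop where
  continuousOn : ContinuousOn (fun p : ℝ × ℝ => u p.1 p.2) halfPlane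
  exists_branching : ∀ p ∈ zeroSet u, ∃ Φ Ψ, IsLocalBranching u p.1 p.2 Φ Ψ ∧
    (p ∈ regularZeros u → (∃ φ, Φ = {φ} ∧ Ψ = ∅) ∨ ∃ ψ, Φ = ∅ ∧ Ψ = {ψ})

theorem IsHeatSolution.hasBranchingZeros {u : ℝ → ℝ → ℝ} (hu : IsHeatSolution u)
    (hbdd : ∃ M : ℝ, ∀ x t : ℝ, 0 < t → |u x t| ≤ M)
    (hnontrivial : ∃ x t : ℝ, 0 < t ∧ u x t ≠ 0) : HasBranchingZeros u where
  continuousOn := hu.continuousOn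
  exists_branching := by
    classical
    rintro ⟨x₀, t₀⟩ ⟨ht₀, hz⟩
    have ht₀' : 0 < t₀ := ht₀
    obtain ⟨W, r, h⟩ := hu.exists_hasHeatSeries hbdd x₀ ht₀'
    -- by analyticity, a nontrivial solution has no zero of infinite order
    have hex : ∃ n, W n ≠ 0 := by
      by_contra! hW
      have hana : AnalyticOnNhd ℝ (fun p : ℝ × ℝ => u p.1 p.2) halfPlane := fun p hp => by
        obtain ⟨W, r, h⟩ := hu.exists_hasHeatSeries hbdd p.1 hp
        exact h.analyticAt
      have hev : (fun p : ℝ × ℝ => u p.1 p.2) =ᶠ[𝓝 (x₀, t₀)] 0 := by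
        have h1 : ∀ᶠ q : ℝ × ℝ in 𝓝 (x₀, t₀), |q.1 - x₀| < r :=
          (isOpen_lt (by fun_prop) continuous_const).mem_nhds (by simpa using h.pos)
        have h2 : ∀ᶠ q : ℝ × ℝ in 𝓝 (x₀, t₀), |q.2 - t₀| < r :=
          (isOpen_lt (by fun_prop) continuous_const).mem_nhds (by simpa using h.pos)
        filter_upwards [h1, h2] with q hq1 hq2
        rw [h.eq_tsum _ _ hq1 hq2]
        simp [heatCoeff, hW]
      have := hana.eqOn_zero_of_preconnected_of_eventuallyEq_zero isPreconnected_halfPlane ht₀ hev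
      obtain ⟨x, t, ht, hne⟩ := hnontrivial
      exact hne (this (show (x, t) ∈ halfPlane from ht))
    have hmin : ∀ m < Nat.find hex, W m = 0 := fun m hm => by simpa using Nat.find_min hex hm
    have h1 : 1 ≤ Nat.find hex := by
      rw [Nat.one_le_iff_ne_zero]
      intro h0
      have := Nat.find_spec hex
      rw [h0, ← h.apply_center] at this
      exact this hz
    obtain ⟨Φ, Ψ, hb, hreg⟩ := h.exists_isLocalBranching h1 hmin (Nat.find_spec hex)
    refine ⟨Φ, Ψ, hb, fun hp => hreg ?_⟩
    -- `u_x = W 1` and `u_t = W 2` at the zero, so that a regular zero has order at most two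
    by_contra! h2
    refine hp.2 ?_
    simp only
    rw [h.partialX.apply_center, h.partialT.apply_center, hmin _ (by omega), hmin _ (by omega)]
    simp

/-! ### Vertical arcs of zeros -/

theorem IsCap.u_eq_zero {u : ℝ → ℝ → ℝ} {x₀ t₀ : ℝ} {φ : ℝ → ℝ} (h : IsCap u x₀ t₀ φ) :
    u x₀ t₀ = 0 := by
  have := h.zero.self_of_nhds
  rwa [h.apply_eq] at this

theorem tendsto_add_mul_nhdsGT (x₀ σ : ℝ) :
    Filter.Tendsto (fun y => x₀ + σ * y) (𝓝[>] 0) (𝓝 x₀) := by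
  have : ContinuousAt (fun y => x₀ + σ * y) 0 := by fun_prop
  simpa [ContinuousAt] using this.tendsto.mono_left nhdsWithin_le_nhds

/-- The two halves of a cap: for each sign `σ`, the function `φ (x₀ + σ y)` is strictly decreasing
for small `y ≥ 0`. -/
theorem IsCap.exists_strictAntiOn {u : ℝ → ℝ → ℝ} {x₀ t₀ : ℝ} {φ : ℝ → ℝ} (h : IsCap u x₀ t₀ φ)
    (ht₀ : 0 < t₀) {σ : ℝ} (hσ : σ = 1 ∨ σ = -1) {ε : ℝ} (hε : 0 < ε) :
    ∃ δ > 0, δ ≤ ε ∧ StrictAntiOn (fun y => φ (x₀ + σ * y)) (Ico 0 δ) ∧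
      ∀ y ∈ Ioo 0 δ, AnalyticAt ℝ φ (x₀ + σ * y) ∧ deriv φ (x₀ + σ * y) ≠ 0 ∧
        u (x₀ + σ * y) (φ (x₀ + σ * y)) = 0 ∧ 0 < φ (x₀ + σ * y) := by
  have hd : ∀ᶠ y in 𝓝[>] (0 : ℝ), σ * deriv φ (x₀ + σ * y) < 0 := by
    rcases hσ with rfl | rfl
    · have h1 : Filter.Tendsto (fun y => x₀ + 1 * y) (𝓝[>] 0) (𝓝[>] x₀) := by
        refine tendsto_nhdsWithin_iff.2 ⟨tendsto_add_mul_nhdsGT x₀ 1, ?_⟩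
        filter_upwards [self_mem_nhdsWithin] with y hy
        have : 0 < y := hy
        show x₀ < x₀ + 1 * y
        linarith
      filter_upwards [h1.eventually h.deriv_neg] with y hy
      linarith
    · have h1 : Filter.Tendsto (fun y => x₀ + (-1) * y) (𝓝[>] 0) (𝓝[<] x₀) := by
        refine tendsto_nhdsWithin_iff.2 ⟨tendsto_add_mul_nhdsGT x₀ (-1), ?_⟩
        filter_upwards [self_mem_nhdsWithin] with y hy
        have : 0 < y := hy
        show x₀ + (-1) * y < x₀
        linarith
      filter_upwards [h1.eventually h.deriv_pos] with y hy
      linarith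
  have hlim := tendsto_add_mul_nhdsGT x₀ σ
  have hpos : ∀ᶠ x in 𝓝 x₀, 0 < φ x :=
    h.analyticAt.continuousAt.eventually_const_lt (by rwa [h.apply_eq])
  obtain ⟨δ, hδ, hall⟩ := (mem_nhdsGT_iff_exists_Ioo_subset).1
    (((hd.and (hlim.eventually h.analyticAt.eventually_analyticAt)).and
      (hlim.eventually h.zero)).and (hlim.eventually hpos))
  have hδ0 : (0 : ℝ) < δ := hδ
  have hsub : ∀ y ∈ Ioo 0 (min δ ε), y ∈ Ioo 0 δ := fun y hy =>
    ⟨hy.1, hy.2.trans_le (min_le_left _ _)⟩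
  have hder : ∀ y, AnalyticAt ℝ φ (x₀ + σ * y) →
      HasDerivAt (fun y => φ (x₀ + σ * y)) (σ * deriv φ (x₀ + σ * y)) y := by
    intro y hy
    have h1 : HasDerivAt (fun y => x₀ + σ * y) σ y := by
      simpa using ((hasDerivAt_id y).const_mul σ).const_add x₀
    rw [mul_comm]
    exact hy.differentiableAt.hasDerivAt.comp y h1
  refine ⟨min δ ε, lt_min hδ0 hε, min_le_right _ _, ?_, fun y hy => ?_⟩
  · refine strictAntiOn_of_deriv_neg (convex_Ico _ _) ?_ ?_
    · intro y hy
      rcases hy.1.eq_or_lt with rfl | hy0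
      · have : AnalyticAt ℝ φ (x₀ + σ * 0) := by simpa using h.analyticAt
        exact (hder 0 this).continuousAt.continuousWithinAt
      · exact (hder y (hall (hsub y ⟨hy0, hy.2⟩)).1.1.2).continuousAt.continuousWithinAt
    · intro y hy
      rw [interior_Ico] at hy
      rw [(hder y (hall (hsub y hy)).1.1.2).deriv]
      exact (hall (hsub y hy)).1.1.1
  · obtain ⟨⟨⟨h1, h2⟩, h3⟩, h4⟩ := hall (hsub y hy)
    refine ⟨h2, fun h0 => ?_, h3, h4⟩
    rw [h0, mul_zero] at h1
    exact lt_irrefl _ h1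

theorem IsCap.eventually_lt {u : ℝ → ℝ → ℝ} {x₀ t₀ : ℝ} {φ : ℝ → ℝ} (h : IsCap u x₀ t₀ φ)
    (ht₀ : 0 < t₀) : ∀ᶠ x in 𝓝 x₀, x ≠ x₀ → φ x < t₀ := by
  obtain ⟨δ₁, h1, -, ha1, -⟩ := h.exists_strictAntiOn ht₀ (Or.inl rfl) one_pos
  obtain ⟨δ₂, h2, -, ha2, -⟩ := h.exists_strictAntiOn ht₀ (Or.inr rfl) one_pos
  filter_upwards [Ioo_mem_nhds (show x₀ - δ₂ < x₀ by linarith) (show x₀ < x₀ + δ₁ by linarith)]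
    with x hx hne
  rcases lt_or_gt_of_ne hne with hlt | hgt
  · have := ha2 (left_mem_Ico.2 h2) ⟨by linarith, by linarith [hx.1]⟩ (show 0 < x₀ - x by linarith)
    simpa [h.apply_eq] using this
  · have := ha1 (left_mem_Ico.2 h1) ⟨by linarith, by linarith [hx.2]⟩ (show 0 < x - x₀ by linarith)
    simpa [h.apply_eq] using this

theorem IsCap.eventually_le {u : ℝ → ℝ → ℝ} {x₀ t₀ : ℝ} {φ : ℝ → ℝ} (h : IsCap u x₀ t₀ φ)
    (ht₀ : 0 < t₀) : ∀ᶠ x in 𝓝 x₀, φ x ≤ t₀ := by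
  filter_upwards [h.eventually_lt ht₀] with x hx
  by_cases hne : x = x₀
  · rw [hne, h.apply_eq]
  · exact (hx hne).le

/-- Each half of a cap reaches all times shortly before the time of its top. -/
theorem IsCap.eventually_exists {u : ℝ → ℝ → ℝ} {x₀ t₀ : ℝ} {φ : ℝ → ℝ} (h : IsCap u x₀ t₀ φ)
    (ht₀ : 0 < t₀) {σ : ℝ} (hσ : σ = 1 ∨ σ = -1) {ε : ℝ} (hε : 0 < ε) :
    ∀ᶠ t in 𝓝[<] t₀, ∃ y ∈ Ioo 0 ε, φ (x₀ + σ * y) = t := by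
  obtain ⟨δ, hδ, hδε, hanti, hall⟩ := h.exists_strictAntiOn ht₀ hσ hε
  have hδ2 : δ / 2 ∈ Ico 0 δ := ⟨by linarith, by linarith⟩
  have hlt : φ (x₀ + σ * (δ / 2)) < t₀ := by
    have := hanti (left_mem_Ico.2 hδ) hδ2 (by linarith)
    simpa [h.apply_eq] using this
  have hcont : ContinuousOn (fun y => φ (x₀ + σ * y)) (Icc 0 (δ / 2)) := by
    intro y hy
    have hφ : ContinuousAt φ (x₀ + σ * y) := by
      rcases hy.1.eq_or_lt with rfl | hy0
      · simpa using h.analyticAt.continuousAt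
      · exact (hall y ⟨hy0, by linarith [hy.2]⟩).1.continuousAt
    exact (ContinuousAt.comp (f := fun y => x₀ + σ * y) hφ (by fun_prop)).continuousWithinAt
  filter_upwards [Ioo_mem_nhdsLT hlt] with t ht
  obtain ⟨y, hy, hyt⟩ := intermediate_value_Ioo' (by linarith) hcont
    (show t ∈ Ioo _ _ from ⟨ht.1, by simpa [h.apply_eq] using ht.2⟩)
  exact ⟨y, ⟨hy.1, by linarith [hy.2]⟩, hyt⟩

/-- A vertical arc of zeros: an analytic function `g` of the time in an open interval `J` of positive
times whose graph consists of zeros of `u`. -/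
structure IsVerticalArc (u : ℝ → ℝ → ℝ) (J : Set ℝ) (g : ℝ → ℝ) : Prop where
  isOpen : IsOpen J
  isPreconnected : IsPreconnected J
  pos : ∀ t ∈ J, 0 < t
  analytic : AnalyticOnNhd ℝ g J
  zero : ∀ t ∈ J, u (g t) t = 0

theorem IsStem.exists_isVerticalArc {u : ℝ → ℝ → ℝ} {x₀ t₀ : ℝ} {ψ : ℝ → ℝ}
    (h : IsStem u x₀ t₀ ψ) (ht₀ : 0 < t₀) :
    ∃ ε > 0, IsVerticalArc u (Metric.ball t₀ ε) ψ := by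
  obtain ⟨ε, hε, hball⟩ := Metric.eventually_nhds_iff_ball.1
    ((h.analyticAt.eventually_analyticAt.and h.zero).and (Ioi_mem_nhds ht₀))
  exact ⟨ε, hε, Metric.isOpen_ball, (convex_ball _ _).isPreconnected, fun t ht => (hball t ht).2,
    fun t ht => (hball t ht).1.1, fun t ht => (hball t ht).1.2⟩

namespace IsVerticalArc

variable {u : ℝ → ℝ → ℝ} {J J' : Set ℝ} {g g' : ℝ → ℝ}

theorem tendsto (h : IsVerticalArc u J g) {t : ℝ} (ht : t ∈ J) :
    Filter.Tendsto (fun s => (g s, s)) (𝓝 t) (𝓝 (g t, t)) :=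
  (h.analytic t ht).continuousAt.prodMk continuousAt_id

/-- Shortly after the time of a zero on a vertical arc, the arc follows a stem at this zero: the caps
stay below. -/
theorem eventually_stem {x₀ t₀ : ℝ} {Φ Ψ : Set (ℝ → ℝ)} (ht₀ : 0 < t₀)
    (hb : IsLocalBranching u x₀ t₀ Φ Ψ) (h : IsVerticalArc u J g) (ht : t₀ ∈ J) (hx : g t₀ = x₀) :
    ∀ᶠ t in 𝓝[>] t₀, ∃ ψ ∈ Ψ, g t = ψ t := by
  have hlim := h.tendsto ht
  rw [hx] at hlim
  have hcap : ∀ᶠ x in 𝓝 x₀, ∀ φ ∈ Φ, φ x ≤ t₀ :=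
    (Filter.eventually_all_finite hb.finite).2 fun φ hφ => (hb.isCap φ hφ).eventually_le ht₀
  have hlim1 : Filter.Tendsto g (𝓝 t₀) (𝓝 x₀) := by
    rw [← hx]; exact (h.analytic t₀ ht).continuousAt
  filter_upwards [nhdsWithin_le_nhds (hlim.eventually hb.cover),
    nhdsWithin_le_nhds (hlim1.eventually hcap), nhdsWithin_le_nhds (h.isOpen.mem_nhds ht),
    self_mem_nhdsWithin] with t h1 h2 h3 h4
  rcases h1 (h.zero t h3) with ⟨φ, hφ, he⟩ | hψ
  · have : t₀ < t := h4
    have h5 := h2 φ hφ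
    linarith
  · exact hψ

/-- Two vertical arcs that meet coincide wherever both are defined. -/
theorem eqOn_of_meet (hZ : HasBranchingZeros u) (h : IsVerticalArc u J g)
    (h' : IsVerticalArc u J' g') {t : ℝ} (ht : t ∈ J) (ht' : t ∈ J') (heq : g t = g' t) :
    EqOn g g' (J ∩ J') := by
  obtain ⟨Φ, Ψ, hb, -⟩ := hZ.exists_branching (g t, t) ⟨h.pos t ht, h.zero t ht⟩
  have hpre : IsPreconnected (J ∩ J') :=
    (h.isPreconnected.ordConnected.inter h'.isPreconnected.ordConnected).isPreconnected
  refine (h.analytic.mono inter_subset_left).eqOn_of_preconnected_of_frequently_eq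
    (h'.analytic.mono inter_subset_right) hpre ⟨ht, ht'⟩ ?_
  have hev : ∀ᶠ s in 𝓝[>] t, g s = g' s := by
    filter_upwards [eventually_stem (h.pos t ht) hb h ht rfl,
      eventually_stem (h.pos t ht) hb h' ht' heq.symm] with s ⟨ψ, hψ, h1⟩ ⟨ψ', hψ', h2⟩
    rw [h1, h2, hb.subsingleton hψ hψ']
  exact hev.frequently.filter_mono (nhdsWithin_mono t fun s hs => (ne_of_gt hs : s ≠ t))

theorem exists_union (hZ : HasBranchingZeros u) (h : IsVerticalArc u J g)
    (h' : IsVerticalArc u J' g') {t : ℝ} (ht : t ∈ J) (ht' : t ∈ J') (heq : g t = g' t) :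
    ∃ f, IsVerticalArc u (J ∪ J') f ∧ EqOn f g J ∧ EqOn f g' J' := by
  classical
  have hon := h.eqOn_of_meet hZ h' ht ht' heq
  have e1 : EqOn (J.piecewise g g') g J := piecewise_eqOn J g g'
  have e2 : EqOn (J.piecewise g g') g' J' := by
    intro s hs
    by_cases hsJ : s ∈ J
    · rw [e1 hsJ, hon ⟨hsJ, hs⟩]
    · exact piecewise_eq_of_notMem J g g' hsJ
  refine ⟨J.piecewise g g', ⟨h.isOpen.union h'.isOpen,
    h.isPreconnected.union t ht ht' h'.isPreconnected, ?_, ?_, ?_⟩, e1, e2⟩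
  · rintro s (hs | hs)
    exacts [h.pos s hs, h'.pos s hs]
  · rintro s (hs | hs)
    · exact (h.analytic s hs).congr (e1.symm.eventuallyEq_of_mem (h.isOpen.mem_nhds hs))
    · exact (h'.analytic s hs).congr (e2.symm.eventuallyEq_of_mem (h'.isOpen.mem_nhds hs))
  · rintro s (hs | hs)
    · rw [e1 hs, h.zero s hs]
    · rw [e2 hs, h'.zero s hs]

end IsVerticalArc

/-- A nonempty vertical arc that contains every vertical arc it meets. -/
structure IsMaxArc (u : ℝ → ℝ → ℝ) (J : Set ℝ) (g : ℝ → ℝ) : Prop extends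
    IsVerticalArc u J g where
  nonempty : J.Nonempty
  maximal : ∀ J' g', IsVerticalArc u J' g' → ∀ t ∈ J, t ∈ J' → g t = g' t →
    J' ⊆ J ∧ EqOn g g' J'

/-- The graph of `g` over the times in `J`. -/
def arcGraph (J : Set ℝ) (g : ℝ → ℝ) : Set (ℝ × ℝ) := {p | p.2 ∈ J ∧ p.1 = g p.2}

/-- Every vertical arc extends to a maximal one, the union of all the arcs through one of its points. -/
theorem IsVerticalArc.exists_isMaxArc {u : ℝ → ℝ → ℝ} (hZ : HasBranchingZeros u) {J₀ : Set ℝ}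
    {g₀ : ℝ → ℝ} (h₀ : IsVerticalArc u J₀ g₀) {t₀ : ℝ} (ht₀ : t₀ ∈ J₀) :
    ∃ J g, IsMaxArc u J g ∧ J₀ ⊆ J ∧ EqOn g g₀ J₀ := by
  classical
  -- the arcs through the given point
  let A : Set (Set ℝ × (ℝ → ℝ)) := {a | IsVerticalArc u a.1 a.2 ∧ t₀ ∈ a.1 ∧ a.2 t₀ = g₀ t₀}
  let J : Set ℝ := {t | ∃ a ∈ A, t ∈ a.1}
  have hex : ∀ t, ∃ f : ℝ → ℝ, t ∈ J → ∃ a ∈ A, t ∈ a.1 ∧ f = a.2 := by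
    intro t
    by_cases ht : t ∈ J
    · obtain ⟨a, ha, hta⟩ := ht
      exact ⟨a.2, fun _ => ⟨a, ha, hta, rfl⟩⟩
    · exact ⟨g₀, fun h => absurd h ht⟩
  choose f hf using hex
  let g : ℝ → ℝ := fun t => f t t
  have hga : ∀ a ∈ A, EqOn g a.2 a.1 := by
    intro a ha t hta
    obtain ⟨b, hb, htb, he⟩ := hf t ⟨a, ha, hta⟩
    show f t t = a.2 t
    rw [he]
    exact hb.1.eqOn_of_meet hZ ha.1 hb.2.1 ha.2.1 (hb.2.2.trans ha.2.2.symm) ⟨htb, hta⟩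
  have h₀A : (J₀, g₀) ∈ A := ⟨h₀, ht₀, rfl⟩
  have hsub : ∀ a ∈ A, a.1 ⊆ J := fun a ha t ht => ⟨a, ha, ht⟩
  refine ⟨J, g, ⟨⟨?_, ?_, ?_, ?_, ?_⟩, ⟨t₀, hsub _ h₀A ht₀⟩, ?_⟩, hsub _ h₀A, hga _ h₀A⟩
  · rw [isOpen_iff_mem_nhds]
    rintro t ⟨a, ha, hta⟩
    exact Filter.mem_of_superset (ha.1.isOpen.mem_nhds hta) (hsub a ha)
  · refine isPreconnected_of_forall t₀ fun t ⟨a, ha, hta⟩ => ?_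
    exact ⟨a.1, hsub a ha, ha.2.1, hta, ha.1.isPreconnected⟩
  · rintro t ⟨a, ha, hta⟩
    exact ha.1.pos t hta
  · rintro t ⟨a, ha, hta⟩
    exact (ha.1.analytic t hta).congr
      ((hga a ha).symm.eventuallyEq_of_mem (ha.1.isOpen.mem_nhds hta))
  · rintro t ⟨a, ha, hta⟩
    rw [hga a ha hta]
    exact ha.1.zero t hta
  · rintro J' g' h' t ⟨a, ha, hta⟩ ht' heq
    rw [hga a ha hta] at heq
    obtain ⟨k, hk, hk1, hk2⟩ := ha.1.exists_union hZ h' hta ht' heq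
    have hkA : (a.1 ∪ J', k) ∈ A := ⟨hk, Or.inl ha.2.1, by
      show k t₀ = g₀ t₀
      rw [hk1 ha.2.1, ha.2.2]⟩
    refine ⟨subset_union_right.trans (hsub _ hkA), fun s hs => ?_⟩
    rw [hga _ hkA (Or.inr hs)]
    exact hk2 hs

theorem IsMaxArc.eq_of_meet {u : ℝ → ℝ → ℝ} {J J' : Set ℝ} {g g' : ℝ → ℝ} (h : IsMaxArc u J g)
    (h' : IsMaxArc u J' g') {t : ℝ} (ht : t ∈ J) (ht' : t ∈ J') (heq : g t = g' t) :
    J = J' ∧ EqOn g g' J := by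
  obtain ⟨h1, h2⟩ := h.maximal J' g' h'.toIsVerticalArc t ht ht' heq
  obtain ⟨h3, -⟩ := h'.maximal J g h.toIsVerticalArc t ht' ht heq.symm
  obtain rfl := h3.antisymm h1
  exact ⟨rfl, h2⟩

theorem arcGraph_congr {J J' : Set ℝ} {g g' : ℝ → ℝ} (h : J = J') (h' : EqOn g g' J) :
    arcGraph J g = arcGraph J' g' := by
  subst h
  ext p
  constructor
  · rintro ⟨h1, h2⟩; exact ⟨h1, h2.trans (h' h1)⟩
  · rintro ⟨h1, h2⟩; exact ⟨h1, h2.trans (h' h1).symm⟩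

/-- The inverse of an injective analytic function with nonvanishing derivative on an open interval. -/
theorem exists_analytic_inverse {φ : ℝ → ℝ} {I : Set ℝ} (hI : IsOpen I) (hc : IsPreconnected I)
    (hφ : AnalyticOnNhd ℝ φ I) (hd : ∀ x ∈ I, deriv φ x ≠ 0) (hinj : InjOn φ I) :
    ∃ g, IsOpen (φ '' I) ∧ IsPreconnected (φ '' I) ∧ AnalyticOnNhd ℝ g (φ '' I) ∧
      ∀ x ∈ I, g (φ x) = x := by
  have hleft : ∀ x ∈ I, Function.invFunOn φ I (φ x) = x := fun x hx =>
    hinj.leftInvOn_invFunOn hx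
  have hmap : ∀ x ∈ I, φ '' I ∈ 𝓝 (φ x) := by
    intro x hx
    rw [← (hφ x hx).hasStrictDerivAt.map_nhds_eq (hd x hx)]
    exact Filter.image_mem_map (hI.mem_nhds hx)
  refine ⟨Function.invFunOn φ I, ?_, hc.image φ hφ.continuousOn, ?_, hleft⟩
  · rw [isOpen_iff_mem_nhds]
    rintro _ ⟨x, hx, rfl⟩
    exact hmap x hx
  · rintro _ ⟨x, hx, rfl⟩
    have hloc := (hφ x hx).analyticAt_localInverse (hd x hx)
    have hr := HasStrictDerivAt.eventually_right_inverse (hφ x hx).hasStrictDerivAt (hd x hx)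
    have hself : (hφ x hx).hasStrictDerivAt.localInverse φ (deriv φ x) x (hd x hx) (φ x) = x :=
      HasStrictFDerivAt.localInverse_apply_image ..
    have hmem : ∀ᶠ t in 𝓝 (φ x),
        (hφ x hx).hasStrictDerivAt.localInverse φ (deriv φ x) x (hd x hx) t ∈ I :=
      hloc.continuousAt.eventually_mem (by rw [hself]; exact hI.mem_nhds hx)
    refine hloc.congr ?_
    filter_upwards [hr, hmem] with t h1 h2
    have := hleft _ h2
    rw [h1] at this
    exact this.symm

/-- The maximal arc `(J, g)` contains one of the two halves, according to the sign `σ`, of the cap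
`φ` at `(x₀, t₀)`. -/
structure IsLeg (u : ℝ → ℝ → ℝ) (x₀ t₀ : ℝ) (φ : ℝ → ℝ) (σ : ℝ) (J : Set ℝ) (g : ℝ → ℝ) : Prop
    extends IsMaxArc u J g where
  eventually_mem : ∀ᶠ y in 𝓝[>] (0 : ℝ), φ (x₀ + σ * y) ∈ J ∧ g (φ (x₀ + σ * y)) = x₀ + σ * y

theorem IsCap.exists_isLeg {u : ℝ → ℝ → ℝ} (hZ : HasBranchingZeros u) {x₀ t₀ : ℝ} {φ : ℝ → ℝ}
    (h : IsCap u x₀ t₀ φ) (ht₀ : 0 < t₀) {σ : ℝ} (hσ : σ = 1 ∨ σ = -1) :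
    ∃ J g, IsLeg u x₀ t₀ φ σ J g ∧
      ∃ δ > 0, ∀ y ∈ Ioo 0 δ, φ (x₀ + σ * y) ∈ J ∧ g (φ (x₀ + σ * y)) = x₀ + σ * y := by
  obtain ⟨δ, hδ, -, hanti, hall⟩ := h.exists_strictAntiOn ht₀ hσ one_pos
  have hσ0 : σ ≠ 0 := by rcases hσ with rfl | rfl <;> norm_num
  have hlin : ∀ y, HasDerivAt (fun y => x₀ + σ * y) σ y := fun y => by
    simpa using ((hasDerivAt_id y).const_mul σ).const_add x₀
  obtain ⟨k, hk1, hk2, hk3, hk4⟩ := exists_analytic_inverse (φ := fun y => φ (x₀ + σ * y))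
    (I := Ioo 0 δ) isOpen_Ioo isPreconnected_Ioo
    (fun y hy => (hall y hy).1.comp_of_eq (f := fun y => x₀ + σ * y) (by fun_prop) rfl)
    (fun y hy => by
      have := ((hall y hy).1.differentiableAt.hasDerivAt.comp y (hlin y)).deriv
      rw [show (fun y => φ (x₀ + σ * y)) = φ ∘ fun y => x₀ + σ * y from rfl, this]
      exact mul_ne_zero (hall y hy).2.1 hσ0)
    (hanti.injOn.mono Ioo_subset_Ico_self)
  have harc : IsVerticalArc u ((fun y => φ (x₀ + σ * y)) '' Ioo 0 δ) (fun t => x₀ + σ * k t) := by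
    refine ⟨hk1, hk2, ?_, fun t ht => ?_, ?_⟩
    · rintro _ ⟨y, hy, rfl⟩
      exact (hall y hy).2.2.2
    · have := hk3 t ht
      exact analyticAt_const.add (analyticAt_const.mul this)
    · rintro _ ⟨y, hy, rfl⟩
      have := hk4 y hy
      simp only at this ⊢
      rw [this]
      exact (hall y hy).2.2.1
  obtain ⟨J, g, hmax, hJ, hg⟩ := harc.exists_isMaxArc hZ
    (mem_image_of_mem _ (show δ / 2 ∈ Ioo 0 δ from ⟨by linarith, by linarith⟩))
  have hmem : ∀ y ∈ Ioo 0 δ, φ (x₀ + σ * y) ∈ J ∧ g (φ (x₀ + σ * y)) = x₀ + σ * y := by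
    intro y hy
    refine ⟨hJ (mem_image_of_mem _ hy), ?_⟩
    have h1 := hg (mem_image_of_mem _ hy)
    have h2 := hk4 y hy
    simp only at h1 h2
    rw [h1, h2]
  exact ⟨J, g, ⟨hmax, by filter_upwards [Ioo_mem_nhdsGT hδ] with y hy using hmem y hy⟩, δ, hδ, hmem⟩

namespace IsLeg

variable {u : ℝ → ℝ → ℝ} {x₀ t₀ σ : ℝ} {φ : ℝ → ℝ} {J J' : Set ℝ} {g g' : ℝ → ℝ}

theorem eventually_eq (h : IsLeg u x₀ t₀ φ σ J g) (hc : IsCap u x₀ t₀ φ) (ht₀ : 0 < t₀)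
    (hσ : σ = 1 ∨ σ = -1) {ε : ℝ} (hε : 0 < ε) :
    ∀ᶠ t in 𝓝[<] t₀, t ∈ J ∧ ∃ y ∈ Ioo 0 ε, g t = x₀ + σ * y ∧ φ (x₀ + σ * y) = t := by
  obtain ⟨δ, hδ, hsub⟩ := (mem_nhdsGT_iff_exists_Ioo_subset).1 h.eventually_mem
  have hδ0 : (0 : ℝ) < δ := hδ
  filter_upwards [hc.eventually_exists ht₀ hσ (lt_min hδ0 hε)] with t ⟨y, hy, hyt⟩
  have := hsub (show y ∈ Ioo 0 δ from ⟨hy.1, hy.2.trans_le (min_le_left _ _)⟩)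
  simp only [mem_ofPred_eq, hyt] at this
  exact ⟨this.1, y, ⟨hy.1, hy.2.trans_le (min_le_right _ _)⟩, this.2, hyt⟩

theorem tendsto_left (h : IsLeg u x₀ t₀ φ σ J g) (hc : IsCap u x₀ t₀ φ) (ht₀ : 0 < t₀)
    (hσ : σ = 1 ∨ σ = -1) : Filter.Tendsto g (𝓝[<] t₀) (𝓝 x₀) := by
  rw [Metric.tendsto_nhds]
  intro ε hε
  filter_upwards [h.eventually_eq hc ht₀ hσ hε] with t ⟨_, y, hy, hg, _⟩
  rw [hg, Real.dist_eq, add_sub_cancel_left, abs_mul]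
  have : |σ| = 1 := by rcases hσ with rfl | rfl <;> simp
  rw [this, one_mul, abs_of_pos hy.1]
  exact hy.2

/-- A leg of a cap cannot be continued analytically as a graph beyond the top of the cap: by the
identity theorem `φ (g t) = t` would hold beyond the top, where `φ ≤ t₀`. -/
theorem notMem (h : IsLeg u x₀ t₀ φ σ J g) (hc : IsCap u x₀ t₀ φ) (ht₀ : 0 < t₀)
    (hσ : σ = 1 ∨ σ = -1) : t₀ ∉ J := by
  intro hJ
  have hgc := (h.analytic t₀ hJ).continuousAt
  have hg0 : g t₀ = x₀ :=
    tendsto_nhds_unique (hgc.tendsto.mono_left nhdsWithin_le_nhds) (h.tendsto_left hc ht₀ hσ)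
  have han : AnalyticAt ℝ (fun t => φ (g t)) t₀ :=
    hc.analyticAt.comp_of_eq (h.analytic t₀ hJ) hg0
  have hfreq : ∃ᶠ t in 𝓝[≠] t₀, φ (g t) = t := by
    have h1 : ∀ᶠ t in 𝓝[<] t₀, φ (g t) = t := by
      filter_upwards [h.eventually_eq hc ht₀ hσ one_pos] with t ⟨_, y, _, h1, h2⟩
      rw [h1, h2]
    exact h1.frequently.filter_mono (nhdsWithin_mono t₀ fun s hs => (ne_of_lt hs : s ≠ t₀))
  have hev : ∀ᶠ t in 𝓝 t₀, φ (g t) = t := (han.frequently_eq_iff_eventually_eq analyticAt_id).1 hfreq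
  have hle : ∀ᶠ t in 𝓝 t₀, φ (g t) ≤ t₀ := by
    have : Filter.Tendsto g (𝓝 t₀) (𝓝 x₀) := by rw [← hg0]; exact hgc
    exact this.eventually (hc.eventually_le ht₀)
  obtain ⟨t, ⟨h1, h2⟩, h3⟩ := (((hev.and hle).filter_mono nhdsWithin_le_nhds).and
    (self_mem_nhdsWithin : ∀ᶠ t in 𝓝[>] t₀, t ∈ Ioi t₀)).exists
  rw [h1] at h2
  exact absurd h3 (not_lt.2 h2)

theorem lt_of_mem (h : IsLeg u x₀ t₀ φ σ J g) (hc : IsCap u x₀ t₀ φ) (ht₀ : 0 < t₀)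
    (hσ : σ = 1 ∨ σ = -1) {t : ℝ} (ht : t ∈ J) : t < t₀ := by
  by_contra! hle
  obtain ⟨s, hs, hs0⟩ := ((h.eventually_eq hc ht₀ hσ one_pos).and
    (self_mem_nhdsWithin : ∀ᶠ t in 𝓝[<] t₀, t ∈ Iio t₀)).exists
  exact h.notMem hc ht₀ hσ (h.isPreconnected.ordConnected.out hs.1 ht ⟨le_of_lt hs0, hle⟩)

theorem eq_of_isLeg (h : IsLeg u x₀ t₀ φ σ J g) (h' : IsLeg u x₀ t₀ φ σ J' g') :
    J = J' ∧ EqOn g g' J := by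
  obtain ⟨y, h1, h2⟩ := (h.eventually_mem.and h'.eventually_mem).exists
  exact h.toIsMaxArc.eq_of_meet h'.toIsMaxArc h1.1 h2.1 (h1.2.trans h2.2.symm)

end IsLeg

theorem IsMaxArc.isLeg_of_meet {u : ℝ → ℝ → ℝ} {x₀ t₀ σ : ℝ} {φ : ℝ → ℝ} {J J' : Set ℝ}
    {g g' : ℝ → ℝ} (h : IsMaxArc u J g) (h' : IsLeg u x₀ t₀ φ σ J' g') {t : ℝ} (ht : t ∈ J)
    (ht' : t ∈ J') (heq : g t = g' t) : IsLeg u x₀ t₀ φ σ J g := by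
  obtain ⟨rfl, he⟩ := h.eq_of_meet h'.toIsMaxArc ht ht' heq
  refine ⟨h, ?_⟩
  filter_upwards [h'.eventually_mem] with y hy
  exact ⟨hy.1, (he hy.1).trans hy.2⟩

/-- A maximal arc can only end, inside the half-plane, at the top of a cap one of whose halves it
contains: at a stem it could be continued. -/
theorem IsMaxArc.exists_cap_of_mem_closure {u : ℝ → ℝ → ℝ} (hZ : HasBranchingZeros u) {J : Set ℝ}
    {g : ℝ → ℝ} (h : IsMaxArc u J g) {p : ℝ × ℝ} (hp : p ∈ closure (arcGraph J g))
    (hpH : p ∈ halfPlane) (hpJ : p ∉ arcGraph J g) :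
    ∃ φ, IsCap u p.1 p.2 φ ∧ ∃ σ, (σ = 1 ∨ σ = -1) ∧ IsLeg u p.1 p.2 φ σ J g := by
  obtain ⟨x₀, t₀⟩ := p
  have ht₀ : 0 < t₀ := hpH
  have hfreq : ∃ᶠ q in 𝓝 (x₀, t₀), q ∈ arcGraph J g := mem_closure_iff_frequently.1 hp
  have hz : u x₀ t₀ = 0 := by
    by_contra hne
    have hc : ContinuousAt (fun p : ℝ × ℝ => u p.1 p.2) (x₀, t₀) :=
      hZ.continuousOn.continuousAt (isOpen_halfPlane.mem_nhds hpH)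
    obtain ⟨q, ⟨hq1, hq2⟩, hq⟩ := (hfreq.and_eventually (hc.eventually_ne hne)).exists
    exact hq (by rw [hq2]; exact h.zero _ hq1)
  have ht₀J : t₀ ∉ J := by
    intro hJ
    have hc : ContinuousAt (fun q : ℝ × ℝ => q.1 - g q.2) (x₀, t₀) :=
      continuousAt_fst.sub ((h.analytic t₀ hJ).continuousAt.comp (f := Prod.snd) continuousAt_snd)
    by_cases hne : x₀ - g t₀ = 0
    · exact hpJ ⟨hJ, sub_eq_zero.1 hne⟩
    · obtain ⟨q, ⟨hq1, hq2⟩, hq⟩ := (hfreq.and_eventually (hc.eventually_ne hne)).exists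
      exact hq (sub_eq_zero.2 hq2)
  obtain ⟨Φ, Ψ, hb, -⟩ := hZ.exists_branching (x₀, t₀) ⟨hpH, hz⟩
  have hΨ : ∀ᶠ q : ℝ × ℝ in 𝓝 (x₀, t₀), q ∈ arcGraph J g → ∀ ψ ∈ Ψ, q.1 ≠ ψ q.2 := by
    rcases hb.subsingleton.eq_empty_or_singleton with h0 | ⟨ψ, rfl⟩
    · simp [h0]
    · obtain ⟨ε, hε, harc⟩ := (hb.isStem ψ rfl).exists_isVerticalArc ht₀
      have : ∀ᶠ q : ℝ × ℝ in 𝓝 (x₀, t₀), q.2 ∈ Metric.ball t₀ ε :=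
        continuousAt_snd.eventually_mem (Metric.ball_mem_nhds _ hε)
      filter_upwards [this] with q hq hqJ ψ' hψ' heq
      rw [mem_singleton_iff] at hψ'
      subst hψ'
      exact ht₀J ((h.maximal _ _ harc q.2 hqJ.1 hq (hqJ.2.symm.trans heq)).1
        (Metric.mem_ball_self hε))
  have hΦ : ∀ᶠ x in 𝓝 x₀, ∀ φ ∈ Φ, x ≠ x₀ → ∃ σ, (σ = 1 ∨ σ = -1) ∧
      ∃ J' g', IsLeg u x₀ t₀ φ σ J' g' ∧ φ x ∈ J' ∧ g' (φ x) = x := by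
    refine (Filter.eventually_all_finite hb.finite).2 fun φ hφ => ?_
    have hc := hb.isCap φ hφ
    obtain ⟨J₁, g₁, hl₁, δ₁, hδ₁, h₁⟩ := hc.exists_isLeg hZ ht₀ (Or.inl rfl)
    obtain ⟨J₂, g₂, hl₂, δ₂, hδ₂, h₂⟩ := hc.exists_isLeg hZ ht₀ (Or.inr rfl)
    filter_upwards [Ioo_mem_nhds (show x₀ - δ₂ < x₀ by linarith) (show x₀ < x₀ + δ₁ by linarith)]
      with x hx hne
    rcases lt_or_gt_of_ne hne with hlt | hgt
    · have := h₂ (x₀ - x) ⟨by linarith, by linarith [hx.1]⟩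
      rw [show x₀ + -1 * (x₀ - x) = x by ring] at this
      exact ⟨-1, Or.inr rfl, J₂, g₂, hl₂, this⟩
    · have := h₁ (x - x₀) ⟨by linarith, by linarith [hx.2]⟩
      rw [show x₀ + 1 * (x - x₀) = x by ring] at this
      exact ⟨1, Or.inl rfl, J₁, g₁, hl₁, this⟩
  have hΦ' : ∀ᶠ q : ℝ × ℝ in 𝓝 (x₀, t₀), ∀ φ ∈ Φ, q.1 ≠ x₀ → ∃ σ, (σ = 1 ∨ σ = -1) ∧
      ∃ J' g', IsLeg u x₀ t₀ φ σ J' g' ∧ φ q.1 ∈ J' ∧ g' (φ q.1) = q.1 :=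
    (continuous_fst.tendsto (x₀, t₀)).eventually hΦ
  obtain ⟨q, ⟨hqJ, hqg⟩, ⟨hq1, hq2⟩, hq3⟩ :=
    (hfreq.and_eventually ((hb.cover.and hΨ).and hΦ')).exists
  rcases hq1 (by rw [hqg]; exact h.zero _ hqJ) with ⟨φ, hφ, he⟩ | ⟨ψ, hψ, he⟩
  · have hne : q.1 ≠ x₀ := by
      intro h0
      rw [he, h0, (hb.isCap φ hφ).apply_eq] at hqJ
      exact ht₀J hqJ
    obtain ⟨σ, hσ, J', g', hl, h1, h2⟩ := hq3 φ hφ hne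
    rw [← he] at h1 h2
    exact ⟨φ, hb.isCap φ hφ, σ, hσ, h.isLeg_of_meet hl hqJ h1 (hqg.symm.trans h2.symm)⟩
  · exact absurd he (hq2 ⟨hqJ, hqg⟩ ψ hψ)

/-! ### The regular analytic curves -/

/-- A shear flattens a set that is locally the graph of an analytic function over the `x`-axis. -/
theorem exists_chart_of_graph_fst {C V : Set (ℝ × ℝ)} {I : Set ℝ} {φ : ℝ → ℝ}
    (hI : IsOpen I) (hφ : AnalyticOnNhd ℝ φ I) (hV : IsOpen V) (hVI : ∀ q ∈ V, q.1 ∈ I)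
    (hC : ∀ q ∈ V, q ∈ C ↔ q.2 = φ q.1) {p : ℝ × ℝ} (hp : p ∈ V) :
    ∃ e : OpenPartialHomeomorph (ℝ × ℝ) (ℝ × ℝ),
      p ∈ e.source ∧ AnalyticOnNhd ℝ e e.source ∧ AnalyticOnNhd ℝ e.symm e.target ∧
        ∀ q ∈ e.source, q ∈ C ↔ (e q).2 = 0 := by
  have hfst : ∀ q : ℝ × ℝ, q.1 ∈ I → AnalyticAt ℝ (fun q : ℝ × ℝ => φ q.1) q := fun q hq =>
    (hφ q.1 hq).comp_of_eq analyticAt_fst rfl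
  have h1 : ∀ q : ℝ × ℝ, q.1 ∈ I → AnalyticAt ℝ (fun q : ℝ × ℝ => (q.1, q.2 - φ q.1)) q :=
    fun q hq => analyticAt_fst.prod (analyticAt_snd.sub (hfst q hq))
  have h2 : ∀ q : ℝ × ℝ, q.1 ∈ I → AnalyticAt ℝ (fun q : ℝ × ℝ => (q.1, q.2 + φ q.1)) q :=
    fun q hq => analyticAt_fst.prod (analyticAt_snd.add (hfst q hq))
  let e : OpenPartialHomeomorph (ℝ × ℝ) (ℝ × ℝ) :=
    { toFun := fun q => (q.1, q.2 - φ q.1)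
      invFun := fun q => (q.1, q.2 + φ q.1)
      source := V
      target := (Prod.fst ⁻¹' I) ∩ (fun q : ℝ × ℝ => (q.1, q.2 + φ q.1)) ⁻¹' V
      map_source' := fun q hq => ⟨hVI q hq, by simpa using hq⟩
      map_target' := fun q hq => hq.2
      left_inv' := fun q _ => by simp
      right_inv' := fun q _ => by simp
      open_source := hV
      open_target := ContinuousOn.isOpen_inter_preimage
        (fun q hq => (h2 q hq).continuousAt.continuousWithinAt) (hI.preimage continuous_fst) hV
      continuousOn_toFun := fun q hq => (h1 q (hVI q hq)).continuousAt.continuousWithinAt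
      continuousOn_invFun := fun q hq => (h2 q hq.1).continuousAt.continuousWithinAt }
  exact ⟨e, hp, fun q hq => h1 q (hVI q hq), fun q hq => h2 q hq.1, fun q hq =>
    (hC q hq).trans sub_eq_zero.symm⟩

/-- A shear flattens a set that is locally the graph of an analytic function over the `t`-axis. -/
theorem exists_chart_of_graph_snd {C V : Set (ℝ × ℝ)} {J : Set ℝ} {g : ℝ → ℝ}
    (hJ : IsOpen J) (hg : AnalyticOnNhd ℝ g J) (hV : IsOpen V) (hVJ : ∀ q ∈ V, q.2 ∈ J)
    (hC : ∀ q ∈ V, q ∈ C ↔ q.1 = g q.2) {p : ℝ × ℝ} (hp : p ∈ V) :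
    ∃ e : OpenPartialHomeomorph (ℝ × ℝ) (ℝ × ℝ),
      p ∈ e.source ∧ AnalyticOnNhd ℝ e e.source ∧ AnalyticOnNhd ℝ e.symm e.target ∧
        ∀ q ∈ e.source, q ∈ C ↔ (e q).2 = 0 := by
  obtain ⟨e, h1, h2, h3, h4⟩ := exists_chart_of_graph_fst (C := Prod.swap ⁻¹' C)
    (V := Prod.swap ⁻¹' V) hJ hg (hV.preimage continuous_swap) (fun q hq => hVJ _ hq)
    (fun q hq => hC _ hq) (p := p.swap) (by simpa using hp)
  have hswap : ∀ q : ℝ × ℝ, AnalyticAt ℝ (Prod.swap : ℝ × ℝ → ℝ × ℝ) q := fun q =>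
    analyticAt_snd.prod analyticAt_fst
  refine ⟨(Homeomorph.prodComm ℝ ℝ).toOpenPartialHomeomorph.trans e, ?_, ?_, ?_, ?_⟩
  · simpa using h1
  · intro q hq
    have hq' : q.swap ∈ e.source := by simpa using hq
    exact (h2 _ hq').comp (hswap q)
  · intro q hq
    have hq' : q ∈ e.target := by simpa using hq
    exact (hswap _).comp (h3 q hq')
  · intro q hq
    have hq' : q.swap ∈ e.source := by simpa using hq
    simpa using h4 _ hq'

theorem closure_diff_subset_frontier {C U : Set (ℝ × ℝ)} (hU : IsOpen U) (hCU : C ⊆ U)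
    (h : closure C ∩ U ⊆ C) : closure C \ C ⊆ frontier U := by
  rw [hU.frontier_eq]
  exact fun q hq => ⟨closure_mono hCU hq.1, fun hqU => hq.2 (h ⟨hq.1, hqU⟩)⟩

namespace IsVerticalArc

variable {u : ℝ → ℝ → ℝ} {J : Set ℝ} {g : ℝ → ℝ}

theorem arcGraph_eq_image : arcGraph J g = (fun t => (g t, t)) '' J := by
  ext p
  constructor
  · rintro ⟨h1, h2⟩
    exact ⟨p.2, h1, Prod.ext h2.symm rfl⟩
  · rintro ⟨t, ht, rfl⟩
    exact ⟨ht, rfl⟩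

theorem isPreconnected_arcGraph (h : IsVerticalArc u J g) : IsPreconnected (arcGraph J g) := by
  rw [arcGraph_eq_image]
  exact h.isPreconnected.image _ (h.analytic.continuousOn.prodMk continuousOn_id)

theorem arcGraph_subset_zeroSet (h : IsVerticalArc u J g) : arcGraph J g ⊆ zeroSet u := by
  rintro p ⟨h1, h2⟩
  exact ⟨h.pos _ h1, by rw [h2]; exact h.zero _ h1⟩

theorem frequently_mem_arcGraph (h : IsVerticalArc u J g) {p : ℝ × ℝ} (hp : p ∈ arcGraph J g) :
    ∃ᶠ q in 𝓝[≠] p, q ∈ arcGraph J g := by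
  have hlim : Filter.Tendsto (fun t => (g t, t)) (𝓝[>] p.2) (𝓝[≠] p) := by
    refine tendsto_nhdsWithin_iff.2 ⟨?_, ?_⟩
    · have := (h.tendsto hp.1).mono_left (nhdsWithin_le_nhds (s := Ioi p.2))
      rwa [← hp.2] at this
    · filter_upwards [self_mem_nhdsWithin] with t ht heq
      have : p.2 < t := ht
      have h2 : t = p.2 := congrArg Prod.snd heq
      exact this.ne h2.symm
  have hev : ∀ᶠ t in 𝓝[>] p.2, (g t, t) ∈ arcGraph J g := by
    filter_upwards [nhdsWithin_le_nhds (h.isOpen.mem_nhds hp.1)] with t ht using ⟨ht, rfl⟩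
  exact hlim.frequently hev.frequently

end IsVerticalArc

namespace IsLeg

variable {u : ℝ → ℝ → ℝ} {x₀ t₀ σ : ℝ} {φ : ℝ → ℝ} {J : Set ℝ} {g : ℝ → ℝ}

theorem mem_closure (h : IsLeg u x₀ t₀ φ σ J g) (hc : IsCap u x₀ t₀ φ) (ht₀ : 0 < t₀)
    (hσ : σ = 1 ∨ σ = -1) : (x₀, t₀) ∈ closure (arcGraph J g) := by
  have hlim : Filter.Tendsto (fun t => (g t, t)) (𝓝[<] t₀) (𝓝 (x₀, t₀)) :=
    (h.tendsto_left hc ht₀ hσ).prodMk_nhds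
      (Filter.tendsto_id.mono_left nhdsWithin_le_nhds)
  refine mem_closure_of_tendsto hlim ?_
  filter_upwards [h.eventually_eq hc ht₀ hσ one_pos] with t ht using ⟨ht.1, rfl⟩

/-- The top of a cap is determined by each of its legs. -/
theorem top_eq {x₁ t₁ σ' : ℝ} {φ' : ℝ → ℝ} (h : IsLeg u x₀ t₀ φ σ J g) (hc : IsCap u x₀ t₀ φ)
    (ht₀ : 0 < t₀) (hσ : σ = 1 ∨ σ = -1) (h' : IsLeg u x₁ t₁ φ' σ' J g)
    (hc' : IsCap u x₁ t₁ φ') (ht₁ : 0 < t₁) (hσ' : σ' = 1 ∨ σ' = -1) : x₀ = x₁ ∧ t₀ = t₁ := by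
  have key : ∀ {a b : ℝ}, (∀ᶠ t in 𝓝[<] a, t ∈ J) → (∀ t ∈ J, t < b) → a ≤ b := by
    intro a b ha hb
    exact le_of_tendsto (Filter.tendsto_id.mono_left nhdsWithin_le_nhds : Filter.Tendsto id (𝓝[<] a) (𝓝 a))
      (ha.mono fun t ht => (hb t ht).le)
  have hle : t₀ ≤ t₁ := key ((h.eventually_eq hc ht₀ hσ one_pos).mono fun t ht => ht.1)
    fun t ht => h'.lt_of_mem hc' ht₁ hσ' ht
  have hge : t₁ ≤ t₀ := key ((h'.eventually_eq hc' ht₁ hσ' one_pos).mono fun t ht => ht.1)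
    fun t ht => h.lt_of_mem hc ht₀ hσ ht
  obtain rfl := hle.antisymm hge
  exact ⟨tendsto_nhds_unique (h.tendsto_left hc ht₀ hσ) (h'.tendsto_left hc' ht₁ hσ'), rfl⟩

/-- Inside the half-plane, a leg ends only at the top of its cap. -/
theorem closure_inter_subset (hZ : HasBranchingZeros u) (h : IsLeg u x₀ t₀ φ σ J g)
    (hc : IsCap u x₀ t₀ φ) (ht₀ : 0 < t₀) (hσ : σ = 1 ∨ σ = -1) :
    closure (arcGraph J g) ∩ halfPlane ⊆ insert (x₀, t₀) (arcGraph J g) := by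
  rintro p ⟨hp, hpH⟩
  by_cases hpJ : p ∈ arcGraph J g
  · exact Or.inr hpJ
  · obtain ⟨φ', hc', σ', hσ', h'⟩ := h.toIsMaxArc.exists_cap_of_mem_closure hZ hp hpH hpJ
    obtain ⟨h1, h2⟩ := h.top_eq hc ht₀ hσ h' hc' hpH hσ'
    exact Or.inl (Prod.ext h1.symm h2.symm)

theorem sign_eq {σ' : ℝ} {φ' : ℝ → ℝ} (h : IsLeg u x₀ t₀ φ σ J g) (hc : IsCap u x₀ t₀ φ)
    (ht₀ : 0 < t₀) (hσ : σ = 1 ∨ σ = -1) (h' : IsLeg u x₀ t₀ φ' σ' J g)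
    (hc' : IsCap u x₀ t₀ φ') (hσ' : σ' = 1 ∨ σ' = -1) : σ = σ' := by
  obtain ⟨t, ⟨_, y, hy, h1, _⟩, _, y', hy', h2, _⟩ := ((h.eventually_eq hc ht₀ hσ one_pos).and
    (h'.eventually_eq hc' ht₀ hσ' one_pos)).exists
  have h3 := hy.1
  have h4 := hy'.1
  rcases hσ with rfl | rfl <;> rcases hσ' with rfl | rfl <;> first | rfl | linarith

/-- Two caps with a common leg have the same germ, by the identity theorem. -/
theorem cap_eventuallyEq {σ' : ℝ} {φ' : ℝ → ℝ} (h : IsLeg u x₀ t₀ φ σ J g)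
    (hc : IsCap u x₀ t₀ φ) (ht₀ : 0 < t₀) (hσ : σ = 1 ∨ σ = -1) (h' : IsLeg u x₀ t₀ φ' σ' J g)
    (hc' : IsCap u x₀ t₀ φ') (hσ' : σ' = 1 ∨ σ' = -1) : φ =ᶠ[𝓝 x₀] φ' := by
  refine (hc.analyticAt.frequently_eq_iff_eventually_eq hc'.analyticAt).1 ?_
  have hlim : Filter.Tendsto g (𝓝[<] t₀) (𝓝[≠] x₀) := by
    refine tendsto_nhdsWithin_iff.2 ⟨h.tendsto_left hc ht₀ hσ, ?_⟩
    filter_upwards [h.eventually_eq hc ht₀ hσ one_pos] with t ⟨_, y, hy, h1, _⟩ heq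
    have h2 := hy.1
    rw [mem_singleton_iff.1 heq] at h1
    rcases hσ with rfl | rfl <;> linarith
  refine hlim.frequently (Filter.Eventually.frequently ?_)
  filter_upwards [h.eventually_eq hc ht₀ hσ one_pos, h'.eventually_eq hc' ht₀ hσ' one_pos]
    with t ⟨_, y, hy, h1, h2⟩ ⟨_, y', hy', h3, h4⟩
  rw [h1, h2, ← h1, h3, h4]

theorem congr_cap {φ' : ℝ → ℝ} (h : IsLeg u x₀ t₀ φ σ J g) (he : φ =ᶠ[𝓝 x₀] φ') :
    IsLeg u x₀ t₀ φ' σ J g := by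
  refine ⟨h.toIsMaxArc, ?_⟩
  filter_upwards [h.eventually_mem, (tendsto_add_mul_nhdsGT x₀ σ).eventually he] with y h1 h2
  rwa [h2] at h1

end IsLeg

/-- The union of the two legs of a cap and of its top. -/
def capCurve (p : ℝ × ℝ) (J : Set ℝ) (g : ℝ → ℝ) (J' : Set ℝ) (g' : ℝ → ℝ) : Set (ℝ × ℝ) :=
  insert p (arcGraph J g ∪ arcGraph J' g')

/-- The family of curves into which the zero set decomposes: the maximal arcs that do not end inside
the half-plane, and the pairs of maximal arcs that end at the top of a common cap. -/
def curveFamily (u : ℝ → ℝ → ℝ) : Set (Set (ℝ × ℝ)) :=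
  {C | ∃ J g, IsMaxArc u J g ∧ C = arcGraph J g ∧ closure (arcGraph J g) ∩ halfPlane ⊆ arcGraph J g} ∪
  {C | ∃ p φ J g J' g', p ∈ halfPlane ∧ IsCap u p.1 p.2 φ ∧ IsLeg u p.1 p.2 φ 1 J g ∧
    IsLeg u p.1 p.2 φ (-1) J' g' ∧ C = capCurve p J g J' g'}

theorem IsMaxArc.isRegularAnalyticCurve {u : ℝ → ℝ → ℝ} {J : Set ℝ} {g : ℝ → ℝ}
    (h : IsMaxArc u J g) (hcl : closure (arcGraph J g) ∩ halfPlane ⊆ arcGraph J g) :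
    IsRegularAnalyticCurve (arcGraph J g) halfPlane := by
  have hsub : arcGraph J g ⊆ halfPlane := fun p hp => (h.arcGraph_subset_zeroSet hp).1
  refine ⟨hsub, ⟨?_, h.isPreconnected_arcGraph⟩, fun p hp => ?_,
    closure_diff_subset_frontier isOpen_halfPlane hsub hcl⟩
  · rw [IsVerticalArc.arcGraph_eq_image]
    exact h.nonempty.image _
  · exact exists_chart_of_graph_snd (C := arcGraph J g) (g := g) (V := Prod.snd ⁻¹' J) h.isOpen h.analytic
      (h.isOpen.preimage continuous_snd) (fun q hq => hq) (fun q hq => ⟨fun h => h.2, fun h => ⟨hq, h⟩⟩)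
      hp.1

theorem IsLeg.disjoint_arcGraph {u : ℝ → ℝ → ℝ} {x₀ t₀ : ℝ} {φ : ℝ → ℝ} {J J' : Set ℝ}
    {g g' : ℝ → ℝ} (h : IsLeg u x₀ t₀ φ 1 J g) (h' : IsLeg u x₀ t₀ φ (-1) J' g')
    (hc : IsCap u x₀ t₀ φ) (ht₀ : 0 < t₀) : Disjoint (arcGraph J g) (arcGraph J' g') := by
  rw [Set.disjoint_left]
  rintro p ⟨h1, h2⟩ ⟨h3, h4⟩
  have := h.toIsMaxArc.isLeg_of_meet h' h1 h3 (h2.symm.trans h4)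
  have := h.sign_eq hc ht₀ (Or.inl rfl) this hc (Or.inr rfl)
  norm_num at this

/-- Away from the top of its cap, a leg is an open part of the curve formed by the cap. -/
theorem exists_chart_of_leg {u : ℝ → ℝ → ℝ} (hZ : HasBranchingZeros u) {x₀ t₀ σ σ' : ℝ}
    {φ : ℝ → ℝ} {J J' : Set ℝ} {g g' : ℝ → ℝ} (h : IsLeg u x₀ t₀ φ σ J g)
    (h' : IsLeg u x₀ t₀ φ σ' J' g') (hσ : σ = 1 ∨ σ = -1) (hσ' : σ' = 1 ∨ σ' = -1)
    (hc : IsCap u x₀ t₀ φ) (ht₀ : 0 < t₀) (hdisj : Disjoint (arcGraph J g) (arcGraph J' g'))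
    {C : Set (ℝ × ℝ)} (hC : C = insert (x₀, t₀) (arcGraph J g ∪ arcGraph J' g')) {p : ℝ × ℝ}
    (hp : p ∈ arcGraph J g) :
    ∃ e : OpenPartialHomeomorph (ℝ × ℝ) (ℝ × ℝ),
      p ∈ e.source ∧ AnalyticOnNhd ℝ e e.source ∧ AnalyticOnNhd ℝ e.symm e.target ∧
        ∀ q ∈ e.source, q ∈ C ↔ (e q).2 = 0 := by
  have htop : ∀ q : ℝ × ℝ, q.2 ∈ J → q ≠ (x₀, t₀) := by
    rintro q hq rfl
    exact h.notMem hc ht₀ hσ hq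
  have hpH : p ∈ halfPlane := (h.arcGraph_subset_zeroSet hp).1
  refine exists_chart_of_graph_snd (g := g) (V := Prod.snd ⁻¹' J ∩ (closure (arcGraph J' g'))ᶜ) h.isOpen
    h.analytic ((h.isOpen.preimage continuous_snd).inter isClosed_closure.isOpen_compl)
    (fun q hq => hq.1) (fun q hq => ?_) ⟨hp.1, fun hcl => ?_⟩
  · rw [hC]
    constructor
    · rintro (h1 | h1 | h1)
      · exact absurd h1 (htop q hq.1)
      · exact h1.2
      · exact absurd (subset_closure h1) hq.2
    · exact fun h1 => Or.inr (Or.inl ⟨hq.1, h1⟩)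
  · rcases h'.closure_inter_subset hZ hc ht₀ hσ' ⟨hcl, hpH⟩ with h1 | h1
    · exact htop p hp.1 h1
    · exact Set.disjoint_left.1 hdisj hp h1

theorem isRegularAnalyticCurve_capCurve {u : ℝ → ℝ → ℝ} (hZ : HasBranchingZeros u) {p : ℝ × ℝ}
    {φ : ℝ → ℝ} {J J' : Set ℝ} {g g' : ℝ → ℝ} (hpH : p ∈ halfPlane) (hc : IsCap u p.1 p.2 φ)
    (h : IsLeg u p.1 p.2 φ 1 J g) (h' : IsLeg u p.1 p.2 φ (-1) J' g') :
    IsRegularAnalyticCurve (capCurve p J g J' g') halfPlane := by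
  obtain ⟨x₀, t₀⟩ := p
  have ht₀ : 0 < t₀ := hpH
  simp only at hc h h'
  have hdisj := h.disjoint_arcGraph h' hc ht₀
  have hcl := h.closure_inter_subset hZ hc ht₀ (Or.inl rfl)
  have hcl' := h'.closure_inter_subset hZ hc ht₀ (Or.inr rfl)
  have hm := h.mem_closure hc ht₀ (Or.inl rfl)
  have hm' := h'.mem_closure hc ht₀ (Or.inr rfl)
  have hsub : capCurve (x₀, t₀) J g J' g' ⊆ halfPlane := by
    rintro q (rfl | hq | hq)
    exacts [hpH, (h.arcGraph_subset_zeroSet hq).1, (h'.arcGraph_subset_zeroSet hq).1]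
  refine ⟨hsub, ⟨⟨_, mem_insert _ _⟩, ?_⟩, ?_, closure_diff_subset_frontier isOpen_halfPlane hsub ?_⟩
  · have h1 : IsPreconnected (insert (x₀, t₀) (arcGraph J g)) :=
      h.isPreconnected_arcGraph.subset_closure (subset_insert _ _)
        (insert_subset hm subset_closure)
    have h2 : IsPreconnected (insert (x₀, t₀) (arcGraph J' g')) :=
      h'.isPreconnected_arcGraph.subset_closure (subset_insert _ _)
        (insert_subset hm' subset_closure)
    have := h1.union (x₀, t₀) (mem_insert _ _) (mem_insert _ _) h2
    rwa [insert_union, union_insert, insert_idem] at this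
  · rintro q (rfl | hq | hq)
    · -- near the top the curve is the graph of the cap
      obtain ⟨ε, hε, hball⟩ := Metric.eventually_nhds_iff_ball.1 hc.analyticAt.eventually_analyticAt
      obtain ⟨δ₁, hδ₁, h₁⟩ := (mem_nhdsGT_iff_exists_Ioo_subset).1 h.eventually_mem
      obtain ⟨δ₂, hδ₂, h₂⟩ := (mem_nhdsGT_iff_exists_Ioo_subset).1 h'.eventually_mem
      have hδ₁0 : (0 : ℝ) < δ₁ := hδ₁
      have hδ₂0 : (0 : ℝ) < δ₂ := hδ₂
      obtain ⟨δ, hδ, hδε, hδδ₁, hδδ₂⟩ : ∃ δ, 0 < δ ∧ δ ≤ ε ∧ δ ≤ δ₁ ∧ δ ≤ δ₂ :=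
        ⟨min ε (min δ₁ δ₂), by positivity, min_le_left _ _,
          (min_le_right _ _).trans (min_le_left _ _), (min_le_right _ _).trans (min_le_right _ _)⟩
      obtain ⟨s, hs, hall⟩ := (mem_nhdsLT_iff_exists_Ioo_subset).1
        ((h.eventually_eq hc ht₀ (Or.inl rfl) hδ).and (h'.eventually_eq hc ht₀ (Or.inr rfl) hδ))
      refine exists_chart_of_graph_fst (φ := φ) (I := Ioo (x₀ - δ) (x₀ + δ))
        (V := Ioo (x₀ - δ) (x₀ + δ) ×ˢ Ioi s) isOpen_Ioo ?_
        (isOpen_Ioo.prod isOpen_Ioi) (fun q hq => hq.1) (fun q hq => ?_) ⟨⟨by linarith, by linarith⟩, hs⟩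
      · intro x hx
        refine hball x ?_
        rw [Metric.mem_ball, Real.dist_eq, abs_lt]
        exact ⟨by linarith [hx.1], by linarith [hx.2]⟩
      · obtain ⟨hqx, hqs⟩ := hq
        constructor
        · rintro (rfl | hq | hq)
          · exact hc.apply_eq.symm
          · obtain ⟨⟨_, y, hy, h1, h2⟩, -⟩ := hall ⟨hqs, h.lt_of_mem hc ht₀ (Or.inl rfl) hq.1⟩
            rw [hq.2, h1, h2]
          · obtain ⟨-, _, y, hy, h1, h2⟩ := hall ⟨hqs, h'.lt_of_mem hc ht₀ (Or.inr rfl) hq.1⟩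
            rw [hq.2, h1, h2]
        · intro he
          rcases lt_trichotomy q.1 x₀ with hlt | heq | hgt
          · have := h₂ (show x₀ - q.1 ∈ Ioo 0 δ₂ from ⟨by linarith, by linarith [hqx.1]⟩)
            rw [mem_ofPred_eq, show x₀ + -1 * (x₀ - q.1) = q.1 by ring, ← he] at this
            exact Or.inr (Or.inr ⟨this.1, this.2.symm⟩)
          · exact Or.inl (Prod.ext heq (by rw [he, heq, hc.apply_eq]))
          · have := h₁ (show q.1 - x₀ ∈ Ioo 0 δ₁ from ⟨by linarith, by linarith [hqx.2]⟩)
            rw [mem_ofPred_eq, show x₀ + 1 * (q.1 - x₀) = q.1 by ring, ← he] at this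
            exact Or.inr (Or.inl ⟨this.1, this.2.symm⟩)
    · exact exists_chart_of_leg hZ h h' (Or.inl rfl) (Or.inr rfl) hc ht₀ hdisj rfl hq
    · exact exists_chart_of_leg hZ h' h (Or.inr rfl) (Or.inl rfl) hc ht₀ hdisj.symm
        (by rw [capCurve, union_comm]) hq
  · rw [capCurve, insert_eq, closure_union, closure_union, closure_singleton]
    rintro q ⟨h1 | h1 | h1, hqH⟩
    · exact Or.inl h1
    · rcases hcl ⟨h1, hqH⟩ with h2 | h2
      exacts [Or.inl h2, Or.inr (Or.inl h2)]
    · rcases hcl' ⟨h1, hqH⟩ with h2 | h2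
      exacts [Or.inl h2, Or.inr (Or.inr h2)]

theorem isRegularAnalyticCurve_of_mem_curveFamily {u : ℝ → ℝ → ℝ} (hZ : HasBranchingZeros u)
    {C : Set (ℝ × ℝ)} (hC : C ∈ curveFamily u) : IsRegularAnalyticCurve C halfPlane := by
  rcases hC with ⟨J, g, h, rfl, hcl⟩ | ⟨p, φ, J, g, J', g', hpH, hc, h, h', rfl⟩
  · exact h.isRegularAnalyticCurve hcl
  · exact isRegularAnalyticCurve_capCurve hZ hpH hc h h'

theorem subset_zeroSet_of_mem_curveFamily {u : ℝ → ℝ → ℝ} {C : Set (ℝ × ℝ)}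
    (hC : C ∈ curveFamily u) : C ⊆ zeroSet u := by
  rcases hC with ⟨J, g, h, rfl, hcl⟩ | ⟨p, φ, J, g, J', g', hpH, hc, h, h', rfl⟩
  · exact h.arcGraph_subset_zeroSet
  · rintro q (rfl | hq | hq)
    exacts [⟨hpH, hc.u_eq_zero⟩, h.arcGraph_subset_zeroSet hq, h'.arcGraph_subset_zeroSet hq]

/-! ### Local finiteness and continuation of the curves -/

theorem capCurve_comm {p : ℝ × ℝ} {J J' : Set ℝ} {g g' : ℝ → ℝ} :
    capCurve p J g J' g' = capCurve p J' g' J g := by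
  rw [capCurve, capCurve, union_comm]

theorem mem_curveFamily_of_isLeg {u : ℝ → ℝ → ℝ} {p : ℝ × ℝ} {φ : ℝ → ℝ} {σ : ℝ} {J J' : Set ℝ}
    {g g' : ℝ → ℝ} (hp : p ∈ halfPlane) (hc : IsCap u p.1 p.2 φ) (hσ : σ = 1 ∨ σ = -1)
    (h : IsLeg u p.1 p.2 φ σ J g) (h' : IsLeg u p.1 p.2 φ (-σ) J' g') :
    capCurve p J g J' g' ∈ curveFamily u := by
  rcases hσ with rfl | rfl
  · exact Or.inr ⟨p, φ, J, g, J', g', hp, hc, h, h', rfl⟩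
  · rw [neg_neg] at h'
    exact Or.inr ⟨p, φ, J', g', J, g, hp, hc, h', h, capCurve_comm⟩

theorem neg_eq_one_or {σ : ℝ} (hσ : σ = 1 ∨ σ = -1) : -σ = 1 ∨ -σ = -1 := by
  rcases hσ with rfl | rfl <;> simp

theorem IsMaxArc.exists_mem_curveFamily {u : ℝ → ℝ → ℝ} (hZ : HasBranchingZeros u) {J : Set ℝ}
    {g : ℝ → ℝ} (h : IsMaxArc u J g) : ∃ C ∈ curveFamily u, arcGraph J g ⊆ C := by
  by_cases hcl : closure (arcGraph J g) ∩ halfPlane ⊆ arcGraph J g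
  · exact ⟨_, Or.inl ⟨J, g, h, rfl, hcl⟩, subset_rfl⟩
  · obtain ⟨p, ⟨hp, hpH⟩, hpJ⟩ := not_subset.1 hcl
    obtain ⟨φ, hc, σ, hσ, hl⟩ := h.exists_cap_of_mem_closure hZ hp hpH hpJ
    obtain ⟨J', g', hl', -⟩ := hc.exists_isLeg hZ hpH (neg_eq_one_or hσ)
    exact ⟨_, mem_curveFamily_of_isLeg hpH hc hσ hl hl',
      subset_union_left.trans (subset_insert _ _)⟩

theorem IsCap.tendsto_graph {u : ℝ → ℝ → ℝ} {x₀ t₀ : ℝ} {φ : ℝ → ℝ} (hc : IsCap u x₀ t₀ φ) :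
    Filter.Tendsto (fun x => (x, φ x)) (𝓝 x₀) (𝓝 (x₀, t₀)) := by
  have h : ContinuousAt (fun x => (x, φ x)) x₀ := continuousAt_id.prodMk hc.analyticAt.continuousAt
  simpa [ContinuousAt, hc.apply_eq] using h

theorem IsStem.tendsto_graph {u : ℝ → ℝ → ℝ} {x₀ t₀ : ℝ} {ψ : ℝ → ℝ} (hs : IsStem u x₀ t₀ ψ) :
    Filter.Tendsto (fun t => (ψ t, t)) (𝓝 t₀) (𝓝 (x₀, t₀)) := by
  have h : ContinuousAt (fun t => (ψ t, t)) t₀ := hs.analyticAt.continuousAt.prodMk continuousAt_id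
  simpa [ContinuousAt, hs.apply_eq] using h

theorem IsCap.exists_mem_curveFamily {u : ℝ → ℝ → ℝ} (hZ : HasBranchingZeros u) {p : ℝ × ℝ}
    {φ : ℝ → ℝ} (hp : p ∈ halfPlane) (hc : IsCap u p.1 p.2 φ) :
    ∃ C ∈ curveFamily u, p ∈ C ∧ ∀ᶠ q in 𝓝 p, q.2 = φ q.1 → q ∈ C := by
  obtain ⟨J₁, g₁, hl₁, δ₁, hδ₁, h₁⟩ := hc.exists_isLeg hZ hp (Or.inl rfl)
  obtain ⟨J₂, g₂, hl₂, δ₂, hδ₂, h₂⟩ := hc.exists_isLeg hZ hp (Or.inr rfl)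
  refine ⟨_, Or.inr ⟨p, φ, J₁, g₁, J₂, g₂, hp, hc, hl₁, hl₂, rfl⟩, mem_insert _ _, ?_⟩
  have hx : ∀ᶠ x in 𝓝 p.1, x ∈ Ioo (p.1 - δ₂) (p.1 + δ₁) :=
    Ioo_mem_nhds (by linarith) (by linarith)
  filter_upwards [continuousAt_fst.eventually hx] with q hq he
  rcases lt_trichotomy q.1 p.1 with hlt | heq | hgt
  · have := h₂ (p.1 - q.1) ⟨by linarith, by linarith [hq.1]⟩
    rw [show p.1 + -1 * (p.1 - q.1) = q.1 by ring, ← he] at this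
    exact Or.inr (Or.inr ⟨this.1, this.2.symm⟩)
  · exact Or.inl (Prod.ext heq (by rw [he, heq, hc.apply_eq]))
  · have := h₁ (q.1 - p.1) ⟨by linarith, by linarith [hq.2]⟩
    rw [show p.1 + 1 * (q.1 - p.1) = q.1 by ring, ← he] at this
    exact Or.inr (Or.inl ⟨this.1, this.2.symm⟩)

theorem IsStem.exists_mem_curveFamily {u : ℝ → ℝ → ℝ} (hZ : HasBranchingZeros u) {p : ℝ × ℝ}
    {ψ : ℝ → ℝ} (hp : p ∈ halfPlane) (hs : IsStem u p.1 p.2 ψ) :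
    ∃ C ∈ curveFamily u, p ∈ C ∧ ∀ᶠ q in 𝓝 p, q.1 = ψ q.2 → q ∈ C := by
  obtain ⟨ε, hε, harc⟩ := hs.exists_isVerticalArc hp
  obtain ⟨J, g, h, hJ, hg⟩ := harc.exists_isMaxArc hZ (Metric.mem_ball_self hε)
  obtain ⟨C, hC, hsub⟩ := h.exists_mem_curveFamily hZ
  have hmem : ∀ q : ℝ × ℝ, q.2 ∈ Metric.ball p.2 ε → q.1 = ψ q.2 → q ∈ C := fun q hq he =>
    hsub ⟨hJ hq, by rw [he, hg hq]⟩
  refine ⟨C, hC, hmem p (Metric.mem_ball_self hε) hs.apply_eq.symm, ?_⟩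
  filter_upwards [continuousAt_snd.eventually (Metric.ball_mem_nhds p.2 hε)] with q hq using hmem q hq

/-- Near each zero, the zero set is covered by finitely many curves through this zero. -/
theorem exists_finite_cover {u : ℝ → ℝ → ℝ} (hZ : HasBranchingZeros u) {p : ℝ × ℝ}
    (hp : p ∈ zeroSet u) : ∃ B ⊆ curveFamily u, B.Finite ∧ (∀ C ∈ B, p ∈ C) ∧
      ∀ᶠ q in 𝓝 p, q ∈ zeroSet u → ∃ C ∈ B, q ∈ C := by
  obtain ⟨Φ, Ψ, hb, -⟩ := hZ.exists_branching p hp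
  have h1 : ∀ φ, ∃ C, φ ∈ Φ → C ∈ curveFamily u ∧ p ∈ C ∧ ∀ᶠ q in 𝓝 p, q.2 = φ q.1 → q ∈ C := by
    intro φ
    by_cases hφ : φ ∈ Φ
    · obtain ⟨C, h⟩ := (hb.isCap φ hφ).exists_mem_curveFamily hZ hp.1
      exact ⟨C, fun _ => h⟩
    · exact ⟨∅, fun h => absurd h hφ⟩
  have h2 : ∀ ψ, ∃ C, ψ ∈ Ψ → C ∈ curveFamily u ∧ p ∈ C ∧ ∀ᶠ q in 𝓝 p, q.1 = ψ q.2 → q ∈ C := by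
    intro ψ
    by_cases hψ : ψ ∈ Ψ
    · obtain ⟨C, h⟩ := (hb.isStem ψ hψ).exists_mem_curveFamily hZ hp.1
      exact ⟨C, fun _ => h⟩
    · exact ⟨∅, fun h => absurd h hψ⟩
  choose c hc using h1
  choose d hd using h2
  refine ⟨c '' Φ ∪ d '' Ψ, ?_, (hb.finite.image c).union (hb.subsingleton.finite.image d), ?_, ?_⟩
  · rintro _ (⟨φ, hφ, rfl⟩ | ⟨ψ, hψ, rfl⟩)
    exacts [(hc φ hφ).1, (hd ψ hψ).1]
  · rintro _ (⟨φ, hφ, rfl⟩ | ⟨ψ, hψ, rfl⟩)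
    exacts [(hc φ hφ).2.1, (hd ψ hψ).2.1]
  · filter_upwards [hb.cover, (Filter.eventually_all_finite hb.finite).2 fun φ hφ => (hc φ hφ).2.2,
      (Filter.eventually_all_finite hb.subsingleton.finite).2 fun ψ hψ => (hd ψ hψ).2.2]
      with q hq h1 h2 hqZ
    rcases hq hqZ.2 with ⟨φ, hφ, he⟩ | ⟨ψ, hψ, he⟩
    · exact ⟨c φ, Or.inl ⟨φ, hφ, rfl⟩, h1 φ hφ he⟩
    · exact ⟨d ψ, Or.inr ⟨ψ, hψ, rfl⟩, h2 ψ hψ he⟩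

theorem sUnion_curveFamily {u : ℝ → ℝ → ℝ} (hZ : HasBranchingZeros u) :
    ⋃₀ curveFamily u = zeroSet u := by
  refine (sUnion_subset fun C hC => subset_zeroSet_of_mem_curveFamily hC).antisymm fun p hp => ?_
  obtain ⟨B, hB, -, -, hcov⟩ := exists_finite_cover hZ hp
  obtain ⟨C, hC, hpC⟩ := hcov.self_of_nhds hp
  exact ⟨C, hB hC, hpC⟩

/-- Zeros near a given zero are regular, except possibly this zero itself. -/
theorem eventually_mem_regularZeros {u : ℝ → ℝ → ℝ} (hZ : HasBranchingZeros u) {p : ℝ × ℝ}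
    (hp : p ∈ zeroSet u) : ∀ᶠ q in 𝓝 p, q ≠ p → q ∈ zeroSet u → q ∈ regularZeros u := by
  obtain ⟨Φ, Ψ, hb, -⟩ := hZ.exists_branching p hp
  filter_upwards [eventually_nhdsWithin_iff.1 hb.regular] with q hq hne hqZ
  refine ⟨hqZ, ?_⟩
  rcases hq hne hqZ.2 with h | h
  · exact (add_pos_of_nonneg_of_pos (sq_nonneg _) (sq_pos_of_ne_zero h)).ne'
  · exact (add_pos_of_pos_of_nonneg (sq_pos_of_ne_zero h) (sq_nonneg _)).ne'

theorem frequently_mem_of_mem_curveFamily {u : ℝ → ℝ → ℝ} {C : Set (ℝ × ℝ)}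
    (hC : C ∈ curveFamily u) {p : ℝ × ℝ} (hp : p ∈ C) : ∃ᶠ q in 𝓝[≠] p, q ∈ C := by
  rcases hC with ⟨J, g, h, rfl, -⟩ | ⟨p₀, φ, J, g, J', g', hpH, hc, h, h', rfl⟩
  · exact h.frequently_mem_arcGraph hp
  · rcases hp with rfl | hp | hp
    · have hcl := h.mem_closure hc hpH (Or.inl rfl)
      have hnot : p ∉ arcGraph J g := fun hpJ => h.notMem hc hpH (Or.inl rfl) hpJ.1
      rw [← sdiff_singleton_eq_self hnot] at hcl
      exact (mem_closure_ne_iff_frequently_within.1 hcl).mono fun q hq => Or.inr (Or.inl hq)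
    · exact (h.frequently_mem_arcGraph hp).mono fun q hq => Or.inr (Or.inl hq)
    · exact (h'.frequently_mem_arcGraph hp).mono fun q hq => Or.inr (Or.inr hq)

/-- There is no cap at a zero where the zero set is a single stem: the two halves of the cap reach
the same times. -/
theorem IsLocalBranching.not_isCap {u : ℝ → ℝ → ℝ} {x₀ t₀ : ℝ} {ψ : ℝ → ℝ} (ht₀ : 0 < t₀)
    (hb : IsLocalBranching u x₀ t₀ ∅ {ψ}) (φ : ℝ → ℝ) : ¬ IsCap u x₀ t₀ φ := by
  intro hc
  have hev : ∀ᶠ x in 𝓝 x₀, x = ψ (φ x) := by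
    filter_upwards [hc.tendsto_graph.eventually hb.cover, hc.zero] with x h1 h2
    simpa using h1 h2
  obtain ⟨ε, hε, hball⟩ := Metric.eventually_nhds_iff_ball.1 hev
  obtain ⟨t, ⟨y, hy, h1⟩, y', hy', h2⟩ := ((hc.eventually_exists ht₀ (Or.inl rfl) hε).and
    (hc.eventually_exists ht₀ (Or.inr rfl) hε)).exists
  have h3 := hball (x₀ + 1 * y) (by
    rw [Metric.mem_ball, Real.dist_eq, abs_lt]; constructor <;> linarith [hy.1, hy.2])
  have h4 := hball (x₀ + -1 * y') (by
    rw [Metric.mem_ball, Real.dist_eq, abs_lt]; constructor <;> linarith [hy'.1, hy'.2])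
  rw [h1] at h3
  rw [h2] at h4
  linarith [hy.1, hy'.1]

/-- A curve of the family that contains a point of a maximal arc, other than the top of a cap, is
the curve that arises from this arc. -/
theorem IsMaxArc.eq_arcGraph_or_capCurve {u : ℝ → ℝ → ℝ} {J : Set ℝ} {g : ℝ → ℝ}
    (h : IsMaxArc u J g) {C : Set (ℝ × ℝ)} (hC : C ∈ curveFamily u) {q : ℝ × ℝ}
    (hq : q ∈ arcGraph J g) (hqC : q ∈ C) (hcap : ∀ φ, ¬ IsCap u q.1 q.2 φ) :
    (C = arcGraph J g ∧ closure (arcGraph J g) ∩ halfPlane ⊆ arcGraph J g) ∨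
      ∃ p φ σ J' g', p ∈ halfPlane ∧ IsCap u p.1 p.2 φ ∧ (σ = 1 ∨ σ = -1) ∧
        IsLeg u p.1 p.2 φ σ J g ∧ IsLeg u p.1 p.2 φ (-σ) J' g' ∧ C = capCurve p J g J' g' := by
  have hmeet : ∀ {J₁ : Set ℝ} {g₁ : ℝ → ℝ}, IsMaxArc u J₁ g₁ → q ∈ arcGraph J₁ g₁ →
      arcGraph J₁ g₁ = arcGraph J g := by
    intro J₁ g₁ h₁ hq₁
    obtain ⟨h2, h3⟩ := h₁.eq_of_meet h hq₁.1 hq.1 (hq₁.2.symm.trans hq.2)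
    exact arcGraph_congr h2 h3
  rcases hC with ⟨J₁, g₁, h₁, rfl, hcl⟩ | ⟨p, φ, J₁, g₁, J₂, g₂, hpH, hc, h₁, h₂, rfl⟩
  · rw [hmeet h₁ hqC] at hcl ⊢
    exact Or.inl ⟨rfl, hcl⟩
  · rcases hqC with rfl | hq₁ | hq₂
    · exact absurd hc (hcap φ)
    · refine Or.inr ⟨p, φ, 1, J₂, g₂, hpH, hc, Or.inl rfl, ?_, h₂, ?_⟩
      · exact h.isLeg_of_meet h₁ hq.1 hq₁.1 (hq.2.symm.trans hq₁.2)
      · rw [capCurve, capCurve, hmeet h₁.toIsMaxArc hq₁]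
    · refine Or.inr ⟨p, φ, -1, J₁, g₁, hpH, hc, Or.inr rfl, ?_, by rwa [neg_neg], ?_⟩
      · exact h.isLeg_of_meet h₂ hq.1 hq₂.1 (hq.2.symm.trans hq₂.2)
      · rw [capCurve_comm, capCurve, capCurve, hmeet h₂.toIsMaxArc hq₂]

/-- Through each regular zero there passes only one curve of the family. -/
theorem eq_of_mem_regularZeros {u : ℝ → ℝ → ℝ} (hZ : HasBranchingZeros u) {q : ℝ × ℝ}
    (hq : q ∈ regularZeros u) {C C' : Set (ℝ × ℝ)} (hC : C ∈ curveFamily u)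
    (hC' : C' ∈ curveFamily u) (hqC : q ∈ C) (hqC' : q ∈ C') : C = C' := by
  obtain ⟨Φ, Ψ, hb, hreg⟩ := hZ.exists_branching q hq.1
  have ht₀ : 0 < q.2 := hq.1.1
  rcases hreg hq with ⟨φ, rfl, rfl⟩ | ⟨ψ, rfl, rfl⟩
  · have harc : ∀ {J g}, IsMaxArc u J g → q ∉ arcGraph J g := by
      intro J g h hqJ
      obtain ⟨t, ψ, hψ, -⟩ := (h.eventually_stem ht₀ hb hqJ.1 hqJ.2.symm).exists
      exact hψ
    -- a curve through `q` consists of the legs of the only cap at `q`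
    have key : ∀ {C}, C ∈ curveFamily u → q ∈ C → ∃ J g J' g', IsLeg u q.1 q.2 φ 1 J g ∧
        IsLeg u q.1 q.2 φ (-1) J' g' ∧ C = capCurve q J g J' g' := by
      rintro C (⟨J, g, h, rfl, -⟩ | ⟨p, φ', J, g, J', g', hpH, hc, h, h', rfl⟩) hqC
      · exact absurd hqC (harc h)
      · rcases hqC with rfl | hqC | hqC
        · have he : φ' =ᶠ[𝓝 q.1] φ := by
            filter_upwards [hc.tendsto_graph.eventually hb.cover, hc.zero] with x h1 h2
            simpa using h1 h2
          exact ⟨J, g, J', g', h.congr_cap he, h'.congr_cap he, rfl⟩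
        · exact absurd hqC (harc h.toIsMaxArc)
        · exact absurd hqC (harc h'.toIsMaxArc)
    obtain ⟨J₁, g₁, J₂, g₂, h₁, h₂, rfl⟩ := key hC hqC
    obtain ⟨J₃, g₃, J₄, g₄, h₃, h₄, rfl⟩ := key hC' hqC'
    obtain ⟨e1, e2⟩ := h₁.eq_of_isLeg h₃
    obtain ⟨e3, e4⟩ := h₂.eq_of_isLeg h₄
    rw [capCurve, capCurve, arcGraph_congr e1 e2, arcGraph_congr e3 e4]
  · have hcap := hb.not_isCap ht₀
    obtain ⟨J, g, h, hqJ⟩ : ∃ J g, IsMaxArc u J g ∧ q ∈ arcGraph J g := by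
      rcases hC with ⟨J, g, h, rfl, -⟩ | ⟨p, φ, J, g, J', g', hpH, hc, h, h', rfl⟩
      · exact ⟨J, g, h, hqC⟩
      · rcases hqC with rfl | hqC | hqC
        exacts [absurd hc (hcap φ), ⟨J, g, h.toIsMaxArc, hqC⟩, ⟨J', g', h'.toIsMaxArc, hqC⟩]
    -- a maximal arc that does not end in the half-plane is not a leg
    have hend : ∀ {p φ σ}, closure (arcGraph J g) ∩ halfPlane ⊆ arcGraph J g → p ∈ halfPlane →
        IsCap u p.1 p.2 φ → (σ = 1 ∨ σ = -1) → ¬ IsLeg u p.1 p.2 φ σ J g := by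
      intro p φ σ hcl hpH hc hσ hl
      exact hl.notMem hc hpH hσ (hcl ⟨hl.mem_closure hc hpH hσ, hpH⟩).1
    rcases h.eq_arcGraph_or_capCurve hC hqJ hqC hcap with
      ⟨rfl, hcl⟩ | ⟨p, φ, σ, J₁, g₁, hp, hc, hσ, h₁, h₂, rfl⟩ <;>
    rcases h.eq_arcGraph_or_capCurve hC' hqJ hqC' hcap with
      ⟨rfl, hcl'⟩ | ⟨p', φ', σ', J₁', g₁', hp', hc', hσ', h₁', h₂', rfl⟩
    · rfl
    · exact absurd h₁' (hend hcl hp' hc' hσ')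
    · exact absurd h₁ (hend hcl' hp hc hσ)
    · obtain ⟨e1, e2⟩ := h₁.top_eq hc hp hσ h₁' hc' hp' hσ'
      obtain rfl : p = p' := Prod.ext e1 e2
      obtain rfl := h₁.sign_eq hc hp hσ h₁' hc' hσ'
      have he := h₁.cap_eventuallyEq hc hp hσ h₁' hc' hσ'
      obtain ⟨e3, e4⟩ := (h₂.congr_cap he).eq_of_isLeg h₂'
      rw [capCurve, capCurve, arcGraph_congr e3 e4]

theorem locallyFiniteIn_curveFamily {u : ℝ → ℝ → ℝ} (hZ : HasBranchingZeros u) :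
    LocallyFiniteIn (curveFamily u) halfPlane := by
  intro p hpH
  by_cases hp : p ∈ zeroSet u
  · obtain ⟨B, hB, hfin, -, hcov⟩ := exists_finite_cover hZ hp
    have hV := hcov.and (eventually_mem_regularZeros hZ hp)
    refine ⟨_, hV, hfin.subset ?_⟩
    have key : ∀ {C q}, C ∈ curveFamily u → q ∈ C → q ≠ p →
        ((q ∈ zeroSet u → ∃ C ∈ B, q ∈ C) ∧ (q ≠ p → q ∈ zeroSet u → q ∈ regularZeros u)) →
        C ∈ B := by
      intro C q hC hqC hne hq
      have hqZ := subset_zeroSet_of_mem_curveFamily hC hqC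
      obtain ⟨C', hC', hqC'⟩ := hq.1 hqZ
      rwa [eq_of_mem_regularZeros hZ (hq.2 hne hqZ) hC (hB hC') hqC hqC']
    rintro C ⟨hC, q, hqC, hqV⟩
    by_cases hne : q = p
    · obtain ⟨q', h1, h2, h3⟩ := ((frequently_mem_of_mem_curveFamily hC (hne ▸ hqC)).and_eventually
        ((hV.filter_mono nhdsWithin_le_nhds).and self_mem_nhdsWithin)).exists
      exact key hC h1 h3 h2
    · exact key hC hqC hne hqV
  · have hu : u p.1 p.2 ≠ 0 := fun h => hp ⟨hpH, h⟩
    refine ⟨_, (hZ.continuousOn.continuousAt (isOpen_halfPlane.mem_nhds hpH)).eventually_ne hu, ?_⟩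
    refine finite_empty.subset ?_
    rintro C ⟨hC, q, hqC, hqV⟩
    exact hqV (subset_zeroSet_of_mem_curveFamily hC hqC).2

theorem exists_curve_of_isConnected {u : ℝ → ℝ → ℝ} (hZ : HasBranchingZeros u)
    {Γ : Set (ℝ × ℝ)} (hΓ : IsConnected Γ) (hreg : Γ ⊆ regularZeros u) :
    ∃ C ∈ curveFamily u, Γ ⊆ C := by
  obtain ⟨q₀, hq₀⟩ := hΓ.nonempty
  obtain ⟨C, hC, hq₀C⟩ : q₀ ∈ ⋃₀ curveFamily u := by
    rw [sUnion_curveFamily hZ]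
    exact (hreg hq₀).1
  refine ⟨C, hC, fun q hq => ?_⟩
  -- lying on the same curve is a locally constant relation on the regular zeros
  refine hΓ.isPreconnected.induction₂' (fun q q' => ∀ C ∈ curveFamily u, q ∈ C → q' ∈ C)
    (fun p hp => ?_) (fun _ _ _ _ _ _ h1 h2 C hC h => h2 C hC (h1 C hC h)) hq₀ hq C hC hq₀C
  obtain ⟨B, hB, -, hpB, hcov⟩ := exists_finite_cover hZ (hreg hp).1
  filter_upwards [nhdsWithin_le_nhds hcov, self_mem_nhdsWithin] with q h1 hqΓ
  obtain ⟨C', hC', hqC'⟩ := h1 (hreg hqΓ).1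
  constructor
  · intro C hC hpC
    rwa [eq_of_mem_regularZeros hZ (hreg hp) hC (hB hC') hpC (hpB C' hC')]
  · intro C hC hqC
    rw [eq_of_mem_regularZeros hZ (hreg hqΓ) hC (hB hC') hqC hqC']
    exact hpB C' hC'

theorem exists_isOpen_forall_mem_curve {u : ℝ → ℝ → ℝ} (hZ : HasBranchingZeros u) {p : ℝ × ℝ}
    (hp : p ∈ zeroSet u) : ∃ U : Set (ℝ × ℝ), IsOpen U ∧ p ∈ U ∧ U ⊆ halfPlane ∧
      ∀ q ∈ zeroSet u ∩ U, ∃ C ∈ curveFamily u, p ∈ C ∧ q ∈ C := by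
  obtain ⟨B, hB, -, hpB, hcov⟩ := exists_finite_cover hZ hp
  obtain ⟨U, hU, hUo, hpU⟩ := eventually_nhds_iff.1 hcov
  refine ⟨U ∩ halfPlane, hUo.inter isOpen_halfPlane, ⟨hpU, hp.1⟩, inter_subset_right, ?_⟩
  rintro q ⟨hqZ, hqU, -⟩
  obtain ⟨C, hC, hqC⟩ := hU q hqU hqZ
  exact ⟨C, hB hC, hpB C hC, hqC⟩

/-! ### The zero set near a regular zero -/

theorem closure_zeroSet_inter_subset {u : ℝ → ℝ → ℝ}
    (hu : ContinuousOn (fun p : ℝ × ℝ => u p.1 p.2) halfPlane) :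
    closure (zeroSet u) ∩ halfPlane ⊆ zeroSet u := by
  rintro p ⟨hp, hpH⟩
  refine ⟨hpH, ?_⟩
  by_contra hne
  obtain ⟨q, hq1, hq2⟩ := ((mem_closure_iff_frequently.1 hp).and_eventually
    ((hu.continuousAt (isOpen_halfPlane.mem_nhds hpH)).eventually_ne hne)).exists
  exact hq2 hq1.2

theorem exists_isRegularAnalyticCurve_of_mem_regularZeros {u : ℝ → ℝ → ℝ}
    (hZ : HasBranchingZeros u) {p : ℝ × ℝ} (hp : p ∈ regularZeros u) :
    ∃ U : Set (ℝ × ℝ), IsOpen U ∧ p ∈ U ∧ U ⊆ halfPlane ∧ zeroSet u ∩ U ⊆ regularZeros u ∧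
      IsRegularAnalyticCurve (zeroSet u ∩ U) U := by
  obtain ⟨Φ, Ψ, hb, hreg⟩ := hZ.exists_branching p hp.1
  have hev : ∀ᶠ q in 𝓝 p, q ∈ halfPlane ∧ (q ∈ zeroSet u → q ∈ regularZeros u) := by
    filter_upwards [isOpen_halfPlane.mem_nhds hp.1.1, eventually_mem_regularZeros hZ hp.1]
      with q h1 h2
    refine ⟨h1, fun hqZ => ?_⟩
    by_cases hne : q = p
    exacts [hne ▸ hp, h2 hne hqZ]
  obtain ⟨r, hr, hball⟩ := Metric.eventually_nhds_iff_ball.1 (hev.and hb.cover)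
  have hprod : ∀ {q : ℝ × ℝ}, q.1 ∈ Metric.ball p.1 r → q.2 ∈ Metric.ball p.2 r →
      q ∈ Metric.ball p r := by
    intro q h1 h2
    rw [← ball_prod_same]
    exact ⟨h1, h2⟩
  -- it remains to find a box in which the zero set is connected and flattened by a chart
  suffices H : ∃ U : Set (ℝ × ℝ), IsOpen U ∧ p ∈ U ∧ U ⊆ Metric.ball p r ∧
      IsPreconnected (zeroSet u ∩ U) ∧ IsAnalyticSubmanifoldOne (zeroSet u ∩ U) by
    obtain ⟨U, hU, hpU, hUr, h1, h2⟩ := H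
    have hUH : U ⊆ halfPlane := fun q hq => (hball q (hUr hq)).1.1
    refine ⟨U, hU, hpU, hUH, fun q hq => (hball q (hUr hq.2)).1.2 hq.1, inter_subset_right,
      ⟨⟨p, hp.1, hpU⟩, h1⟩, h2, closure_diff_subset_frontier hU inter_subset_right ?_⟩
    rintro q ⟨hq, hqU⟩
    exact ⟨closure_zeroSet_inter_subset hZ.continuousOn
      ⟨closure_mono inter_subset_left hq, hUH hqU⟩, hqU⟩
  rcases hreg hp with ⟨φ, rfl, rfl⟩ | ⟨ψ, rfl, rfl⟩
  · have hc := hb.isCap φ rfl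
    obtain ⟨δ, hδ, hδball⟩ := Metric.eventually_nhds_iff_ball.1
      ((hc.analyticAt.eventually_analyticAt.and hc.zero).and
        (hc.tendsto_graph.eventually (Metric.ball_mem_nhds p hr)))
    have hU : IsOpen (Metric.ball p.1 (min δ r) ×ˢ Metric.ball p.2 r) :=
      Metric.isOpen_ball.prod Metric.isOpen_ball
    have hδ' : ∀ {x}, x ∈ Metric.ball p.1 (min δ r) → x ∈ Metric.ball p.1 δ := fun h =>
      Metric.ball_subset_ball (min_le_left _ _) h
    have hsub : Metric.ball p.1 (min δ r) ×ˢ Metric.ball p.2 r ⊆ Metric.ball p r := fun q hq =>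
      hprod (Metric.ball_subset_ball (min_le_right _ _) hq.1) hq.2
    have hiff : ∀ q ∈ Metric.ball p.1 (min δ r) ×ˢ Metric.ball p.2 r,
        q ∈ zeroSet u ∩ Metric.ball p.1 (min δ r) ×ˢ Metric.ball p.2 r ↔ q.2 = φ q.1 := by
      intro q hq
      have h1 := hball q (hsub hq)
      refine ⟨fun h => by simpa using h1.2 h.1.2, fun h => ⟨⟨h1.1.1, ?_⟩, hq⟩⟩
      rw [h]
      exact (hδball q.1 (hδ' hq.1)).1.2
    refine ⟨_, hU, ⟨Metric.mem_ball_self (lt_min hδ hr), Metric.mem_ball_self hr⟩, hsub, ?_, ?_⟩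
    · have : zeroSet u ∩ Metric.ball p.1 (min δ r) ×ˢ Metric.ball p.2 r =
          (fun x => (x, φ x)) '' Metric.ball p.1 (min δ r) := by
        ext q
        constructor
        · exact fun h => ⟨q.1, h.2.1, Prod.ext rfl ((hiff q h.2).1 h).symm⟩
        · rintro ⟨x, hx, rfl⟩
          have h1 := (hδball x (hδ' hx)).2
          rw [← Metric.mem_ball, ← ball_prod_same] at h1
          exact (hiff _ ⟨hx, h1.2⟩).2 rfl
      rw [this]
      exact (convex_ball _ _).isPreconnected.image _ (continuousOn_id.prodMk fun x hx =>
        (hδball x (hδ' hx)).1.1.continuousAt.continuousWithinAt)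
    · intro q hq
      exact exists_chart_of_graph_fst (φ := φ) Metric.isOpen_ball (fun x hx => (hδball x (hδ' hx)).1.1)
        hU (fun q hq => hq.1) hiff hq.2
  · have hs := hb.isStem ψ rfl
    obtain ⟨δ, hδ, hδball⟩ := Metric.eventually_nhds_iff_ball.1
      ((hs.analyticAt.eventually_analyticAt.and hs.zero).and
        (hs.tendsto_graph.eventually (Metric.ball_mem_nhds p hr)))
    have hU : IsOpen (Metric.ball p.1 r ×ˢ Metric.ball p.2 (min δ r)) :=
      Metric.isOpen_ball.prod Metric.isOpen_ball
    have hδ' : ∀ {t}, t ∈ Metric.ball p.2 (min δ r) → t ∈ Metric.ball p.2 δ := fun h =>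
      Metric.ball_subset_ball (min_le_left _ _) h
    have hsub : Metric.ball p.1 r ×ˢ Metric.ball p.2 (min δ r) ⊆ Metric.ball p r := fun q hq =>
      hprod hq.1 (Metric.ball_subset_ball (min_le_right _ _) hq.2)
    have hiff : ∀ q ∈ Metric.ball p.1 r ×ˢ Metric.ball p.2 (min δ r),
        q ∈ zeroSet u ∩ Metric.ball p.1 r ×ˢ Metric.ball p.2 (min δ r) ↔ q.1 = ψ q.2 := by
      intro q hq
      have h1 := hball q (hsub hq)
      refine ⟨fun h => by simpa using h1.2 h.1.2, fun h => ⟨⟨h1.1.1, ?_⟩, hq⟩⟩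
      rw [h]
      exact (hδball q.2 (hδ' hq.2)).1.2
    refine ⟨_, hU, ⟨Metric.mem_ball_self hr, Metric.mem_ball_self (lt_min hδ hr)⟩, hsub, ?_, ?_⟩
    · have : zeroSet u ∩ Metric.ball p.1 r ×ˢ Metric.ball p.2 (min δ r) =
          (fun t => (ψ t, t)) '' Metric.ball p.2 (min δ r) := by
        ext q
        constructor
        · exact fun h => ⟨q.2, h.2.2, Prod.ext ((hiff q h.2).1 h).symm rfl⟩
        · rintro ⟨t, ht, rfl⟩
          have h1 := (hδball t (hδ' ht)).2
          rw [← Metric.mem_ball, ← ball_prod_same] at h1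
          exact (hiff _ ⟨h1.1, ht⟩).2 rfl
      rw [this]
      exact (convex_ball _ _).isPreconnected.image _ (ContinuousOn.prodMk (fun t ht =>
        (hδball t (hδ' ht)).1.1.continuousAt.continuousWithinAt) continuousOn_id)
    · intro q hq
      exact exists_chart_of_graph_snd (g := ψ) Metric.isOpen_ball (fun t ht => (hδball t (hδ' ht)).1.1)
        hU (fun q hq => hq.2) hiff hq.2

theorem mainTheorem5 (u : ℝ → ℝ → ℝ) (hu : IsHeatSolution u)
    (hbdd : ∃ M : ℝ, ∀ x t : ℝ, 0 < t → |u x t| ≤ M)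
    (hnontrivial : ∃ x t : ℝ, 0 < t ∧ u x t ≠ 0) :
    -- near each regular zero, the zero set is a regular analytic curve
    (∀ p ∈ regularZeros u, ∃ U : Set (ℝ × ℝ), IsOpen U ∧ p ∈ U ∧ U ⊆ halfPlane ∧
      zeroSet u ∩ U ⊆ regularZeros u ∧ IsRegularAnalyticCurve (zeroSet u ∩ U) U) ∧
    -- the zero set is a locally finite union of regular analytic curves
    ∃ F : Set (Set (ℝ × ℝ)),
      (∀ C ∈ F, IsRegularAnalyticCurve C halfPlane) ∧
      LocallyFiniteIn F halfPlane ∧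
      ⋃₀ F = zeroSet u ∧
      -- these curves continue all the regular analytic curves made of regular zeros
      (∀ U Γ : Set (ℝ × ℝ), IsOpen U → U ⊆ halfPlane → IsRegularAnalyticCurve Γ U →
        Γ ⊆ regularZeros u → ∃ C ∈ F, Γ ⊆ C) ∧
      -- near a singular zero, every zero lies on one of the curves passing through it
      (∀ p ∈ singularZeros u, ∃ U : Set (ℝ × ℝ), IsOpen U ∧ p ∈ U ∧ U ⊆ halfPlane ∧
        ∀ q ∈ zeroSet u ∩ U, ∃ C ∈ F, p ∈ C ∧ q ∈ C) := by
  have hZ := hu.hasBranchingZeros hbdd hnontrivial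
  exact ⟨fun p hp => exists_isRegularAnalyticCurve_of_mem_regularZeros hZ hp, curveFamily u,
    fun C hC => isRegularAnalyticCurve_of_mem_curveFamily hZ hC, locallyFiniteIn_curveFamily hZ,
    sUnion_curveFamily hZ,
    fun U Γ _ _ hΓ hreg => exists_curve_of_isConnected hZ hΓ.isConnected hreg,
    fun p hp => exists_isOpen_forall_mem_curve hZ hp.1⟩
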